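/- Let $\phi:\mathbb{R}\to[0,\infty]$ be a proper closed convex function with $\phi(1)=0$ whose domain is an interval with endpoints $a_\phi<1<b_\phi$, strictly convex and four times continuously differentiable on $]a_\phi,b_\phi[$, and essentially smooth ($\phi'(x)\to-\infty$ as $x\downarrow a_\phi$ if $a_\phi>-\infty$, and $\phi'(x)\to+\infty$ as $x\uparrow b_\phi$ if $b_\phi<\infty$). For probability measures put $D_\phi(Q,P)=\int\phi(dQ/dP)\,dP$ if $Q\ll P$, and $D_\phi(Q,P)=\infty$ otherwise. Let $\{P_\alpha;\alpha\in\Theta\}$, $\Theta\subseteq\mathbb{R}^d$, be an identifiable family of probability measures on a measurable space with densities $p_\alpha$ with respect to a $\sigma$-finite measure $\lambda$, with common support (for $\lambda$-a.e. $x$, either $p_\alpha(x)>0$ for all $\alpha\in\Theta$ or $p_\alpha(x)=0$ for all $\alpha\in\Theta$). Let $\theta\in\Theta$ and let $\theta_T$ be an interior point of $\Theta$. Assume that for $\lambda$-a.e. $x$ the function $\alpha\mapsto p_\alpha(x)$ has continuous partial derivatives up to order $3$ on the interior of $\Theta$; that for $P_\theta$-a.e. $x$ the ratios $p_\theta(x)/p_\alpha(x)$,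 $\alpha\in\Theta$, lie in $]a_\phi,b_\phi[$; and that $\int|\phi'(p_\theta/p_\alpha)|\,dP_\theta<\infty$ for all $\alpha\in\Theta$. Write $Pf=\int f\,dP$ and $$f(\theta,\alpha,x)=\phi'\Big(\tfrac{p_\theta(x)}{p_\alpha(x)}\Big),\quad g(\theta,\alpha,x)=\tfrac{p_\theta(x)}{p_\alpha(x)}\phi'\Big(\tfrac{p_\theta(x)}{p_\alpha(x)}\Big)-\phi\Big(\tfrac{p_\theta(x)}{p_\alpha(x)}\Big),\quad h(\theta,\alpha,x)=P_\theta f(\theta,\alpha)-g(\theta,\alpha,x).$$ Let $X_1,X_2,\dots$ be i.i.d. with distribution $P_{\theta_T}$ and let $P_n$ be the empirical measure of $X_1,\dots,X_n$. Consider the following assumptions. (A.1) There is a neighborhood $N(\theta_T)$ on which the first and second order partial derivatives with respect to $\alpha$ of $f(\theta,\alpha,x)p_\theta(x)$ are dominated by $\lambda$-integrable functions of $x$, and on which the third order partial derivatives with respect to $\alpha$ of $h(\theta,\alpha,x)$ exist and are dominated by $P_{\theta_T}$-integrable functions of $x$. (A.2) $P_{\theta_T}\|(\partial/\partial\alpha)h(\theta,\theta_T)\|^2$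 and $P_{\theta_T}\|(\partial^2/\partial\alpha^2)h(\theta,\theta_T)\|$ are finite, and the matrix $P_{\theta_T}(\partial^2/\partial\alpha^2)h(\theta,\theta_T)$ is non-singular. (A.3) $P_{\theta_T}h(\theta,\theta_T)^2$ is finite. Let $B_n=\{\alpha\in\Theta:\|\alpha-\theta_T\|\le n^{-1/3}\}$, $S=-P_{\theta_T}(\partial^2/\partial\alpha^2)h(\theta,\theta_T)$ and $M=P_{\theta_T}(\partial/\partial\alpha)h(\theta,\theta_T)(\partial/\partial\alpha)^Th(\theta,\theta_T)$. Assume (A.1) and (A.2). Then the following hold. (a) There are random vectors $\widetilde\alpha_n=\widetilde\alpha_\phi(\theta)$, with $P_nh(\theta,\widetilde\alpha_n)$ a random variable, such that almost surely, for all large $n$, $\widetilde\alpha_n$ lies in the interior of $B_n$ and maximizes $\alpha\mapsto P_nh(\theta,\alpha)$ over $B_n$. For every such sequence, almost surely, $P_n(\partial/\partial\alpha)h(\theta,\widetilde\alpha_n)=0$ for all large $n$. Moreover, for every such sequence, with $\widetilde D_n:=P_nh(\theta,\widetilde\alpha_n)$: (b) $\sqrt n(\widetilde\alpha_n-\theta_T)$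 converges in distribution to a centered multivariate normal random vector with covariance matrix $S^{-1}MS^{-1}$. (c) If $\theta_T=\theta$, then $\frac{2n}{\phi''(1)}\widetilde D_n$ converges in distribution to a $\chi^2$ random variable with $d$ degrees of freedom. (d) If moreover (A.3) holds and $\theta\ne\theta_T$, then $D_\phi(P_\theta,P_{\theta_T})<\infty$ and $\sqrt n\big(\widetilde D_n-D_\phi(P_\theta,P_{\theta_T})\big)$ converges in distribution to a centered normal random variable with variance $\sigma_\phi^2(\theta,\theta_T)=P_{\theta_T}h(\theta,\theta_T)^2-\big(P_{\theta_T}h(\theta,\theta_T)\big)^2$. -/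

import Mathlib

open MeasureTheory ProbabilityTheory Filter Topology
open scoped ENNReal NNReal

namespace PhiDivergence

noncomputable section

/-- The effective domain of a convex function with values in `[0, ∞]`. -/
def dom (φ : ℝ → ℝ≥0∞) : Set ℝ := {x | φ x < ∞}

/-- The finite values of `φ`, as a real function (only used on the domain of `φ`). -/
def realVal (φ : ℝ → ℝ≥0∞) (x : ℝ) : ℝ := (φ x).toReal

/-- The derivative `φ'` (only used on the interior of the domain of `φ`). -/
def dphi (φ : ℝ → ℝ≥0∞) : ℝ → ℝ := deriv (realVal φ)

/-- The convex functions that generate the divergences: proper closed convex functions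
`φ : ℝ → [0, ∞]` with `φ 1 = 0`, whose domain is an interval with endpoints `a < 1 < b`, strictly
convex and essentially smooth, with continuous derivatives up to order four. -/
structure IsGenerator (φ : ℝ → ℝ≥0∞) : Prop where
  convex : ConvexOn ℝ≥0 Set.univ φ
  closed : LowerSemicontinuous φ
  map_one : φ 1 = 0
  one_mem : (1 : ℝ) ∈ interior (dom φ)
  strictConvex : StrictConvexOn ℝ (interior (dom φ)) (realVal φ)
  contDiff : ContDiffOn ℝ 4 (realVal φ) (interior (dom φ))
  steep_left : ∀ a, IsGLB (dom φ) a → Tendsto (dphi φ) (𝓝[>] a) atBot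
  steep_right : ∀ b, IsLUB (dom φ) b → Tendsto (dphi φ) (𝓝[<] b) atTop

open Classical in
/-- The `φ`-divergence `D_φ(Q, P) = ∫ φ(dQ/dP) dP`, equal to `∞` if `Q` is not absolutely continuous
with respect to `P`. -/
def phiDiv {𝒳 : Type*} [MeasurableSpace 𝒳] (φ : ℝ → ℝ≥0∞) (Q P : Measure 𝒳) : ℝ≥0∞ :=
  if Q ≪ P then ∫⁻ x, φ (Q.rnDeriv P x).toReal ∂P else ∞

/-- An identifiable model `{P_α ; α ∈ Θ}`, `Θ ⊆ ℝ^d`, with densities `p α` with respect to a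
`σ`-finite measure, whose support does not depend on the parameter. Values of `p α` for `α ∉ Θ` are
irrelevant. -/
structure Model (d : ℕ) (𝒳 : Type*) [MeasurableSpace 𝒳] where
  /-- the parameter space -/
  Θ : Set (EuclideanSpace ℝ (Fin d))
  /-- the dominating measure -/
  lam : Measure 𝒳
  /-- the densities -/
  p : EuclideanSpace ℝ (Fin d) → 𝒳 → ℝ
  sigmaFinite : SigmaFinite lam
  measurable_p : ∀ α ∈ Θ, Measurable (p α)
  p_nonneg : ∀ α ∈ Θ, ∀ x, 0 ≤ p α x
  isProbability : ∀ α ∈ Θ, IsProbabilityMeasure (lam.withDensity fun x => ENNReal.ofReal (p α x))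
  identifiable : Set.InjOn (fun α => lam.withDensity fun x => ENNReal.ofReal (p α x)) Θ
  support_eq : ∀ᵐ x ∂lam, ∀ α ∈ Θ, ∀ β ∈ Θ, (0 < p α x ↔ 0 < p β x)

section
variable {d : ℕ} {𝒳 : Type*} [MeasurableSpace 𝒳]

/-- The distribution `P_α`. -/
def Model.P (M : Model d 𝒳) (α : EuclideanSpace ℝ (Fin d)) : Measure 𝒳 :=
  M.lam.withDensity fun x => ENNReal.ofReal (M.p α x)

/-- `f(θ, α, x) = φ'(p_θ(x) / p_α(x))`. -/
def fFun (φ : ℝ → ℝ≥0∞) (M : Model d 𝒳) (θ α : EuclideanSpace ℝ (Fin d)) (x : 𝒳) : ℝ :=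
  dphi φ (M.p θ x / M.p α x)

/-- `g(θ, α, x) = (p_θ(x) / p_α(x)) φ'(p_θ(x) / p_α(x)) - φ(p_θ(x) / p_α(x))`. -/
def gFun (φ : ℝ → ℝ≥0∞) (M : Model d 𝒳) (θ α : EuclideanSpace ℝ (Fin d)) (x : 𝒳) : ℝ :=
  M.p θ x / M.p α x * dphi φ (M.p θ x / M.p α x) - realVal φ (M.p θ x / M.p α x)

/-- `h(θ, α, x) = P_θ f(θ, α) - g(θ, α, x)`. -/
def hFun (φ : ℝ → ℝ≥0∞) (M : Model d 𝒳) (θ α : EuclideanSpace ℝ (Fin d)) (x : 𝒳) : ℝ :=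
  (∫ y, fFun φ M θ α y ∂(M.P θ)) - gFun φ M θ α x

/-- The `i`-th partial derivative of a function of `α ∈ ℝ^d`. -/
def pd (i : Fin d) (F : EuclideanSpace ℝ (Fin d) → ℝ) (α : EuclideanSpace ℝ (Fin d)) : ℝ :=
  lineDeriv ℝ F α (EuclideanSpace.single i 1)

/-- The vector `(∂/∂α) h(θ, α, x)`. -/
def score (φ : ℝ → ℝ≥0∞) (M : Model d 𝒳) (θ α : EuclideanSpace ℝ (Fin d)) (x : 𝒳) :
    EuclideanSpace ℝ (Fin d) :=
  WithLp.toLp 2 fun i => pd i (fun a => hFun φ M θ a x) α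

/-- The matrix `(∂²/∂α²) h(θ, α, x)`. -/
def hess (φ : ℝ → ℝ≥0∞) (M : Model d 𝒳) (θ α : EuclideanSpace ℝ (Fin d)) (x : 𝒳) :
    Matrix (Fin d) (Fin d) ℝ :=
  Matrix.of fun i j => pd i (pd j fun a => hFun φ M θ a x) α

/-- The standing condition on `φ`, the model and `θ`: the ratios `p_θ / p_α` take their values
where `φ'` is defined, and `∫ |φ'(p_θ / p_α)| dP_θ < ∞` for every `α ∈ Θ`. -/
structure RatioIntegrable (φ : ℝ → ℝ≥0∞) (M : Model d 𝒳) (θ : EuclideanSpace ℝ (Fin d)) :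
    Prop where
  mem_dom : ∀ᵐ x ∂(M.P θ), ∀ α ∈ M.Θ, M.p θ x / M.p α x ∈ interior (dom φ)
  integrable : ∀ α ∈ M.Θ, Integrable (fFun φ M θ α) (M.P θ)

/-- Assumption (A.1). On a neighbourhood `N` of `θT`, the first and second partial derivatives in
`α` of `f(θ, α, x) p_θ(x)` are dominated by a `λ`-integrable function, and the third partial
derivatives of `h(θ, α, x)` exist and are dominated by a `P_{θT}`-integrable function. -/
def AssumptionA1 (φ : ℝ → ℝ≥0∞) (M : Model d 𝒳) (θ θT : EuclideanSpace ℝ (Fin d)) : Prop :=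
  ∃ N : Set (EuclideanSpace ℝ (Fin d)), IsOpen N ∧ θT ∈ N ∧ N ⊆ M.Θ ∧
    (∃ G : 𝒳 → ℝ, Integrable G M.lam ∧ ∀ᵐ x ∂M.lam, ∀ α ∈ N,
      (∀ i, |pd i (fun a => fFun φ M θ a x * M.p θ x) α| ≤ G x) ∧
      (∀ i j, |pd i (pd j fun a => fFun φ M θ a x * M.p θ x) α| ≤ G x)) ∧
    (∃ H : 𝒳 → ℝ, Integrable H (M.P θT) ∧ ∀ᵐ x ∂(M.P θT), ∀ α ∈ N, ∀ i j k,
      LineDifferentiableAt ℝ (pd j (pd k fun a => hFun φ M θ a x)) α (EuclideanSpace.single i 1) ∧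
      |pd i (pd j (pd k fun a => hFun φ M θ a x)) α| ≤ H x)

/-- The matrix `S = -P_{θT} (∂²/∂α²) h(θ, θT)`. -/
def matS (φ : ℝ → ℝ≥0∞) (M : Model d 𝒳) (θ θT : EuclideanSpace ℝ (Fin d)) :
    Matrix (Fin d) (Fin d) ℝ :=
  Matrix.of fun i j => -∫ x, hess φ M θ θT x i j ∂(M.P θT)

/-- The matrix `P_{θT} (∂/∂α) h(θ, θT) (∂/∂α)ᵀ h(θ, θT)`. -/
def matM (φ : ℝ → ℝ≥0∞) (M : Model d 𝒳) (θ θT : EuclideanSpace ℝ (Fin d)) :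
    Matrix (Fin d) (Fin d) ℝ :=
  Matrix.of fun i j => ∫ x, score φ M θ θT x i * score φ M θ θT x j ∂(M.P θT)

/-- The limiting covariance matrix `V = S⁻¹ M S⁻¹`. -/
def matV (φ : ℝ → ℝ≥0∞) (M : Model d 𝒳) (θ θT : EuclideanSpace ℝ (Fin d)) :
    Matrix (Fin d) (Fin d) ℝ :=
  (matS φ M θ θT)⁻¹ * matM φ M θ θT * (matS φ M θ θT)⁻¹

/-- Assumption (A.2). The score is square integrable and the Hessian is integrable under `P_{θT}`
at `α = θT`, and the mean Hessian is non-singular. -/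
structure AssumptionA2 (φ : ℝ → ℝ≥0∞) (M : Model d 𝒳) (θ θT : EuclideanSpace ℝ (Fin d)) :
    Prop where
  score_sq : Integrable (fun x => ‖score φ M θ θT x‖ ^ 2) (M.P θT)
  hess_int : ∀ i j, Integrable (fun x => hess φ M θ θT x i j) (M.P θT)
  nonsingular : IsUnit (Matrix.of fun i j => ∫ x, hess φ M θ θT x i j ∂(M.P θT))

/-- Assumption (A.3): `P_{θT} h(θ, θT)²` is finite. -/
def AssumptionA3 (φ : ℝ → ℝ≥0∞) (M : Model d 𝒳) (θ θT : EuclideanSpace ℝ (Fin d)) : Prop :=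
  Integrable (fun x => hFun φ M θ θT x ^ 2) (M.P θT)

/-- `σ²_φ(θ, θT) = P_{θT} h(θ, θT)² - (P_{θT} h(θ, θT))²`. -/
def sigmaSq (φ : ℝ → ℝ≥0∞) (M : Model d 𝒳) (θ θT : EuclideanSpace ℝ (Fin d)) : ℝ :=
  (∫ x, hFun φ M θ θT x ^ 2 ∂(M.P θT)) - (∫ x, hFun φ M θ θT x ∂(M.P θT)) ^ 2

/-- `P_n F`, the mean of `F` under the empirical measure of `X 0, …, X (n - 1)`. -/
def empMean {Ω E : Type*} [AddCommGroup E] [Module ℝ E] (X : ℕ → Ω → 𝒳) (n : ℕ) (ω : Ω)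
    (F : 𝒳 → E) : E :=
  (n : ℝ)⁻¹ • ∑ i ∈ Finset.range n, F (X i ω)

/-- The ball `B(θT, n^{-1/3})`. -/
def ball13 (M : Model d 𝒳) (θT : EuclideanSpace ℝ (Fin d)) (n : ℕ) :
    Set (EuclideanSpace ℝ (Fin d)) :=
  {α ∈ M.Θ | ‖α - θT‖ ≤ (n : ℝ) ^ (-(1 / 3) : ℝ)}

/-- `αt` is a sequence of local maximizers `α̃_φ(θ)`: the `αt n` and the statistics
`P_n h(θ, αt n)` are random variables and, almost surely, for all large `n`, `αt n` lies in the
interior of the ball `B(θT, n^{-1/3})` and maximizes `α ↦ P_n h(θ, α)` over this ball. -/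
structure IsLocalMaximizer {Ω : Type*} [MeasurableSpace Ω] (μ : Measure Ω) (φ : ℝ → ℝ≥0∞)
    (M : Model d 𝒳) (θ θT : EuclideanSpace ℝ (Fin d)) (X : ℕ → Ω → 𝒳)
    (αt : ℕ → Ω → EuclideanSpace ℝ (Fin d)) : Prop where
  aemeasurable : ∀ n, AEMeasurable (αt n) μ
  aemeasurable_stat : ∀ n, AEMeasurable (fun ω => empMean X n ω (hFun φ M θ (αt n ω))) μ
  isMax : ∀ᵐ ω ∂μ, ∀ᶠ n : ℕ in atTop, αt n ω ∈ interior (ball13 M θT n) ∧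
    IsMaxOn (fun α => empMean X n ω (hFun φ M θ α)) (ball13 M θT n) (αt n ω)

end

/-- The `χ²` distribution with `d` degrees of freedom: the law of `Z₁² + ⋯ + Z_d²` for independent
standard normal `Z₁, …, Z_d`. -/
def chiSquared (d : ℕ) : Measure ℝ :=
  (Measure.pi fun _ : Fin d => gaussianReal 0 1).map fun z => ∑ i, z i ^ 2

instance (d : ℕ) : IsProbabilityMeasure (chiSquared d) :=
  Measure.isProbabilityMeasure_map (Measurable.aemeasurable (by fun_prop))

end

end PhiDivergence

open PhiDivergence

namespace PhiDivergence

/-! On the ball of radius `n ^ (-1/3)` the criterion `α ↦ P_n h(θ, α)` is almost surely nearly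
quadratic for large `n`, and all the limits are read off from that quadratic.

Structure of the criterion. Put `r = p_θ / p_α`. Since `r φ'(r) - φ(r)` has derivative `r φ''(r)`,
the identity `p_α ∂g = ∂(φ'(r) p_θ)` holds pointwise (`RegularPoint.pd_fDens`). Integrated at `θT`,
with the domination in `AssumptionA1`, it says that the score has mean zero. Differentiated once
more, it identifies `S` with the weighted Fisher matrix `∫ φ''(r) r² / p ∂ᵢp ∂ⱼp dλ`
(`LocalRegularity.matS_apply`). Hence `S` is positive semidefinite, and non-singularity makes it
positive definite. The bound on third derivatives makes the gradient nearly affine.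
`RegularCriterion` keeps exactly these facts.

The maximizer. By the strong law the gradient of `P_n h` differs from an affine map with linear part
`-S` by an `ε_n`-Lipschitz map, with `ε_n → 0` almost surely. A square integrable centred score has
empirical mean `o(n ^ (-1/3))` almost surely (`ae_tendsto_rpow_mul_mean`), so on the sphere of
radius `n ^ (-1/3)` the quadratic term beats the linear one. The maximum is therefore interior and
critical, and there is only one critical point (`NearlyQuadratic.exists_unique_isMaxOn`); uniqueness
makes the measurable choice elementary. Solving for the critical point
(`NearlyQuadratic.exists_critical_bounds`) expresses its position as `S⁻¹ s` and the gain in value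
as `⟪s, S⁻¹ s⟫ / 2`, where `s` is the empirical score at `θT`, up to errors of smaller order. The
central limit theorem for `s` and Slutsky's lemma finish.

The values. If `θT = θ`, then `h(θ, θ, ·) = 0`, and the `χ²` limit requires the score covariance to
be `φ''(1) S`. This needs `∫ ∂p dλ = 0` at `θ`, although derivatives of `p_α` are not assumed
dominated near `θ`. The domination of `φ'(r) p_θ` still gives a one-sided Lipschitz bound for `p_α`,
and Fatou's lemma in the directions `e` and `-e` gives both inequalities
(`LocalRegularity.integral_pd_p_eq_zero`). If `θ ≠ θT`, the divergence is the mean of `h(θ, θT)`;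
maximizing changes the empirical mean only by a multiple of `‖s‖²`, which is negligible at scale
`√n`, so the scalar central limit theorem decides. -/

/-! ### The strong law of large numbers with a rate -/

/-- **Kronecker's lemma**. -/
lemma tendsto_inv_mul_sum_of_tendsto_sum_div {a b : ℕ → ℝ} (hb : Monotone b) (hb0 : ∀ n, 0 < b n)
    (hbt : Tendsto b atTop atTop) {c : ℝ}
    (h : Tendsto (fun n => ∑ k ∈ Finset.range n, a k / b k) atTop (𝓝 c)) :
    Tendsto (fun n => (b n)⁻¹ * ∑ k ∈ Finset.range n, a k) atTop (𝓝 0) := by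
  set W : ℕ → ℝ := fun n => ∑ k ∈ Finset.range n, a k / b k with hW
  -- Abel summation with the partial sums centred at their limit `c`; the centring produces the
  -- boundary term `b 0 * c`.
  have key : ∀ n, ∑ k ∈ Finset.range n, a k =
      b n * (W n - c) - ∑ k ∈ Finset.range n, (b (k + 1) - b k) * (W (k + 1) - c) + b 0 * c := by
    intro n
    induction n with
    | zero => simp [hW]
    | succ n ih =>
      rw [Finset.sum_range_succ, Finset.sum_range_succ, ih]
      have : W (n + 1) = W n + a n / b n := by simp [hW, Finset.sum_range_succ]
      have h2 : a n = b n * (W (n + 1) - W n) := by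
        rw [this]; field_simp [(hb0 n).ne']; ring
      rw [h2]; ring
  have hsum : ∀ n, ∑ k ∈ Finset.range n, (b (k + 1) - b k) = b n - b 0 :=
    fun n => Finset.sum_range_sub b n
  have hWc : Tendsto (fun n => W n - c) atTop (𝓝 0) := by simpa using h.sub_const c
  -- A weighted Cesàro mean of a null sequence is null: the weights `b (k + 1) - b k` are
  -- nonnegative and their sums diverge.
  have ho : (fun n => (b (n + 1) - b n) * (W (n + 1) - c)) =o[atTop] fun n => b (n + 1) - b n := by
    have h1 : (fun n => W (n + 1) - c) =o[atTop] (fun _ => (1 : ℝ)) :=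
      (Asymptotics.isLittleO_one_iff ℝ).2 (hWc.comp (tendsto_add_atTop_nat 1))
    simpa using (Asymptotics.isBigO_refl (fun n => b (n + 1) - b n) atTop).mul_isLittleO h1
  have ho2 := ho.sum_range (fun n => sub_nonneg.2 (hb n.le_succ))
    (by simp_rw [hsum]; exact tendsto_atTop_add_const_right _ _ hbt)
  simp_rw [hsum] at ho2
  have hbO : (fun n => b n - b 0) =O[atTop] b := by
    refine Asymptotics.IsBigO.of_bound 1 (Eventually.of_forall fun n => ?_)
    rw [Real.norm_of_nonneg (sub_nonneg.2 (hb (Nat.zero_le n))), Real.norm_of_nonneg (hb0 n).le]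
    linarith [hb0 0]
  have h3 := (ho2.trans_isBigO hbO).tendsto_div_nhds_zero
  have h4 : Tendsto (fun n => b 0 * c / b n) atTop (𝓝 0) := hbt.const_div_atTop _
  have h5 := (hWc.sub h3).add h4
  simp only [sub_zero, add_zero] at h5
  refine h5.congr fun n => ?_
  rw [key n]
  have := (hb0 n).ne'
  field_simp
  
variable {Ω : Type*} [MeasurableSpace Ω] {μ : Measure Ω} [IsProbabilityMeasure μ]

/-- A series of independent centered random variables with summable variances converges. -/
lemma ae_exists_tendsto_sum_of_summable_variance {Z : ℕ → Ω → ℝ} (hZm : ∀ n, Measurable (Z n))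
    (hindep : iIndepFun Z μ) (hL2 : ∀ n, MemLp (Z n) 2 μ) (hmean : ∀ n, μ[Z n] = 0)
    (hsum : Summable fun n => Var[Z n; μ]) :
    ∀ᵐ ω ∂μ, ∃ c, Tendsto (fun n => ∑ k ∈ Finset.range n, Z k ω) atTop (𝓝 c) := by
  let ℱ := Filtration.natural Z fun n => (hZm n).stronglyMeasurable
  -- The shift by one makes `W n` measurable for the σ-algebra of `Z 0, …, Z n`, of which the next
  -- increment `Z (n + 1)` is independent.
  let W : ℕ → Ω → ℝ := fun n => ∑ k ∈ Finset.range (n + 1), Z k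
  have hW2 : ∀ n, MemLp (W n) 2 μ := fun n => memLp_finsetSum' _ fun k _ => hL2 k
  have hWint : ∀ n, Integrable (W n) μ := fun n => (hW2 n).integrable one_le_two
  have hmart : Martingale W ℱ μ := by
    refine martingale_of_condExp_sub_eq_zero_nat ?_ hWint ?_
    · intro n
      refine Finset.stronglyMeasurable_sum _ fun k hk => ?_
      exact (Filtration.stronglyAdapted_natural (fun n => (hZm n).stronglyMeasurable) k).mono
        (ℱ.mono (Nat.lt_succ_iff.1 (Finset.mem_range.1 hk)))
    · intro n
      have : W (n + 1) - W n = Z (n + 1) := by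
        simp only [W, Finset.sum_range_succ _ (n + 1)]; simp
      rw [this]
      refine (hindep.condExp_natural_ae_eq_of_lt _ n.lt_succ_self).trans ?_
      simp only [hmean]; rfl
  -- The `L¹` bound for martingale convergence comes from `|w| ≤ 1 + w²` and additivity of the
  -- variance.
  have hbdd : ∀ n, eLpNorm (W n) 1 μ ≤
      (Real.toNNReal (1 + ∑' n, Var[Z n; μ]) : ℝ≥0) := by
    intro n
    rw [eLpNorm_one_eq_lintegral_enorm, ← ofReal_integral_norm_eq_lintegral_enorm (hWint n)]
    refine ENNReal.ofReal_le_ofReal ?_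
    have hvar : ∫ ω, W n ω ^ 2 ∂μ ≤ ∑' n, Var[Z n; μ] := by
      have h0 : μ[W n] = 0 := by
        simp only [W, Finset.sum_apply]
        rw [integral_finsetSum _ fun k _ => (hL2 k).integrable one_le_two]
        exact Finset.sum_eq_zero fun k _ => hmean k
      have h1 : Var[W n; μ] = ∫ ω, W n ω ^ 2 ∂μ := by
        rw [variance_of_integral_eq_zero (hW2 n).aemeasurable h0]
      rw [← h1, IndepFun.variance_sum (fun k _ => hL2 k) fun i _ j _ hij => hindep.indepFun hij]
      exact hsum.sum_le_tsum _ fun k _ => variance_nonneg _ _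
    calc ∫ ω, ‖W n ω‖ ∂μ ≤ ∫ ω, (1 + W n ω ^ 2) ∂μ := by
          refine integral_mono (hWint n).norm ((integrable_const _).add (hW2 n).integrable_sq)
            fun ω => ?_
          simp only [Real.norm_eq_abs]
          nlinarith [sq_nonneg (|W n ω| - 1), sq_abs (W n ω), abs_nonneg (W n ω)]
      _ = 1 + ∫ ω, W n ω ^ 2 ∂μ := by
          rw [integral_add (integrable_const _) (hW2 n).integrable_sq]; simp
      _ ≤ _ := by linarith
  filter_upwards [hmart.submartingale.exists_ae_tendsto_of_bdd hbdd] with ω ⟨c, hc⟩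
  refine ⟨c, (tendsto_add_atTop_iff_nat 1).1 ?_⟩
  simpa [W] using hc

/-- The strong law of large numbers with rate `n ^ (-1/3)`, for square integrable variables. -/
lemma ae_tendsto_rpow_mul_mean {Y : ℕ → Ω → ℝ} (hindep : iIndepFun Y μ)
    (hident : ∀ i, IdentDistrib (Y i) (Y 0) μ μ) (hL2 : MemLp (Y 0) 2 μ) (hmean : μ[Y 0] = 0) :
    ∀ᵐ ω ∂μ, Tendsto (fun n : ℕ => (n : ℝ) ^ (1 / 3 : ℝ) *
      ((n : ℝ)⁻¹ * ∑ k ∈ Finset.range n, Y k ω)) atTop (𝓝 0) := by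
  have hYm : ∀ i, AEMeasurable (Y i) μ := fun i => (hident i).aemeasurable_fst
  have hae : ∀ᵐ ω ∂μ, ∀ i, Y i ω = (hYm i).mk _ ω := ae_all_iff.2 fun i => (hYm i).ae_eq_mk
  -- With weights of order `n ^ (2/3)` the variances of `Y n / b n` are of order `n ^ (-4/3)`, hence
  -- summable, and `n ^ (1/3) / n = n ^ (-2/3)` is the rate that Kronecker's lemma returns.
  let b : ℕ → ℝ := fun n => ((n : ℝ) + 1) ^ (2 / 3 : ℝ)
  have hb0 : ∀ n, 0 < b n := fun n => by positivity
  have hbm : Monotone b := fun m n h => by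
    have : (m : ℝ) ≤ n := by exact_mod_cast h
    dsimp only [b]; gcongr
  have hbt : Tendsto b atTop atTop := (tendsto_rpow_atTop (by norm_num)).comp
    (tendsto_atTop_add_const_right _ _ tendsto_natCast_atTop_atTop)
  let Z : ℕ → Ω → ℝ := fun n ω => (hYm n).mk _ ω / b n
  have hY2 : ∀ n, MemLp ((hYm n).mk _) 2 μ := fun n =>
    ((hident n).symm.memLp_snd hL2).ae_eq (hYm n).ae_eq_mk
  have hZ2 : ∀ n, MemLp (Z n) 2 μ := fun n => by
    simpa only [Z, div_eq_mul_inv, mul_comm] using (hY2 n).const_mul (b n)⁻¹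
  have hconv := ae_exists_tendsto_sum_of_summable_variance (μ := μ) (Z := Z)
    (fun n => (hYm n).measurable_mk.div_const _)
    ((hindep.congr fun i => (hYm i).ae_eq_mk).comp (fun n x => x / b n) fun n => by fun_prop)
    hZ2
    (fun n => by
      have : μ[Z n] = (∫ ω, Y n ω ∂μ) / b n := by
        rw [← integral_div]
        exact integral_congr_ae ((hYm n).ae_eq_mk.symm.mono fun ω h => by simp [Z, h])
      rw [this, (hident n).integral_eq, hmean, zero_div])
    (by
      have hv : ∀ n, Var[Z n; μ] = Var[Y 0; μ] * (1 / ((n : ℝ) + 1) ^ (4 / 3 : ℝ)) := by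
        intro n
        have h1 : Z n = fun ω => (b n)⁻¹ * (hYm n).mk _ ω := by
          ext ω; simp only [Z, div_eq_inv_mul]
        rw [h1, variance_const_mul, ← variance_congr (hYm n).ae_eq_mk, (hident n).variance_eq,
          mul_comm, inv_pow, one_div]
        congr 2
        dsimp only [b]
        rw [← Real.rpow_natCast, ← Real.rpow_mul (by positivity)]
        norm_num
      simp_rw [hv]
      refine Summable.mul_left _ ?_
      have := (summable_nat_add_iff 1).2 (Real.summable_one_div_nat_rpow.2
        (show (1 : ℝ) < 4 / 3 by norm_num))
      simpa using this)
  filter_upwards [hconv, hae] with ω ⟨c, hc⟩ hω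
  have h1 := tendsto_inv_mul_sum_of_tendsto_sum_div hbm hb0 hbt hc
  -- The factor `2 ^ (2/3)` pays for replacing `n + 1` by `n`, since `n + 1 ≤ 2 n` for `n ≥ 1`.
  have h2 : Tendsto (fun n : ℕ => (2 : ℝ) ^ (2 / 3 : ℝ) *
      ‖(b n)⁻¹ * ∑ k ∈ Finset.range n, (hYm k).mk _ ω‖) atTop (𝓝 0) := by
    simpa using h1.norm.const_mul ((2 : ℝ) ^ (2 / 3 : ℝ))
  refine squeeze_zero_norm' ?_ h2
  filter_upwards [eventually_ge_atTop 1] with n hn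
  have hn' : (1 : ℝ) ≤ n := by exact_mod_cast hn
  have hn0 : (0 : ℝ) < n := by linarith
  rw [← mul_assoc, norm_mul, norm_mul _ (∑ k ∈ Finset.range n, _), ← mul_assoc]
  simp_rw [hω]
  refine mul_le_mul_of_nonneg_right ?_ (norm_nonneg _)
  rw [Real.norm_of_nonneg (by positivity), Real.norm_of_nonneg (inv_nonneg.2 (hb0 n).le)]
  have e1 : (n : ℝ) ^ (1 / 3 : ℝ) * (n : ℝ)⁻¹ = ((n : ℝ) ^ (2 / 3 : ℝ))⁻¹ := by
    rw [← Real.rpow_neg_one, ← Real.rpow_add hn0, ← Real.rpow_neg hn0.le]; norm_num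
  rw [e1, ← div_eq_mul_inv, inv_le_comm₀ (by positivity) (by have := hb0 n; positivity), inv_div,
    div_le_iff₀ (by positivity), mul_comm]
  dsimp only [b]
  rw [← Real.mul_rpow (by norm_num) hn0.le]
  exact Real.rpow_le_rpow (by positivity) (by linarith) (by norm_num)

/-! ### Convergence in distribution and in probability -/

section Law
variable {Ω : Type*} [MeasurableSpace Ω] {μ : Measure Ω} [IsProbabilityMeasure μ]
variable {E : Type*} [NormedAddCommGroup E] [MeasurableSpace E] [BorelSpace E]

/-- Only the law of the limit matters, so the limit variable may be replaced by the identity on its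
image measure. -/
lemma tendstoInDistribution_id_of_map_eq {X : ℕ → Ω → E} {Ω' : Type*} [MeasurableSpace Ω']
    {ν : Measure Ω'} [IsProbabilityMeasure ν] {Z : Ω' → E}
    (h : TendstoInDistribution X atTop Z (fun _ => μ) ν)
    {π : Measure E} [IsProbabilityMeasure π] (hπ : ν.map Z = π) :
    TendstoInDistribution X atTop id (fun _ => μ) π where
  forall_aemeasurable := h.forall_aemeasurable
  aemeasurable_limit := aemeasurable_id
  tendsto := by
    subst hπ
    convert! h.tendsto using 2
    simp

/-- Portmanteau theorem for the closed set `{x | ε ≤ ‖x‖}`, which has mass zero under the limit law.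
-/
lemma tendstoInMeasure_zero_of_tendstoInDistribution {X : ℕ → Ω → ℝ} {Ω' : Type*}
    [MeasurableSpace Ω'] {ν : Measure Ω'} [IsProbabilityMeasure ν]
    (h : TendstoInDistribution X atTop (fun _ : Ω' => (0 : ℝ)) (fun _ => μ) ν) :
    TendstoInMeasure μ X atTop 0 := by
  rw [tendstoInMeasure_iff_norm]
  intro ε hε
  have hcl : IsClosed {x : ℝ | ε ≤ ‖x‖} := isClosed_le continuous_const continuous_norm
  have h1 := ProbabilityMeasure.limsup_measure_closed_le_of_tendsto h.tendsto hcl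
  have h2 : (ν.map fun _ : Ω' => (0 : ℝ)) {x : ℝ | ε ≤ ‖x‖} = 0 := by
    rw [Measure.map_apply measurable_const hcl.measurableSet]
    simp [hε.not_ge]
  simp only [ProbabilityMeasure.coe_mk, h2] at h1
  have h3 : ∀ n, (μ.map (X n)) {x : ℝ | ε ≤ ‖x‖} = μ {ω | ε ≤ ‖X n ω - (0 : Ω → ℝ) ω‖} := by
    intro n
    rw [Measure.map_apply_of_aemeasurable (h.forall_aemeasurable n) hcl.measurableSet]
    simp
  simp_rw [h3] at h1
  exact tendsto_of_le_liminf_of_limsup_le zero_le h1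

/-- If `‖D n‖` is eventually at most `C * e n * ‖U n‖ ^ k` with `e n → 0` almost surely and `U n`
convergent in distribution, then `D n → 0` in probability. -/
lemma tendstoInMeasure_zero_of_eventually_norm_le [SecondCountableTopology E]
    {F : Type*} [NormedAddCommGroup F] [MeasurableSpace F] [BorelSpace F]
    {U : ℕ → Ω → E} {Ω' : Type*} [MeasurableSpace Ω'] {ν : Measure Ω'} [IsProbabilityMeasure ν]
    {Z : Ω' → E} (hU : TendstoInDistribution U atTop Z (fun _ => μ) ν)
    {e : ℕ → Ω → ℝ} (he : ∀ n, AEMeasurable (e n) μ)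
    (he0 : ∀ᵐ ω ∂μ, Tendsto (fun n => e n ω) atTop (𝓝 0))
    {D : ℕ → Ω → F} (hD : ∀ n, AEMeasurable (D n) μ) (C : ℝ) (k : ℕ)
    (hle : ∀ᵐ ω ∂μ, ∀ᶠ n in atTop, ‖D n ω‖ ≤ C * e n ω * ‖U n ω‖ ^ k) :
    TendstoInMeasure μ D atTop 0 := by
  -- Slutsky: `(U n, e n)` converges in distribution to `(Z, 0)`, and the bound is a continuous
  -- function of the pair.
  have hR : TendstoInMeasure μ (fun n ω => C * e n ω * ‖U n ω‖ ^ k) atTop 0 := by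
    have h1 := tendstoInMeasure_of_tendsto_ae (μ := μ) (g := fun _ => (0 : ℝ))
      (fun n => (he n).aestronglyMeasurable) he0
    have h2 := hU.continuous_comp_prodMk_of_tendstoInMeasure_const
      (g := fun x : E × ℝ => C * x.2 * ‖x.1‖ ^ k) (by fun_prop) h1 he
    simp only [mul_zero, zero_mul] at h2
    exact tendstoInMeasure_zero_of_tendstoInDistribution h2
  have hUm := hU.forall_aemeasurable
  -- The bound holds only from a random index on; the excess over it is eventually zero almost
  -- surely, hence null in probability.
  have hZ : TendstoInMeasure μ (fun n ω => max (‖D n ω‖ - C * e n ω * ‖U n ω‖ ^ k) 0) atTop 0 := by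
    refine tendstoInMeasure_of_tendsto_ae (fun n => ?_) ?_
    · have := hD n; have := he n; have := hUm n
      exact AEMeasurable.aestronglyMeasurable (by fun_prop)
    · filter_upwards [hle] with ω hω
      refine tendsto_const_nhds.congr' ?_
      filter_upwards [hω] with n hn
      simp [hn]
  rw [tendstoInMeasure_iff_norm] at hR hZ ⊢
  intro ε hε
  have h0 := (hR (ε / 2) (half_pos hε)).add (hZ (ε / 2) (half_pos hε))
  rw [add_zero] at h0
  refine tendsto_of_tendsto_of_tendsto_of_le_of_le tendsto_const_nhds h0 (fun _ => zero_le)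
    fun n => ?_
  refine (measure_mono fun ω hω => ?_).trans (measure_union_le _ _)
  simp only [Pi.zero_apply, sub_zero, Set.mem_ofPred_eq, Set.mem_union] at hω ⊢
  by_contra! hcon
  have e1 := (le_abs_self _).trans_lt hcon.1
  have e2 := (le_max_left _ _).trans_lt ((le_abs_self _).trans_lt hcon.2)
  linarith

end Law

/-! ### Linear images and quadratic forms of Gaussian vectors -/

section Gaussian
open Matrix
open scoped RealInnerProductSpace

variable {ι : Type*} [Fintype ι] [DecidableEq ι]

/-- In the characteristic function `A` moves to `t` as its adjoint `Aᵀ`, and the quadratic form of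
`M` at `Aᵀ t` is that of `A * M * Aᵀ` at `t`. -/
lemma multivariateGaussian_map_toEuclideanCLM {M : Matrix ι ι ℝ} (hM : M.PosSemidef)
    (A : Matrix ι ι ℝ) (hV : (A * M * Aᵀ).PosSemidef) :
    (multivariateGaussian 0 M).map (toEuclideanCLM (𝕜 := ℝ) A) =
      multivariateGaussian 0 (A * M * Aᵀ) := by
  refine Measure.ext_of_charFun (funext fun t => ?_)
  have h1 : charFun ((multivariateGaussian 0 M).map (toEuclideanCLM (𝕜 := ℝ) A)) t =
      charFun (multivariateGaussian 0 M) (toEuclideanCLM (𝕜 := ℝ) Aᵀ t) := by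
    rw [charFun_apply, charFun_apply, integral_map (by fun_prop) (by fun_prop)]
    congr 1; ext x; congr 3
    have : toEuclideanCLM (𝕜 := ℝ) Aᵀ =
        ContinuousLinearMap.adjoint (toEuclideanCLM (𝕜 := ℝ) A) := by
      rw [← ContinuousLinearMap.star_eq_adjoint, ← map_star, star_eq_conjTranspose,
        conjTranspose_eq_transpose_of_trivial]
    rw [this, ContinuousLinearMap.adjoint_inner_right]
  rw [h1, charFun_multivariateGaussian hM, charFun_multivariateGaussian hV]
  simp only [inner_zero_right, Complex.ofReal_zero, zero_mul, zero_sub]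
  congr 4
  rw [ofLp_toEuclideanCLM, ← mulVec_mulVec, ← mulVec_mulVec, dotProduct_mulVec t.ofLp A,
    mulVec_transpose]

/-- The law of `⟪x, T x⟫` is `χ²` when `x` is centred Gaussian with covariance `T⁻¹`. -/
lemma multivariateGaussian_map_inner_inv {d : ℕ} {M T : Matrix (Fin d) (Fin d) ℝ}
    (hM : M.PosSemidef) (hMT : M * T = 1) :
    (multivariateGaussian 0 M).map (fun x => ⟪x, toEuclideanCLM (𝕜 := ℝ) T x⟫) =
      chiSquared d := by
  open scoped MatrixOrder in
  set R := CFC.sqrt M with hR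
  have hRR : R * R = M := CFC.sqrt_mul_sqrt_self _ hM.nonneg
  have hRsa : IsSelfAdjoint R := (CFC.sqrt_nonneg M).isSelfAdjoint
  -- Writing `x = R z` with `z` standard normal, the form becomes that of `R * T * R`. As `R * (R *
  -- T) = 1` and a one-sided inverse of a square matrix is two-sided, it is `‖z‖²`.
  have hRTR : R * T * R = 1 := by
    have h1 : R * (R * T) = 1 := by rw [← mul_assoc, hRR, hMT]
    exact mul_eq_one_comm.1 h1
  rw [multivariateGaussian, Measure.map_map (by fun_prop) (by fun_prop), ← map_pi_eq_stdGaussian,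
    Measure.map_map (by fun_prop) (by fun_prop), chiSquared]
  congr 1
  ext z
  simp only [Function.comp_apply, zero_add]
  rw [← hR]
  have h2 : ⟪toEuclideanCLM (𝕜 := ℝ) R (WithLp.toLp 2 z),
      toEuclideanCLM (𝕜 := ℝ) T (toEuclideanCLM (𝕜 := ℝ) R (WithLp.toLp 2 z))⟫ =
      ⟪WithLp.toLp 2 z, toEuclideanCLM (𝕜 := ℝ) (R * T * R) (WithLp.toLp 2 z)⟫ := by
    rw [map_mul, map_mul, mul_apply_eq_comp, mul_apply_eq_comp,
      ← ContinuousLinearMap.adjoint_inner_left (toEuclideanCLM (𝕜 := ℝ) R),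
      IsSelfAdjoint.adjoint_eq (hRsa.map _)]
  rw [h2, hRTR, map_one, one_apply_eq_self, real_inner_self_eq_norm_sq,
    EuclideanSpace.real_norm_sq_eq]

end Gaussian

/-! ### The multivariate central limit theorem -/

section CLT
open Matrix
open scoped RealInnerProductSpace
variable {Ω : Type*} [MeasurableSpace Ω] {μ : Measure Ω} [IsProbabilityMeasure μ]
variable {ι : Type*} [Fintype ι] [DecidableEq ι]

/-- The multivariate central limit theorem. -/
lemma tendstoInDistribution_sqrt_smul_mean {Y : ℕ → Ω → EuclideanSpace ℝ ι}
    (hindep : iIndepFun Y μ) (hident : ∀ i, IdentDistrib (Y i) (Y 0) μ μ)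
    (hL2 : MemLp (Y 0) 2 μ) (hmean : ∀ i, ∫ ω, Y 0 ω i ∂μ = 0) {M : Matrix ι ι ℝ}
    (hM : ∀ i j, M i j = ∫ ω, Y 0 ω i * Y 0 ω j ∂μ) :
    M.PosSemidef ∧ TendstoInDistribution
      (fun (n : ℕ) ω => √(n : ℝ) • ((n : ℝ)⁻¹ • ∑ k ∈ Finset.range n, Y k ω)) atTop id
      (fun _ => μ) (multivariateGaussian 0 M) := by
  have hYm : ∀ k, AEMeasurable (Y k) μ := fun k => (hident k).aemeasurable_fst
  have hc2 : ∀ i, MemLp (fun ω => Y 0 ω i) 2 μ := fun i =>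
    (EuclideanSpace.proj (𝕜 := ℝ) i).comp_memLp' hL2
  have hinn : ∀ (t x : EuclideanSpace ℝ ι), ⟪x, t⟫ = ∑ i, t i * x i := fun t x => by
    simp [PiLp.inner_apply]
  have ht2 : ∀ t, MemLp (fun ω => ⟪Y 0 ω, t⟫) 2 μ := fun t => by
    simp_rw [hinn]
    exact memLp_finsetSum _ fun i _ => (hc2 i).const_mul _
  have ht0 : ∀ t, ∫ ω, ⟪Y 0 ω, t⟫ ∂μ = 0 := fun t => by
    simp_rw [hinn]
    rw [integral_finsetSum _ fun i _ => ((hc2 i).integrable one_le_two).const_mul _]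
    simp [integral_const_mul, hmean]
  have htv : ∀ t : EuclideanSpace ℝ ι, ∫ ω, ⟪Y 0 ω, t⟫ ^ 2 ∂μ = t ⬝ᵥ M *ᵥ t := fun t => by
    have h1 : ∀ ω, ⟪Y 0 ω, t⟫ ^ 2 = ∑ i, ∑ j, t i * t j * (Y 0 ω i * Y 0 ω j) := fun ω => by
      rw [sq, hinn, Finset.sum_mul_sum]
      exact Finset.sum_congr rfl fun i _ => Finset.sum_congr rfl fun j _ => by ring
    have hi : ∀ i j, Integrable (fun ω => t i * t j * (Y 0 ω i * Y 0 ω j)) μ := fun i j =>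
      ((hc2 i).integrable_mul (hc2 j)).const_mul _
    simp_rw [h1]
    rw [integral_finsetSum _ fun i _ => integrable_finsetSum _ fun j _ => hi i j]
    simp only [dotProduct, mulVec, Finset.mul_sum]
    refine Finset.sum_congr rfl fun i _ => ?_
    rw [integral_finsetSum _ fun j _ => hi i j]
    refine Finset.sum_congr rfl fun j _ => ?_
    rw [integral_const_mul, hM]; ring
  have hPSD : M.PosSemidef := by
    refine PosSemidef.of_dotProduct_mulVec_nonneg ?_ fun x => ?_
    · ext i j; simp [hM, mul_comm]
    · have := htv (WithLp.toLp 2 x)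
      simp only [star_trivial]
      rw [← this]
      exact integral_nonneg fun ω => sq_nonneg _
  have hSm : ∀ n : ℕ, AEMeasurable
      (fun ω => √(n : ℝ) • ((n : ℝ)⁻¹ • ∑ k ∈ Finset.range n, Y k ω)) μ := fun n => by
    have := Finset.aemeasurable_fun_sum (Finset.range n) fun k _ => hYm k
    fun_prop
  refine ⟨hPSD, hSm, aemeasurable_id, ?_⟩
  refine ProbabilityMeasure.tendsto_iff_tendsto_charFun.2 fun t => ?_
  have hv : Var[fun ω => ⟪Y 0 ω, t⟫; μ] = t ⬝ᵥ M *ᵥ t := by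
    rw [variance_of_integral_eq_zero (ht2 t).aemeasurable (ht0 t), htv]
  -- Cramér–Wold: the characteristic function at `t` is that of the projection on `t`, evaluated at
  -- `1`.
  have hclt := tendstoInDistribution_inv_sqrt_mul_sum_sub (P := μ)
    (X := fun k ω => ⟪Y k ω, t⟫) (Y := id)
    (P' := gaussianReal 0 Var[fun ω => ⟪Y 0 ω, t⟫; μ].toNNReal) HasLaw.id
    (ht2 t) (hindep.comp (fun _ x => ⟪x, t⟫) fun _ => by fun_prop)
    (fun k => (hident k).comp (u := fun x => ⟪x, t⟫) (by fun_prop))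
  have h3 := ProbabilityMeasure.tendsto_iff_tendsto_charFun.1 hclt.tendsto 1
  simp only [ProbabilityMeasure.coe_mk, Measure.map_id, charFun_gaussianReal, hv] at h3 ⊢
  rw [charFun_multivariateGaussian hPSD]
  have h4 : 0 ≤ t ⬝ᵥ M *ᵥ t := by rw [← htv]; exact integral_nonneg fun ω => sq_nonneg _
  convert h3 using 2
  · rename_i n
    rw [charFun_apply, charFun_apply, integral_map (hSm n) (by fun_prop),
      integral_map (hclt.forall_aemeasurable n) (by fun_prop)]
    congr 1; ext ω; congr 3
    rw [ht0, smul_smul, real_inner_smul_left, sum_inner]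
    have : √(n : ℝ) * (n : ℝ)⁻¹ = (√(n : ℝ))⁻¹ := by
      rw [← div_eq_mul_inv, Real.sqrt_div_self', one_div]
    simp [this]
  · rw [Real.coe_toNNReal _ h4]; simp

end CLT

/-! ### Measurable selection of a maximizer -/

section Argmax

/-- Approximate maximizers over a dense sequence converge to the maximizer if it is unique. -/
lemma tendsto_of_unique_isMaxOn {E : Type*} [NormedAddCommGroup E] {K : Set E}
    (hK : IsCompact K) {F : E → ℝ}
    (hF : ContinuousOn F K) {a : ℕ → E} (haK : ∀ m, a m ∈ K) {x : E}
    (hmax : IsMaxOn F K x) (huniq : ∀ y ∈ K, IsMaxOn F K y → y = x)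
    (ha : ∀ m : ℕ, F x - 1 / ((m : ℝ) + 1) ≤ F (a m)) : Tendsto a atTop (𝓝 x) := by
  refine tendsto_of_subseq_tendsto fun ns hns => ?_
  obtain ⟨y, hyK, ψ, hψ, hy⟩ := hK.tendsto_subseq fun n => haK (ns n)
  refine ⟨ψ, ?_⟩
  suffices y = x by rw [← this]; exact hy
  have hmem : Tendsto (fun n => a (ns (ψ n))) atTop (𝓝[K] y) :=
    tendsto_nhdsWithin_iff.2 ⟨hy, Eventually.of_forall fun n => haK _⟩
  have h1 : Tendsto (fun n => F (a (ns (ψ n)))) atTop (𝓝 (F y)) := (hF y hyK).tendsto.comp hmem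
  have h2 : Tendsto (fun n => F x - 1 / (((ns (ψ n) : ℕ) : ℝ) + 1)) atTop (𝓝 (F x - 0)) :=
    tendsto_const_nhds.sub (tendsto_one_div_add_atTop_nhds_zero_nat.comp
      (hns.comp hψ.tendsto_atTop))
  have h3 : F x ≤ F y := by
    simpa using le_of_tendsto_of_tendsto' h2 h1 fun n => ha _
  exact huniq y hyK fun z hz => (hmax hz).trans h3

variable {Ω : Type*} [MeasurableSpace Ω] {μ : Measure Ω}
variable {E : Type*} [NormedAddCommGroup E] [CompleteSpace E] [MeasurableSpace E] [BorelSpace E]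
  [SecondCountableTopology E]

/-- Measurable selection of the maximizer, where it is unique. -/
lemma exists_aemeasurable_argmax {K : Set E} (hK : IsCompact K) (hKne : K.Nonempty)
    {F : E → Ω → ℝ} (hFm : ∀ α ∈ K, AEMeasurable (F α) μ)
    (hFc : ∀ᵐ ω ∂μ, ContinuousOn (fun α => F α ω) K) :
    ∃ a : Ω → E, AEMeasurable a μ ∧ AEMeasurable (fun ω => F (a ω) ω) μ ∧
      ∀ᵐ ω ∂μ, (∃ x ∈ K, IsMaxOn (fun α => F α ω) K x ∧
        ∀ y ∈ K, IsMaxOn (fun α => F α ω) K y → y = x) →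
        a ω ∈ K ∧ IsMaxOn (fun α => F α ω) K (a ω) := by
  classical
  have : Nonempty K := hKne.to_subtype
  have : MeasurableSpace K := borel K
  let q : ℕ → E := fun k => TopologicalSpace.denseSeq K k
  have hqK : ∀ k, q k ∈ K := fun k => (TopologicalSpace.denseSeq K k).2
  let f : ℕ → Ω → ℝ := fun k => (hFm (q k) (hqK k)).mk _
  have hfm : ∀ k, Measurable (f k) := fun k => (hFm (q k) (hqK k)).measurable_mk
  have hf : ∀ᵐ ω ∂μ, ∀ k, F (q k) ω = f k ω := ae_all_iff.2 fun k => (hFm (q k) (hqK k)).ae_eq_mk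
  -- Near-maximality among the countable dense family. The second alternative makes the search
  -- succeed for every `ω`, also where the supremum is infinite.
  let p : ℕ → Ω → ℕ → Prop := fun m ω k =>
    (∀ j, f j ω - 1 / ((m : ℝ) + 1) ≤ f k ω) ∨ ¬ ∃ l, ∀ j, f j ω - 1 / ((m : ℝ) + 1) ≤ f l ω
  have hpex : ∀ m ω, ∃ k, p m ω k := fun m ω => by
    by_cases h : ∃ l, ∀ j, f j ω - 1 / ((m : ℝ) + 1) ≤ f l ω
    · exact ⟨h.choose, Or.inl h.choose_spec⟩
    · exact ⟨0, Or.inr h⟩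
  have hpm0 : ∀ m k, MeasurableSet {ω | ∀ j, f j ω - 1 / ((m : ℝ) + 1) ≤ f k ω} := fun m k => by
    rw [Set.ofPred_forall]
    exact MeasurableSet.iInter fun j => measurableSet_le ((hfm j).sub_const _) (hfm k)
  have hpm : ∀ m k, MeasurableSet {ω | p m ω k} := fun m k => by
    refine (hpm0 m k).union (MeasurableSet.compl ?_)
    have : {ω | ∃ l, ∀ j, f j ω - 1 / ((m : ℝ) + 1) ≤ f l ω} =
      ⋃ l, {ω | ∀ j, f j ω - 1 / ((m : ℝ) + 1) ≤ f l ω} := Set.ofPred_exists _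
    change MeasurableSet {ω | ∃ l, ∀ j, f j ω - 1 / ((m : ℝ) + 1) ≤ f l ω}
    rw [this]
    exact MeasurableSet.iUnion fun l => hpm0 m l
  let N : ℕ → Ω → ℕ := fun m ω => Nat.find (hpex m ω)
  have hN : ∀ m, Measurable (N m) := fun m => measurable_find (hpex m) (hpm m)
  let a : ℕ → Ω → E := fun m ω => q (N m ω)
  have ham : ∀ m, Measurable (a m) := fun m => (measurable_from_nat (f := q)).comp (hN m)
  have hstat : ∀ m, Measurable fun ω => f (N m ω) ω := fun m =>
    measurable_from_prod_countable_right (f := fun z : ℕ × Ω => f z.1 z.2) hfm |>.comp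
      ((hN m).prodMk measurable_id)
  -- Off the measurable set of convergence the approximations are replaced by a fixed point, so that
  -- a limit exists everywhere and is measurable.
  let C : Set Ω := {ω | ∃ x, Tendsto (fun m => a m ω) atTop (𝓝 x)}
  have hC : MeasurableSet C := measurableSet_exists_tendsto ham
  let b : ℕ → Ω → E := fun m ω => if ω ∈ C then a m ω else q 0
  have hbm : ∀ m, Measurable (b m) := fun m => Measurable.ite hC (ham m) measurable_const
  have hblim : ∀ ω, ∃ x, Tendsto (fun m => b m ω) atTop (𝓝 x) := fun ω => by
    by_cases h : ω ∈ C
    · simp only [b, if_pos h]; exact h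
    · simp only [b, if_neg h]; exact ⟨_, tendsto_const_nhds⟩
  choose α hα using hblim
  have hαm : Measurable α := measurable_of_tendsto_metrizable hbm (tendsto_pi_nhds.2 hα)
  have hbK : ∀ m ω, b m ω ∈ K := fun m ω => by
    by_cases h : ω ∈ C
    · simp only [b, if_pos h]; exact hqK _
    · simp only [b, if_neg h]; exact hqK _
  have hαK : ∀ ω, α ω ∈ K := fun ω =>
    hK.isClosed.mem_of_tendsto (hα ω) (Eventually.of_forall fun m => hbK m ω)
  refine ⟨α, hαm.aemeasurable, ?_, ?_⟩
  -- Joint measurability of `F` is not available; the value at the limit is a limit of values at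
  -- countably many points, by continuity in the parameter.
  · refine aemeasurable_of_tendsto_metrizable_ae atTop
      (f := fun m ω => if ω ∈ C then f (N m ω) ω else f 0 ω)
      (fun m => (Measurable.ite hC (hstat m) (hfm 0)).aemeasurable) ?_
    filter_upwards [hFc, hf] with ω hc hω
    have h1 : Tendsto (fun m => F (b m ω) ω) atTop (𝓝 (F (α ω) ω)) :=
      (hc _ (hαK ω)).tendsto.comp
        (tendsto_nhdsWithin_iff.2 ⟨hα ω, Eventually.of_forall fun m => hbK m ω⟩)
    refine h1.congr fun m => ?_
    by_cases h : ω ∈ C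
    · simp only [b, if_pos h]; exact hω _
    · simp only [b, if_neg h]; exact hω _
  · filter_upwards [hFc, hf] with ω hc hω ⟨x, hxK, hx, huniq⟩
    suffices α ω = x by rw [this]; exact ⟨hxK, hx⟩
    have hlub : ∀ m : ℕ, ∃ l, F x ω - 1 / ((m : ℝ) + 1) ≤ f l ω := by
      intro m
      have hpos : (0 : ℝ) < 1 / ((m : ℝ) + 1) := by positivity
      have hcont : Continuous fun z : K => F z ω := continuousOn_iff_continuous_domRestrict.1 hc
      have hopen : IsOpen {z : K | F x ω - 1 / ((m : ℝ) + 1) < F z ω} :=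
        isOpen_lt continuous_const hcont
      obtain ⟨z, hz, l, rfl⟩ := (TopologicalSpace.denseRange_denseSeq K).inter_open_nonempty _ hopen
        ⟨⟨x, hxK⟩, by simpa using hpos⟩
      exact ⟨l, by rw [← hω]; exact le_of_lt hz⟩
    have hle : ∀ j, f j ω ≤ F x ω := fun j => by rw [← hω]; exact hx (hqK j)
    have ha : ∀ m : ℕ, F x ω - 1 / ((m : ℝ) + 1) ≤ F (a m ω) ω := by
      intro m
      have hspec : p m ω (N m ω) := Nat.find_spec (hpex m ω)
      have hall : ∀ j, f j ω - 1 / ((m : ℝ) + 1) ≤ f (N m ω) ω := by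
        refine hspec.resolve_right ?_
        rw [not_not]
        obtain ⟨l, hl⟩ := hlub m
        exact ⟨l, fun j => by linarith [hle j]⟩
      have : F (a m ω) ω = f (N m ω) ω := hω _
      rw [this]
      -- `a m` is compared only with points of the dense family; these come arbitrarily close to the
      -- true maximum.
      refine le_of_forall_pos_le_add fun ε hε => ?_
      obtain ⟨m', hm'⟩ := exists_nat_one_div_lt hε
      obtain ⟨l, hl⟩ := hlub m'
      linarith [hall l]
    have hlim := tendsto_of_unique_isMaxOn hK hc (fun m => hqK (N m ω)) hx huniq ha
    have hωC : ω ∈ C := ⟨x, hlim⟩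
    have hb := hα ω
    simp only [b, if_pos hωC] at hb
    exact tendsto_nhds_unique hb hlim

end Argmax

/-! ### Maxima of nearly quadratic functions -/

section Deterministic
open scoped RealInnerProductSpace
variable {E : Type*} [NormedAddCommGroup E] [InnerProductSpace ℝ E] [CompleteSpace E]

/-- `F` is differentiable on the closed ball of radius `ρ` around `a`, and its gradient `G` differs
from the affine map `α ↦ G a - S (α - a)` by an `ε`-Lipschitz map. -/
structure NearlyQuadratic (F : E → ℝ) (G : E → E) (S : E →L[ℝ] E) (a : E) (ρ ε : ℝ) : Prop where
  hasGradientAt : ∀ α ∈ Metric.closedBall a ρ, HasGradientAt F (G α) α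
  norm_sub_le : ∀ α ∈ Metric.closedBall a ρ, ∀ β ∈ Metric.closedBall a ρ,
    ‖G α - G β + S (α - β)‖ ≤ ε * ‖α - β‖

namespace NearlyQuadratic
variable {F : E → ℝ} {G : E → E} {S : E →L[ℝ] E} {a : E} {ρ ε : ℝ}

/-- Mean value inequality along the segment from `a` to `α`: once the quadratic is subtracted, the
derivative is the inner product of `v = α - a` with a vector of norm at most `ε * ‖v‖`. -/
lemma abs_sub_le (h : NearlyQuadratic F G S a ρ ε) (hε : 0 ≤ ε) {α : E}
    (hα : α ∈ Metric.closedBall a ρ) :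
    |F α - F a - (⟪G a, α - a⟫ - ⟪S (α - a), α - a⟫ / 2)| ≤ ε * ‖α - a‖ ^ 2 := by
  set v := α - a with hv
  have hvρ : ‖v‖ ≤ ρ := by simpa [hv, dist_eq_norm] using hα
  have hρ : 0 ≤ ρ := (norm_nonneg v).trans hvρ
  have hmem : ∀ t ∈ Set.Icc (0 : ℝ) 1, a + t • v ∈ Metric.closedBall a ρ := fun t ht => by
    rw [Metric.mem_closedBall, dist_eq_norm, add_sub_cancel_left, norm_smul,
      Real.norm_of_nonneg ht.1]
    exact (mul_le_of_le_one_left (norm_nonneg v) ht.2).trans hvρ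
  let ψ : ℝ → ℝ := fun t => F (a + t • v) - (t * ⟪G a, v⟫ - t ^ 2 * (⟪S v, v⟫ / 2))
  have hψ : ∀ t ∈ Set.Icc (0 : ℝ) 1, HasDerivWithinAt ψ
      (⟪G (a + t • v) - G a + t • S v, v⟫) (Set.Icc 0 1) t := fun t ht => by
    have h1 : HasDerivAt (fun t : ℝ => a + t • v) v t := by
      simpa using ((hasDerivAt_id t).smul_const v).const_add a
    have h2 := (h.hasGradientAt _ (hmem t ht)).hasFDerivAt.comp_hasDerivAt t h1
    have h3 : HasDerivAt (fun t : ℝ => t * ⟪G a, v⟫ - t ^ 2 * (⟪S v, v⟫ / 2))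
        (1 * ⟪G a, v⟫ - (2 * t) * (⟪S v, v⟫ / 2)) t := by
      refine ((hasDerivAt_id t).mul_const _).sub ?_
      simpa using (hasDerivAt_pow 2 t).mul_const (⟪S v, v⟫ / 2)
    refine (h2.sub h3).hasDerivWithinAt.congr_deriv ?_
    simp only [InnerProductSpace.toDual_apply_apply, inner_add_left, inner_sub_left,
      real_inner_smul_left]
    ring
  have hb : ∀ t ∈ Set.Icc (0 : ℝ) 1, ‖⟪G (a + t • v) - G a + t • S v, v⟫‖ ≤ ε * ‖v‖ ^ 2 :=
    fun t ht => by
    have h1 := h.norm_sub_le _ (hmem t ht) a (Metric.mem_closedBall_self hρ)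
    rw [add_sub_cancel_left, map_smul, norm_smul, Real.norm_of_nonneg ht.1] at h1
    have h2 : ‖G (a + t • v) - G a + t • S v‖ ≤ ε * ‖v‖ :=
      h1.trans (mul_le_mul_of_nonneg_left (mul_le_of_le_one_left (norm_nonneg v) ht.2) hε)
    calc _ ≤ ‖G (a + t • v) - G a + t • S v‖ * ‖v‖ := norm_inner_le_norm _ _
      _ ≤ ε * ‖v‖ * ‖v‖ := mul_le_mul_of_nonneg_right h2 (norm_nonneg v)
      _ = _ := by ring
  have key := (convex_Icc (0 : ℝ) 1).norm_image_sub_le_of_norm_hasDerivWithin_le hψ hb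
    (Set.left_mem_Icc.2 zero_le_one) (Set.right_mem_Icc.2 zero_le_one)
  have e1 : ψ 1 - ψ 0 = F α - F a - (⟪G a, v⟫ - ⟪S v, v⟫ / 2) := by
    simp only [ψ, hv, one_smul, zero_smul, add_zero, add_sub_cancel]
    ring
  rwa [e1, sub_zero, norm_one, mul_one, Real.norm_eq_abs] at key

/-- If the gradient at the centre is small, the maximum over the ball is attained in the interior
only. -/
lemma lt_of_norm_eq (h : NearlyQuadratic F G S a ρ ε) (hε : 0 ≤ ε) {c : ℝ}
    (hS : ∀ v, c * ‖v‖ ^ 2 ≤ ⟪S v, v⟫) (hεc : ε < c / 4) (hρ : 0 < ρ) (hs : ‖G a‖ < c / 4 * ρ)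
    {α : E} (hα : ‖α - a‖ = ρ) : F α < F a := by
  have h1 := (abs_le.1 (h.abs_sub_le hε (α := α) (by simp [dist_eq_norm, hα]))).2
  have h2 := hS (α - a)
  have h3 := real_inner_le_norm (G a) (α - a)
  rw [hα] at h1 h2 h3
  -- On the sphere the linear term contributes less than `c ρ² / 4`, the error less than `c ρ² / 4`,
  -- and the quadratic term at most `-c ρ² / 2`.
  have h4 : ‖G a‖ * ρ < c / 4 * ρ * ρ := mul_lt_mul_of_pos_right hs hρ
  have h5 : ε * ρ ^ 2 < c / 4 * ρ ^ 2 := mul_lt_mul_of_pos_right hεc (by positivity)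
  nlinarith

/-- At two zeros of the gradient `‖S (α - β)‖ ≤ ε * ‖α - β‖`, which coercivity with `c > ε` allows
only for `α = β`. -/
lemma eq_of_eq_zero (h : NearlyQuadratic F G S a ρ ε) {c : ℝ}
    (hS : ∀ v, c * ‖v‖ ^ 2 ≤ ⟪S v, v⟫) (hεc : ε < c) {α β : E}
    (hα : α ∈ Metric.closedBall a ρ) (hβ : β ∈ Metric.closedBall a ρ) (hGα : G α = 0)
    (hGβ : G β = 0) : α = β := by
  have h1 := h.norm_sub_le α hα β hβ
  rw [hGα, hGβ, sub_zero, zero_add] at h1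
  have h2 := hS (α - β)
  have h3 := real_inner_le_norm (S (α - β)) (α - β)
  have h4 := mul_le_mul_of_nonneg_right h1 (norm_nonneg (α - β))
  by_contra hne
  have h5 : 0 < ‖α - β‖ := norm_pos_iff.2 (sub_ne_zero.2 hne)
  have h6 : ε * ‖α - β‖ ^ 2 < c * ‖α - β‖ ^ 2 := mul_lt_mul_of_pos_right hεc (by positivity)
  nlinarith

lemma grad_eq_zero (h : NearlyQuadratic F G S a ρ ε) {α : E}
    (hα : α ∈ interior (Metric.closedBall a ρ)) (hmax : IsMaxOn F (Metric.closedBall a ρ) α) :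
    G α = 0 := by
  have h1 := (hmax.isLocalMax (mem_interior_iff_mem_nhds.1 hα)).hasFDerivAt_eq_zero
    (h.hasGradientAt α (interior_subset hα)).hasFDerivAt
  simpa using h1

/-- Compactness gives a maximizer, the comparison with the sphere puts every maximizer in the
interior, and interior maximizers are zeros of the gradient, of which there is at most one. -/
lemma exists_unique_isMaxOn [ProperSpace E] (h : NearlyQuadratic F G S a ρ ε) (hε : 0 ≤ ε) {c : ℝ}
    (hS : ∀ v, c * ‖v‖ ^ 2 ≤ ⟪S v, v⟫) (hεc : ε < c / 4) (hρ : 0 < ρ) (hs : ‖G a‖ < c / 4 * ρ) :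
    (∃ x ∈ Metric.closedBall a ρ, IsMaxOn F (Metric.closedBall a ρ) x ∧
      ∀ y ∈ Metric.closedBall a ρ, IsMaxOn F (Metric.closedBall a ρ) y → y = x) ∧
    ∀ x ∈ Metric.closedBall a ρ, IsMaxOn F (Metric.closedBall a ρ) x →
      x ∈ interior (Metric.closedBall a ρ) := by
  have ha : a ∈ Metric.closedBall a ρ := Metric.mem_closedBall_self hρ.le
  have hint : ∀ x ∈ Metric.closedBall a ρ, IsMaxOn F (Metric.closedBall a ρ) x →
      x ∈ interior (Metric.closedBall a ρ) := fun x hx hmax => by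
    refine Metric.ball_subset_interior_closedBall (Metric.mem_ball.2 ?_)
    refine lt_of_le_of_ne (Metric.mem_closedBall.1 hx) fun heq => ?_
    rw [dist_eq_norm] at heq
    exact (h.lt_of_norm_eq hε hS hεc hρ hs heq).not_ge (hmax ha)
  refine ⟨?_, hint⟩
  obtain ⟨x, hx, hmax⟩ := (isCompact_closedBall a ρ).exists_isMaxOn ⟨a, ha⟩
    fun α hα => (h.hasGradientAt α hα).continuousAt.continuousWithinAt
  refine ⟨x, hx, hmax, fun y hy hymax => ?_⟩
  have hc : ε < c := by
    have : 0 ≤ c / 4 := hε.trans hεc.le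
    linarith
  exact h.eq_of_eq_zero hS hc hy hx (h.grad_eq_zero (hint y hy hymax) hymax)
    (h.grad_eq_zero (hint x hx hmax) hmax)

/-- Expansions at a critical point. -/
lemma exists_critical_bounds (S T : E →L[ℝ] E) (hST : ∀ v, S (T v) = v)
    (hsymm : ∀ v w, ⟪S v, w⟫ = ⟪v, S w⟫) {c : ℝ} (hc : 0 < c)
    (hS : ∀ v, c * ‖v‖ ^ 2 ≤ ⟪S v, v⟫) :
    ∃ C : ℝ, ∀ (F : E → ℝ) (G : E → E) (a : E) (ρ ε : ℝ), NearlyQuadratic F G S a ρ ε → 0 ≤ ε →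
      ε < c / 4 → ∀ α ∈ Metric.closedBall a ρ, G α = 0 →
      ‖α - a - T (G a)‖ ≤ C * ε * ‖G a‖ ∧
      |F α - F a - ⟪G a, T (G a)⟫ / 2| ≤ C * ε * ‖G a‖ ^ 2 ∧
      |F α - F a| ≤ C * ‖G a‖ ^ 2 := by
  have hbelow : ∀ v, c * ‖v‖ ≤ ‖S v‖ := fun v => by
    rcases eq_or_ne v 0 with rfl | hv
    · simp
    · have h1 := (hS v).trans (real_inner_le_norm (S v) v)
      have : 0 < ‖v‖ := norm_pos_iff.2 hv
      nlinarith
  have key : ∀ (F : E → ℝ) (G : E → E) (a : E) (ρ ε : ℝ), NearlyQuadratic F G S a ρ ε → 0 ≤ ε →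
      ε < c / 4 → ∀ α ∈ Metric.closedBall a ρ, G α = 0 →
      ‖α - a - T (G a)‖ ≤ 2 / c ^ 2 * ε * ‖G a‖ ∧
      |F α - F a - ⟪G a, T (G a)⟫ / 2| ≤ (‖S‖ / c ^ 3 + 4 / c ^ 2) * ε * ‖G a‖ ^ 2 ∧
      |F α - F a| ≤ ((‖S‖ / c ^ 3 + 4 / c ^ 2) * c + ‖T‖) * ‖G a‖ ^ 2 := by
    intro F G a ρ ε h hε hεc α hα hG
    set s := G a
    set v := α - a
    have hρ : 0 ≤ ρ := dist_nonneg.trans hα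
    -- The Lipschitz estimate between `α` and the centre: the exact critical point nearly solves `S
    -- v = s`, and `w` below is its deviation from the solution `T s`.
    have h1 : ‖S v - s‖ ≤ ε * ‖v‖ := by
      have := h.norm_sub_le α hα a (Metric.mem_closedBall_self hρ)
      rwa [hG, zero_sub, neg_add_eq_sub] at this
    have hv : ‖v‖ ≤ 2 / c * ‖s‖ := by
      have h2 : ‖S v‖ ≤ ‖S v - s‖ + ‖s‖ := by simpa using norm_add_le (S v - s) s
      have h3 := hbelow v
      have h4 : ε * ‖v‖ ≤ c / 4 * ‖v‖ := mul_le_mul_of_nonneg_right hεc.le (norm_nonneg _)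
      rw [div_mul_eq_mul_div, le_div_iff₀ hc]
      nlinarith [norm_nonneg v]
    set w := v - T s
    have hSw : S w = S v - s := by simp only [w, map_sub, hST]
    have hw : ‖w‖ ≤ 2 / c ^ 2 * ε * ‖s‖ := by
      have h2 := hbelow w
      rw [hSw] at h2
      have h3 : c * ‖w‖ ≤ ε * (2 / c * ‖s‖) :=
        h2.trans (h1.trans (mul_le_mul_of_nonneg_left hv hε))
      have h4 : 2 / c ^ 2 * ε * ‖s‖ = ε * (2 / c * ‖s‖) / c := by field_simp
      rw [h4, le_div_iff₀ hc]; linarith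
    -- Completing the square around `T s`; symmetry of `S` cancels the cross terms.
    have hquad : ⟪s, v⟫ - ⟪S v, v⟫ / 2 = ⟪s, T s⟫ / 2 - ⟪S w, w⟫ / 2 := by
      have e : v = T s + w := by simp [w]
      have e2 : ⟪S w, T s⟫ = ⟪s, w⟫ := by rw [hsymm, hST, real_inner_comm]
      rw [e, map_add, hST, inner_add_right, inner_add_right, inner_add_left, inner_add_left, e2]
      ring
    have h5 := h.abs_sub_le hε hα
    change |F α - F a - (⟪s, v⟫ - ⟪S v, v⟫ / 2)| ≤ ε * ‖v‖ ^ 2 at h5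
    rw [hquad] at h5
    have h6 : |⟪S w, w⟫ / 2| ≤ ‖S‖ / c ^ 3 * ε * ‖s‖ ^ 2 := by
      have h7 : |⟪S w, w⟫| ≤ ‖S‖ * ‖w‖ ^ 2 := by
        calc |⟪S w, w⟫| ≤ ‖S w‖ * ‖w‖ := abs_real_inner_le_norm _ _
          _ ≤ ‖S‖ * ‖w‖ * ‖w‖ := mul_le_mul_of_nonneg_right (S.le_opNorm w) (norm_nonneg _)
          _ = _ := by ring
      have h8 : ‖w‖ ^ 2 ≤ (2 / c ^ 2 * ε * ‖s‖) ^ 2 := pow_le_pow_left₀ (norm_nonneg _) hw 2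
      -- The square is of order `ε²`; one factor is given up through `4 * ε / c ≤ 1`.
      have h9 : (2 / c ^ 2 * ε * ‖s‖) ^ 2 ≤ 1 / c ^ 3 * ε * ‖s‖ ^ 2 := by
        have : (2 / c ^ 2 * ε * ‖s‖) ^ 2 = (4 * ε / c) * (1 / c ^ 3 * ε * ‖s‖ ^ 2) := by
          field_simp; ring
        rw [this]
        refine mul_le_of_le_one_left (by positivity) ?_
        rw [div_le_one hc]; linarith
      rw [abs_div, abs_two]
      have h10 : ‖S‖ * ‖w‖ ^ 2 ≤ ‖S‖ * (1 / c ^ 3 * ε * ‖s‖ ^ 2) :=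
        mul_le_mul_of_nonneg_left (h8.trans h9) (norm_nonneg _)
      have h11 : ‖S‖ / c ^ 3 * ε * ‖s‖ ^ 2 = ‖S‖ * (1 / c ^ 3 * ε * ‖s‖ ^ 2) := by ring
      have h12 : 0 ≤ ‖S‖ / c ^ 3 * ε * ‖s‖ ^ 2 := by positivity
      rw [← h11] at h10
      linarith [abs_nonneg ⟪S w, w⟫]
    have h13 : ε * ‖v‖ ^ 2 ≤ 4 / c ^ 2 * ε * ‖s‖ ^ 2 := by
      have := mul_le_mul_of_nonneg_left (pow_le_pow_left₀ (norm_nonneg _) hv 2) hε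
      calc _ ≤ _ := this
        _ = _ := by ring
    have hB : |F α - F a - ⟪s, T s⟫ / 2| ≤ (‖S‖ / c ^ 3 + 4 / c ^ 2) * ε * ‖s‖ ^ 2 := by
      have e : F α - F a - ⟪s, T s⟫ / 2 =
        (F α - F a - (⟪s, T s⟫ / 2 - ⟪S w, w⟫ / 2)) - ⟪S w, w⟫ / 2 := by ring
      rw [e]
      refine (abs_sub _ _).trans ?_
      calc _ ≤ 4 / c ^ 2 * ε * ‖s‖ ^ 2 + ‖S‖ / c ^ 3 * ε * ‖s‖ ^ 2 :=
            add_le_add (h5.trans h13) h6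
        _ = _ := by ring
    refine ⟨hw, hB, ?_⟩
    have h14 : |⟪s, T s⟫ / 2| ≤ ‖T‖ * ‖s‖ ^ 2 := by
      rw [abs_div, abs_two]
      have : |⟪s, T s⟫| ≤ ‖T‖ * ‖s‖ ^ 2 := by
        calc |⟪s, T s⟫| ≤ ‖s‖ * ‖T s‖ := abs_real_inner_le_norm _ _
          _ ≤ ‖s‖ * (‖T‖ * ‖s‖) := mul_le_mul_of_nonneg_left (T.le_opNorm s) (norm_nonneg _)
          _ = _ := by ring
      linarith [abs_nonneg ⟪s, T s⟫]
    have h15 : (‖S‖ / c ^ 3 + 4 / c ^ 2) * ε * ‖s‖ ^ 2 ≤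
        (‖S‖ / c ^ 3 + 4 / c ^ 2) * c * ‖s‖ ^ 2 := by
      have : ε ≤ c := by linarith
      gcongr
    have e : F α - F a = (F α - F a - ⟪s, T s⟫ / 2) + ⟪s, T s⟫ / 2 := by ring
    rw [e]
    refine (abs_add_le _ _).trans ?_
    calc _ ≤ (‖S‖ / c ^ 3 + 4 / c ^ 2) * c * ‖s‖ ^ 2 + ‖T‖ * ‖s‖ ^ 2 :=
          add_le_add (hB.trans h15) h14
      _ = _ := by ring
  refine ⟨max (2 / c ^ 2) (max (‖S‖ / c ^ 3 + 4 / c ^ 2)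
    ((‖S‖ / c ^ 3 + 4 / c ^ 2) * c + ‖T‖)), fun F G a ρ ε h hε hεc α hα hG => ?_⟩
  obtain ⟨k1, k2, k3⟩ := key F G a ρ ε h hε hεc α hα hG
  refine ⟨k1.trans ?_, k2.trans ?_, k3.trans ?_⟩
  · gcongr; exact le_max_left _ _
  · gcongr; exact (le_max_left _ _).trans (le_max_right _ _)
  · gcongr; exact (le_max_right _ _).trans (le_max_right _ _)

end NearlyQuadratic
end Deterministic

/-! ### Empirical means of an i.i.d. sample -/

section Empirical

lemma empMean_sub {Ω 𝒳 E : Type*} [AddCommGroup E] [Module ℝ E] {X : ℕ → Ω → 𝒳} (n : ℕ) (ω : Ω)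
    (ψ χ : 𝒳 → E) :
    empMean X n ω ψ - empMean X n ω χ = empMean X n ω fun x => ψ x - χ x := by
  simp [empMean, Finset.sum_sub_distrib, smul_sub]

lemma norm_empMean_le {Ω 𝒳 E : Type*} [NormedAddCommGroup E] [NormedSpace ℝ E] {X : ℕ → Ω → 𝒳}
    {n : ℕ} {ω : Ω} {ψ : 𝒳 → E} {χ : 𝒳 → ℝ} (h : ∀ i, ‖ψ (X i ω)‖ ≤ χ (X i ω)) :
    ‖empMean X n ω ψ‖ ≤ empMean X n ω χ := by
  unfold empMean
  rw [norm_smul, Real.norm_of_nonneg (by positivity), smul_eq_mul]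
  exact mul_le_mul_of_nonneg_left (norm_sum_le_of_le _ fun i _ => h i) (by positivity)

variable {Ω 𝒳 : Type*} [MeasurableSpace Ω] [MeasurableSpace 𝒳] {μ : Measure Ω}
  {ν : Measure 𝒳} {X : ℕ → Ω → 𝒳}

lemma ae_forall_of_hasLaw (hX : ∀ i, HasLaw (X i) ν μ) {q : 𝒳 → Prop} (hq : ∀ᵐ x ∂ν, q x) :
    ∀ᵐ ω ∂μ, ∀ i, q (X i ω) :=
  ae_all_iff.2 fun i => ae_of_ae_map (hX i).aemeasurable ((hX i).map_eq.symm ▸ hq)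

section
variable {E : Type*} [MeasurableSpace E]

lemma identDistrib_comp (hX : ∀ i, HasLaw (X i) ν μ) {ψ : 𝒳 → E} (hψ : AEMeasurable ψ ν) (i : ℕ) :
    IdentDistrib (fun ω => ψ (X i ω)) (fun ω => ψ (X 0 ω)) μ μ :=
  ((hX i).identDistrib (hX 0)).comp_of_aemeasurable ((hX i).map_eq.symm ▸ hψ)

lemma iIndepFun_comp (hX : ∀ i, HasLaw (X i) ν μ) (hindep : iIndepFun X μ) {ψ : 𝒳 → E}
    (hψ : AEMeasurable ψ ν) : iIndepFun (fun i ω => ψ (X i ω)) μ :=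
  hindep.comp₀ (fun _ => ψ) (fun i => (hX i).aemeasurable) fun i => (hX i).map_eq.symm ▸ hψ

end

variable {E : Type*} [NormedAddCommGroup E] [NormedSpace ℝ E] [MeasurableSpace E] [BorelSpace E]

lemma aemeasurable_empMean [SecondCountableTopology E] (hX : ∀ i, HasLaw (X i) ν μ) {ψ : 𝒳 → E}
    (hψ : AEMeasurable ψ ν) (n : ℕ) : AEMeasurable (fun ω => empMean X n ω ψ) μ := by
  have h : ∀ i, AEMeasurable (fun ω => ψ (X i ω)) μ := fun i =>
    ((hX i).map_eq.symm ▸ hψ).comp_aemeasurable (hX i).aemeasurable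
  have := Finset.aemeasurable_fun_sum (Finset.range n) fun i _ => h i
  unfold empMean
  fun_prop

lemma ae_tendsto_empMean [IsProbabilityMeasure μ] [CompleteSpace E] [SecondCountableTopology E]
    (hX : ∀ i, HasLaw (X i) ν μ) (hindep : iIndepFun X μ) {ψ : 𝒳 → E}
    (hψ : Integrable ψ ν) :
    ∀ᵐ ω ∂μ, Tendsto (fun n => empMean X n ω ψ) atTop (𝓝 (∫ x, ψ x ∂ν)) := by
  have hm : AEMeasurable ψ ν := hψ.aestronglyMeasurable.aemeasurable
  have hind := iIndepFun_comp hX hindep hm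
  have h0 : Integrable (fun ω => ψ (X 0 ω)) μ :=
    ((hX 0).map_eq.symm ▸ hψ : Integrable ψ (μ.map (X 0))).comp_aemeasurable (hX 0).aemeasurable
  have h := strong_law_ae (fun i ω => ψ (X i ω)) h0 (fun i j hij => hind.indepFun hij)
    (identDistrib_comp hX hm)
  have h1 : ∫ ω, ψ (X 0 ω) ∂μ = ∫ x, ψ x ∂ν := (hX 0).integral_comp hψ.aestronglyMeasurable
  rwa [h1] at h

end Empirical

/-! ### Local maximizers of a regular random criterion -/

/-- The radius `n ^ (-1/3)`. -/
noncomputable def radius13 (n : ℕ) : ℝ := (n : ℝ) ^ (-(1 / 3) : ℝ)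

lemma radius13_nonneg (n : ℕ) : 0 ≤ radius13 n := Real.rpow_nonneg n.cast_nonneg _

lemma tendsto_radius13 : Tendsto radius13 atTop (𝓝 0) :=
  (tendsto_rpow_neg_atTop (by norm_num)).comp tendsto_natCast_atTop_atTop

lemma eventually_radius13_pos : ∀ᶠ n in atTop, 0 < radius13 n := by
  filter_upwards [eventually_gt_atTop 0] with n hn
  exact Real.rpow_pos_of_pos (by exact_mod_cast hn) _

open scoped RealInnerProductSpace

/-- A criterion function `h α x` that is smooth in `α` around `a`, with gradient `sc` and Hessian
`Hs` at `a`, such that the mean of the gradient vanishes at `a` and the mean Hessian is `-S`. -/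
structure RegularCriterion {d : ℕ} {𝒳 : Type*} [MeasurableSpace 𝒳] (ν : Measure 𝒳)
    (h : EuclideanSpace ℝ (Fin d) → 𝒳 → ℝ)
    (sc : EuclideanSpace ℝ (Fin d) → 𝒳 → EuclideanSpace ℝ (Fin d))
    (Hs : 𝒳 → EuclideanSpace ℝ (Fin d) →L[ℝ] EuclideanSpace ℝ (Fin d)) (K : 𝒳 → ℝ)
    (S : EuclideanSpace ℝ (Fin d) →L[ℝ] EuclideanSpace ℝ (Fin d))
    (a : EuclideanSpace ℝ (Fin d)) (δ : ℝ) : Prop where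
  delta_pos : 0 < δ
  aemeasurable : ∀ α ∈ Metric.ball a δ, AEMeasurable (h α) ν
  hasGradientAt : ∀ᵐ x ∂ν, ∀ α ∈ Metric.ball a δ, HasGradientAt (fun α => h α x) (sc α x) α
  norm_sub_le : ∀ᵐ x ∂ν, ∀ ρ, 0 ≤ ρ → ρ < δ → ∀ α ∈ Metric.closedBall a ρ,
    ∀ β ∈ Metric.closedBall a ρ, ‖sc α x - sc β x - Hs x (α - β)‖ ≤ K x * ρ * ‖α - β‖
  K_nonneg : ∀ x, 0 ≤ K x
  integrable_K : Integrable K ν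
  integrable_Hs : Integrable Hs ν
  memLp_score : MemLp (sc a) 2 ν
  integral_score : ∀ i, ∫ x, sc a x i ∂ν = 0
  integral_Hs : ∫ x, Hs x ∂ν = -S

namespace RegularCriterion
variable {d : ℕ} {Ω 𝒳 : Type*} [MeasurableSpace Ω] [MeasurableSpace 𝒳] {μ : Measure Ω}
  {ν : Measure 𝒳} {X : ℕ → Ω → 𝒳}
  {h : EuclideanSpace ℝ (Fin d) → 𝒳 → ℝ}
  {sc : EuclideanSpace ℝ (Fin d) → 𝒳 → EuclideanSpace ℝ (Fin d)}
  {Hs : 𝒳 → EuclideanSpace ℝ (Fin d) →L[ℝ] EuclideanSpace ℝ (Fin d)} {K : 𝒳 → ℝ}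
  {S : EuclideanSpace ℝ (Fin d) →L[ℝ] EuclideanSpace ℝ (Fin d)}
  {a : EuclideanSpace ℝ (Fin d)} {δ : ℝ}

/-- The random error bound in the quadratic expansion of the empirical criterion. -/
noncomputable def err (X : ℕ → Ω → 𝒳)
    (Hs : 𝒳 → EuclideanSpace ℝ (Fin d) →L[ℝ] EuclideanSpace ℝ (Fin d)) (K : 𝒳 → ℝ)
    (S : EuclideanSpace ℝ (Fin d) →L[ℝ] EuclideanSpace ℝ (Fin d)) (n : ℕ) (ω : Ω) : ℝ :=
  ‖empMean X n ω Hs + S‖ + empMean X n ω K * radius13 n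

lemma err_nonneg {Ω : Type*} {X : ℕ → Ω → 𝒳} (hR : RegularCriterion ν h sc Hs K S a δ) (n : ℕ)
    (ω : Ω) :
    0 ≤ err X Hs K S n ω := by
  have : 0 ≤ empMean X n ω K := by
    have := norm_empMean_le (X := X) (n := n) (ω := ω) (ψ := K) (χ := K)
      fun i => (Real.norm_of_nonneg (hR.K_nonneg _)).le
    exact (norm_nonneg _).trans this
  have := radius13_nonneg n
  unfold err
  positivity

lemma aemeasurable_err (hR : RegularCriterion ν h sc Hs K S a δ) (hX : ∀ i, HasLaw (X i) ν μ)
    (n : ℕ) : AEMeasurable (err X Hs K S n) μ := by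
  have h1 := aemeasurable_empMean hX hR.integrable_Hs.aestronglyMeasurable.aemeasurable n
  have h2 := aemeasurable_empMean hX hR.integrable_K.aestronglyMeasurable.aemeasurable n
  unfold err
  fun_prop

/-- The empirical criterion is nearly quadratic on the ball of radius `n ^ (-1/3)`. -/
lemma ae_nearlyQuadratic (hR : RegularCriterion ν h sc Hs K S a δ)
    (hX : ∀ i, HasLaw (X i) ν μ) :
    ∀ᵐ ω ∂μ, ∀ n, n ≠ 0 → radius13 n < δ →
      NearlyQuadratic (fun α => empMean X n ω (h α)) (fun α => empMean X n ω (sc α)) S a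
        (radius13 n) (err X Hs K S n ω) := by
  filter_upwards [ae_forall_of_hasLaw hX hR.hasGradientAt, ae_forall_of_hasLaw hX hR.norm_sub_le]
    with ω hg hl n hn hρ
  refine ⟨fun α hα => ?_, fun α hα β hβ => ?_⟩
  · have hα' : α ∈ Metric.ball a δ := Metric.closedBall_subset_ball hρ hα
    have h1 := (HasFDerivAt.fun_sum (u := Finset.range n)
      fun i _ => (hg i α hα').hasFDerivAt).const_smul (n : ℝ)⁻¹
    rw [hasGradientAt_iff_hasFDerivAt]
    convert! h1 using 1
    simp [empMean]
  · have h1 := norm_empMean_le (X := X) (n := n) (ω := ω)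
      (ψ := fun x => sc α x - sc β x - Hs x (α - β)) (χ := fun x => K x * radius13 n * ‖α - β‖)
      fun i => hl i _ (radius13_nonneg n) hρ α hα β hβ
    have e1 : empMean X n ω (fun x => K x * radius13 n * ‖α - β‖) =
        empMean X n ω K * radius13 n * ‖α - β‖ := by
      simp [empMean, Finset.sum_mul, mul_assoc]
    have e2 : empMean X n ω (fun x => sc α x - sc β x - Hs x (α - β)) =
        empMean X n ω (sc α) - empMean X n ω (sc β) - (empMean X n ω Hs) (α - β) := by
      rw [empMean_sub, ← empMean_sub]
      simp [empMean]
    rw [e1, e2] at h1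
    -- Two errors: the averaged Taylor remainder of the gradient, and the deviation of the empirical
    -- Hessian from its mean `-S`. They are the two terms of `err`.
    have e3 : empMean X n ω (sc α) - empMean X n ω (sc β) + S (α - β) =
        (empMean X n ω (sc α) - empMean X n ω (sc β) - (empMean X n ω Hs) (α - β)) +
          (empMean X n ω Hs + S) (α - β) := by
      rw [add_apply]; abel
    rw [e3]
    refine (norm_add_le _ _).trans ?_
    have h2 := (empMean X n ω Hs + S).le_opNorm (α - β)
    unfold err
    linarith

variable [IsProbabilityMeasure μ]

lemma ae_tendsto_err (hR : RegularCriterion ν h sc Hs K S a δ) (hX : ∀ i, HasLaw (X i) ν μ)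
    (hindep : iIndepFun X μ) :
    ∀ᵐ ω ∂μ, Tendsto (fun n => err X Hs K S n ω) atTop (𝓝 0) := by
  filter_upwards [ae_tendsto_empMean hX hindep hR.integrable_Hs,
    ae_tendsto_empMean hX hindep hR.integrable_K] with ω h1 h2
  rw [hR.integral_Hs] at h1
  have := (h1.add_const S).norm.add (h2.mul tendsto_radius13)
  simpa [err] using this

lemma ae_tendsto_rpow_mul_norm_score (hR : RegularCriterion ν h sc Hs K S a δ)
    (hX : ∀ i, HasLaw (X i) ν μ) (hindep : iIndepFun X μ) :
    ∀ᵐ ω ∂μ, Tendsto (fun n : ℕ => (n : ℝ) ^ (1 / 3 : ℝ) * ‖empMean X n ω (sc a)‖) atTop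
      (𝓝 0) := by
  have hc : ∀ j, MemLp (fun x => sc a x j) 2 ν := fun j =>
    (EuclideanSpace.proj (𝕜 := ℝ) j).comp_memLp' hR.memLp_score
  have key : ∀ j, ∀ᵐ ω ∂μ, Tendsto (fun n : ℕ => (n : ℝ) ^ (1 / 3 : ℝ) *
      ((n : ℝ)⁻¹ * ∑ k ∈ Finset.range n, sc a (X k ω) j)) atTop (𝓝 0) := fun j => by
    have hm : AEMeasurable (fun x => sc a x j) ν := (hc j).aestronglyMeasurable.aemeasurable
    refine ae_tendsto_rpow_mul_mean (Y := fun k ω => sc a (X k ω) j) (iIndepFun_comp hX hindep hm)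
      (identDistrib_comp hX hm) ?_ ?_
    · exact ((hX 0).map_eq.symm ▸ hc j : MemLp _ 2 (μ.map (X 0))).comp_of_map (hX 0).aemeasurable
    · exact ((hX 0).integral_comp (hc j).aestronglyMeasurable).trans (hR.integral_score j)
  filter_upwards [ae_all_iff.2 key] with ω hω
  have h1 : Tendsto (fun n : ℕ => ((n : ℝ) ^ (1 / 3 : ℝ)) • empMean X n ω (sc a)) atTop (𝓝 0) := by
    rw [← (EuclideanSpace.equiv (Fin d) ℝ).toHomeomorph.isInducing.tendsto_nhds_iff.symm.eq]
    refine tendsto_pi_nhds.2 fun j => ?_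
    simpa [empMean] using hω j
  simpa [norm_smul, abs_of_nonneg (Real.rpow_nonneg (Nat.cast_nonneg _) _)] using h1.norm

/-- Almost surely, for all large `n`, the empirical criterion has a non-degenerate maximum. -/
lemma ae_eventually_good (hR : RegularCriterion ν h sc Hs K S a δ)
    (hX : ∀ i, HasLaw (X i) ν μ) (hindep : iIndepFun X μ) {c : ℝ} (hc : 0 < c) :
    ∀ᵐ ω ∂μ, ∀ᶠ n in atTop, 0 < radius13 n ∧ radius13 n < δ ∧
      NearlyQuadratic (fun α => empMean X n ω (h α)) (fun α => empMean X n ω (sc α)) S a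
        (radius13 n) (err X Hs K S n ω) ∧
      err X Hs K S n ω < c / 4 ∧ ‖empMean X n ω (sc a)‖ < c / 4 * radius13 n := by
  filter_upwards [hR.ae_nearlyQuadratic hX, hR.ae_tendsto_err hX hindep,
    hR.ae_tendsto_rpow_mul_norm_score hX hindep] with ω h1 h2 h3
  filter_upwards [eventually_ne_atTop 0, eventually_radius13_pos,
    tendsto_radius13.eventually_lt_const hR.delta_pos, h2.eventually_lt_const (by positivity :
      0 < c / 4), h3.eventually_lt_const (by positivity : 0 < c / 4)] with n hn hpos hδ herr hsc
  refine ⟨hpos, hδ, h1 n hn hδ, herr, ?_⟩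
  -- The rate of the strong law is the reciprocal of the radius, so the score is eventually below
  -- any fixed multiple of the radius.
  have e : (n : ℝ) ^ (1 / 3 : ℝ) * radius13 n = 1 := by
    unfold radius13
    rw [← Real.rpow_add (by positivity)]; norm_num
  calc ‖empMean X n ω (sc a)‖ = (n : ℝ) ^ (1 / 3 : ℝ) * ‖empMean X n ω (sc a)‖ * radius13 n := by
        rw [mul_right_comm, e, one_mul]
    _ < _ := mul_lt_mul_of_pos_right hsc hpos

/-- Existence of measurable local maximizers. -/
lemma exists_local_maximizer (hR : RegularCriterion ν h sc Hs K S a δ)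
    (hX : ∀ i, HasLaw (X i) ν μ) (hindep : iIndepFun X μ) {c : ℝ} (hc : 0 < c)
    (hS : ∀ v, c * ‖v‖ ^ 2 ≤ ⟪S v, v⟫) :
    ∃ αt : ℕ → Ω → EuclideanSpace ℝ (Fin d), (∀ n, AEMeasurable (αt n) μ) ∧
      (∀ n, AEMeasurable (fun ω => empMean X n ω (h (αt n ω))) μ) ∧
      ∀ᵐ ω ∂μ, ∀ᶠ n in atTop, αt n ω ∈ interior (Metric.closedBall a (radius13 n)) ∧
        IsMaxOn (fun α => empMean X n ω (h α)) (Metric.closedBall a (radius13 n)) (αt n ω) := by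
  have hmeas : ∀ n, ∀ α ∈ Metric.ball a δ, AEMeasurable (fun ω => empMean X n ω (h α)) μ :=
    fun n α hα => aemeasurable_empMean hX (hR.aemeasurable α hα) n
  have key : ∀ n, ∃ b : Ω → EuclideanSpace ℝ (Fin d), AEMeasurable b μ ∧
      AEMeasurable (fun ω => empMean X n ω (h (b ω))) μ ∧ (n ≠ 0 → radius13 n < δ → ∀ᵐ ω ∂μ,
        (∃ x ∈ Metric.closedBall a (radius13 n),
          IsMaxOn (fun α => empMean X n ω (h α)) (Metric.closedBall a (radius13 n)) x ∧
          ∀ y ∈ Metric.closedBall a (radius13 n),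
            IsMaxOn (fun α => empMean X n ω (h α)) (Metric.closedBall a (radius13 n)) y → y = x) →
        b ω ∈ Metric.closedBall a (radius13 n) ∧
          IsMaxOn (fun α => empMean X n ω (h α)) (Metric.closedBall a (radius13 n)) (b ω)) := by
    intro n
    by_cases hn : n ≠ 0 ∧ radius13 n < δ
    · obtain ⟨b, h1, h2, h3⟩ := exists_aemeasurable_argmax (μ := μ)
        (isCompact_closedBall a (radius13 n)) ⟨a, Metric.mem_closedBall_self (radius13_nonneg n)⟩
        (F := fun α ω => empMean X n ω (h α))
        (fun α hα => hmeas n α (Metric.closedBall_subset_ball hn.2 hα))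
        (by
          filter_upwards [hR.ae_nearlyQuadratic hX] with ω hω α hα
          exact ((hω n hn.1 hn.2).hasGradientAt α hα).continuousAt.continuousWithinAt)
      exact ⟨b, h1, h2, fun _ _ => h3⟩
    -- For small `n` the ball may leave the region of regularity; any choice with a measurable
    -- criterion value will do there.
    · exact ⟨fun _ => a, aemeasurable_const, hmeas n a (Metric.mem_ball_self hR.delta_pos),
        fun h1 h2 => absurd ⟨h1, h2⟩ hn⟩
  choose b h1 h2 h3 using key
  refine ⟨b, h1, h2, ?_⟩
  have h4 : ∀ᵐ ω ∂μ, ∀ n, n ≠ 0 → radius13 n < δ → (∃ x ∈ Metric.closedBall a (radius13 n),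
          IsMaxOn (fun α => empMean X n ω (h α)) (Metric.closedBall a (radius13 n)) x ∧
          ∀ y ∈ Metric.closedBall a (radius13 n),
            IsMaxOn (fun α => empMean X n ω (h α)) (Metric.closedBall a (radius13 n)) y → y = x) →
        b n ω ∈ Metric.closedBall a (radius13 n) ∧
          IsMaxOn (fun α => empMean X n ω (h α)) (Metric.closedBall a (radius13 n)) (b n ω) := by
    simp_rw [ae_all_iff]
    exact fun n hn hδ => h3 n hn hδ
  filter_upwards [hR.ae_eventually_good hX hindep hc, h4] with ω h5 h6
  filter_upwards [h5, eventually_ne_atTop 0] with n ⟨hpos, hδ, hQ, herr, hsc⟩ hn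
  obtain ⟨h7, h8⟩ := hQ.exists_unique_isMaxOn (hR.err_nonneg n ω) hS herr hpos hsc
  obtain ⟨h9, h10⟩ := h6 n hn hδ h7
  exact ⟨h8 _ h9 h10, h10⟩

section Maximizer
variable {αt : ℕ → Ω → EuclideanSpace ℝ (Fin d)}

lemma ae_eventually_score_eq_zero (hR : RegularCriterion ν h sc Hs K S a δ)
    (hX : ∀ i, HasLaw (X i) ν μ) (hindep : iIndepFun X μ)
    (hmax : ∀ᵐ ω ∂μ, ∀ᶠ n in atTop, αt n ω ∈ interior (Metric.closedBall a (radius13 n)) ∧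
        IsMaxOn (fun α => empMean X n ω (h α)) (Metric.closedBall a (radius13 n)) (αt n ω)) :
    ∀ᵐ ω ∂μ, ∀ᶠ n in atTop, empMean X n ω (sc (αt n ω)) = 0 := by
  -- The constant `1` is arbitrary: only the near-quadratic part of the event is used.
  filter_upwards [hR.ae_eventually_good hX hindep one_pos, hmax] with ω h1 h2
  filter_upwards [h1, h2] with n ⟨_, _, hQ, _⟩ ⟨h3, h4⟩
  exact hQ.grad_eq_zero h3 h4

/-- The normalized score. -/
noncomputable def normScore (X : ℕ → Ω → 𝒳)
    (sc : EuclideanSpace ℝ (Fin d) → 𝒳 → EuclideanSpace ℝ (Fin d)) (a : EuclideanSpace ℝ (Fin d))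
    (n : ℕ) (ω : Ω) : EuclideanSpace ℝ (Fin d) := √(n : ℝ) • empMean X n ω (sc a)

lemma tendstoInDistribution_normScore (hR : RegularCriterion ν h sc Hs K S a δ)
    (hX : ∀ i, HasLaw (X i) ν μ) (hindep : iIndepFun X μ) {V : Matrix (Fin d) (Fin d) ℝ}
    (hV : ∀ i j, V i j = ∫ x, sc a x i * sc a x j ∂ν) :
    V.PosSemidef ∧ TendstoInDistribution (normScore X sc a) atTop id (fun _ => μ)
      (multivariateGaussian 0 V) := by
  have hm : AEMeasurable (sc a) ν := hR.memLp_score.aestronglyMeasurable.aemeasurable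
  have hc : ∀ j, MemLp (fun x => sc a x j) 2 ν := fun j =>
    (EuclideanSpace.proj (𝕜 := ℝ) j).comp_memLp' hR.memLp_score
  refine tendstoInDistribution_sqrt_smul_mean (Y := fun k ω => sc a (X k ω))
    (iIndepFun_comp hX hindep hm) (identDistrib_comp hX hm) ?_ (fun j => ?_) fun i j => ?_
  · exact ((hX 0).map_eq.symm ▸ hR.memLp_score : MemLp _ 2 (μ.map (X 0))).comp_of_map
      (hX 0).aemeasurable
  · exact ((hX 0).integral_comp (hc j).aestronglyMeasurable).trans (hR.integral_score j)
  · rw [hV]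
    exact ((hX 0).integral_comp (f := fun x => sc a x i * sc a x j)
      ((hc i).aestronglyMeasurable.mul (hc j).aestronglyMeasurable)).symm

/-- First order expansions of the local maximizers and of the maximal value. -/
lemma tendstoInMeasure_expansions (hR : RegularCriterion ν h sc Hs K S a δ)
    (hX : ∀ i, HasLaw (X i) ν μ) (hindep : iIndepFun X μ) {c : ℝ} (hc : 0 < c)
    (hS : ∀ v, c * ‖v‖ ^ 2 ≤ ⟪S v, v⟫)
    (T : EuclideanSpace ℝ (Fin d) →L[ℝ] EuclideanSpace ℝ (Fin d)) (hST : ∀ v, S (T v) = v)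
    (hsymm : ∀ v w, ⟪S v, w⟫ = ⟪v, S w⟫)
    (hαm : ∀ n, AEMeasurable (αt n) μ)
    (hstat : ∀ n, AEMeasurable (fun ω => empMean X n ω (h (αt n ω))) μ)
    (hmax : ∀ᵐ ω ∂μ, ∀ᶠ n in atTop, αt n ω ∈ interior (Metric.closedBall a (radius13 n)) ∧
        IsMaxOn (fun α => empMean X n ω (h α)) (Metric.closedBall a (radius13 n)) (αt n ω)) :
    TendstoInMeasure μ (fun (n : ℕ) ω => √(n : ℝ) • (αt n ω - a) - T (normScore X sc a n ω))
      atTop 0 ∧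
    TendstoInMeasure μ (fun (n : ℕ) ω => n * (empMean X n ω (h (αt n ω)) - empMean X n ω (h a)) -
      ⟪normScore X sc a n ω, T (normScore X sc a n ω)⟫ / 2) atTop 0 ∧
    TendstoInMeasure μ (fun (n : ℕ) ω =>
      √(n : ℝ) * (empMean X n ω (h (αt n ω)) - empMean X n ω (h a))) atTop 0 := by
  obtain ⟨C, hC⟩ := NearlyQuadratic.exists_critical_bounds S T hST hsymm hc hS
  have hU := (hR.tendstoInDistribution_normScore hX hindep
    (V := Matrix.of fun i j => ∫ x, sc a x i * sc a x j ∂ν) fun i j => rfl).2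
  have hUm := hU.forall_aemeasurable
  have ham := fun n => aemeasurable_empMean hX
    (hR.aemeasurable a (Metric.mem_ball_self hR.delta_pos)) n
  have hall : ∀ᵐ ω ∂μ, ∀ᶠ n : ℕ in atTop, 0 < (n : ℝ) ∧
      ‖αt n ω - a - T (empMean X n ω (sc a))‖ ≤ C * err X Hs K S n ω * ‖empMean X n ω (sc a)‖ ∧
      |empMean X n ω (h (αt n ω)) - empMean X n ω (h a) -
        ⟪empMean X n ω (sc a), T (empMean X n ω (sc a))⟫ / 2| ≤
          C * err X Hs K S n ω * ‖empMean X n ω (sc a)‖ ^ 2 ∧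
      |empMean X n ω (h (αt n ω)) - empMean X n ω (h a)| ≤ C * ‖empMean X n ω (sc a)‖ ^ 2 := by
    filter_upwards [hR.ae_eventually_good hX hindep hc, hmax,
      hR.ae_eventually_score_eq_zero hX hindep hmax] with ω h1 h2 h3
    filter_upwards [h1, h2, h3, eventually_gt_atTop 0] with n ⟨_, _, hQ, herr, _⟩ ⟨h4, _⟩ h5 hn
    exact ⟨by exact_mod_cast hn, hC _ _ _ _ _ hQ (hR.err_nonneg n ω) herr _
      (interior_subset h4) h5⟩
  have hnorm : ∀ (n : ℕ) ω, ‖normScore X sc a n ω‖ = √(n : ℝ) * ‖empMean X n ω (sc a)‖ := by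
    intro n ω
    rw [normScore, norm_smul, Real.norm_of_nonneg (Real.sqrt_nonneg _)]
  have hnorm2 : ∀ (n : ℕ) ω, ‖normScore X sc a n ω‖ ^ 2 = n * ‖empMean X n ω (sc a)‖ ^ 2 := by
    intro n ω
    rw [hnorm, mul_pow, Real.sq_sqrt n.cast_nonneg]
  refine ⟨?_, ?_, ?_⟩
  · refine tendstoInMeasure_zero_of_eventually_norm_le hU (hR.aemeasurable_err hX)
      (hR.ae_tendsto_err hX hindep) (fun n => ?_) C 1 ?_
    · have := hαm n; have := hUm n; fun_prop
    · filter_upwards [hall] with ω hω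
      filter_upwards [hω] with n ⟨_, h1, _⟩
      rw [pow_one, hnorm, normScore, map_smul, ← smul_sub, norm_smul,
        Real.norm_of_nonneg (Real.sqrt_nonneg _)]
      calc _ ≤ √(n : ℝ) * (C * err X Hs K S n ω * ‖empMean X n ω (sc a)‖) :=
            mul_le_mul_of_nonneg_left h1 (Real.sqrt_nonneg _)
        _ = _ := by ring
  · refine tendstoInMeasure_zero_of_eventually_norm_le hU (hR.aemeasurable_err hX)
      (hR.ae_tendsto_err hX hindep) (fun n => ?_) C 2 ?_
    · have := hstat n; have := hUm n; have := ham n; fun_prop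
    · filter_upwards [hall] with ω hω
      filter_upwards [hω] with n ⟨_, _, h1, _⟩
      have e : ⟪normScore X sc a n ω, T (normScore X sc a n ω)⟫ =
          n * ⟪empMean X n ω (sc a), T (empMean X n ω (sc a))⟫ := by
        rw [normScore, map_smul, real_inner_smul_left, real_inner_smul_right, ← mul_assoc,
          Real.mul_self_sqrt n.cast_nonneg]
      rw [hnorm2, e, mul_div_assoc, ← mul_sub, Real.norm_eq_abs, abs_mul,
        abs_of_nonneg (n.cast_nonneg : (0 : ℝ) ≤ n)]
      calc _ ≤ (n : ℝ) * (C * err X Hs K S n ω * ‖empMean X n ω (sc a)‖ ^ 2) :=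
            mul_le_mul_of_nonneg_left h1 n.cast_nonneg
        _ = _ := by ring
  -- The gain in value is at most `C` times the squared score, so at scale `√n` it is at most `C *
  -- (√n)⁻¹ * ‖U n‖ ^ 2`.
  · refine tendstoInMeasure_zero_of_eventually_norm_le hU (e := fun n _ => (√(n : ℝ))⁻¹)
      (fun n => aemeasurable_const)
      (ae_of_all _ fun _ => tendsto_inv_atTop_zero.comp
        (Real.tendsto_sqrt_atTop.comp tendsto_natCast_atTop_atTop)) (fun n => ?_) C 2 ?_
    · have := hstat n; have := ham n; fun_prop
    · filter_upwards [hall] with ω hω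
      filter_upwards [hω] with n ⟨hn, _, _, h1⟩
      rw [hnorm2, Real.norm_eq_abs, abs_mul, abs_of_nonneg (Real.sqrt_nonneg _)]
      have e : C * (√(n : ℝ))⁻¹ * (n * ‖empMean X n ω (sc a)‖ ^ 2) =
          √(n : ℝ) * (C * ‖empMean X n ω (sc a)‖ ^ 2) := by
        have h2 : (√(n : ℝ))⁻¹ * n = √(n : ℝ) := by
          rw [← div_eq_inv_mul, Real.div_sqrt]
        calc _ = C * ((√(n : ℝ))⁻¹ * n) * ‖empMean X n ω (sc a)‖ ^ 2 := by ring
          _ = _ := by rw [h2]; ring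
      rw [e]
      exact mul_le_mul_of_nonneg_left h1 (Real.sqrt_nonneg _)

end Maximizer
end RegularCriterion

/-! ### Partial derivatives and differentiation under the integral sign -/

section Partial
variable {d : ℕ} {F G : EuclideanSpace ℝ (Fin d) → ℝ} {α : EuclideanSpace ℝ (Fin d)}

lemma pd_eq_fderiv (hF : DifferentiableAt ℝ F α) (i : Fin d) :
    pd i F α = fderiv ℝ F α (EuclideanSpace.single i 1) := hF.lineDeriv_eq_fderiv

lemma euclidean_eq_sum_single (v : EuclideanSpace ℝ (Fin d)) :
    v = ∑ i, v i • EuclideanSpace.single i (1 : ℝ) := by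
  ext j
  simp [Finset.sum_apply, Pi.single_apply]

lemma clm_apply_eq_sum (L : EuclideanSpace ℝ (Fin d) →L[ℝ] ℝ) (v : EuclideanSpace ℝ (Fin d)) :
    L v = ∑ i, v i * L (EuclideanSpace.single i 1) := by
  conv_lhs => rw [euclidean_eq_sum_single v]
  simp [map_sum]

lemma clm_norm_le_sum (L : EuclideanSpace ℝ (Fin d) →L[ℝ] ℝ) :
    ‖L‖ ≤ ∑ i, |L (EuclideanSpace.single i 1)| := by
  refine L.opNorm_le_bound (Finset.sum_nonneg fun i _ => abs_nonneg _) fun v => ?_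
  rw [clm_apply_eq_sum, Finset.sum_mul]
  refine norm_sum_le_of_le _ fun i _ => ?_
  rw [norm_mul, mul_comm, Real.norm_eq_abs (L _)]
  exact mul_le_mul_of_nonneg_left (PiLp.norm_apply_le v i) (abs_nonneg _)

lemma euclidean_norm_le_sum (v : EuclideanSpace ℝ (Fin d)) : ‖v‖ ≤ ∑ i, |v i| := by
  conv_lhs => rw [euclidean_eq_sum_single v]
  refine norm_sum_le_of_le _ fun i _ => ?_
  simp [norm_smul]

lemma pd_congr (h : F =ᶠ[𝓝 α] G) (i : Fin d) : pd i F α = pd i G α := by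
  have := h.lineDeriv_eq (𝕜 := ℝ) (v := EuclideanSpace.single i (1 : ℝ))
  exact this

lemma eqOn_pd {N : Set (EuclideanSpace ℝ (Fin d))} (hN : IsOpen N) (h : Set.EqOn F G N)
    (i : Fin d) : Set.EqOn (pd i F) (pd i G) N := fun _ hα =>
  pd_congr (h.eventuallyEq_of_mem (hN.mem_nhds hα)) i

lemma contDiffOn_pd {N : Set (EuclideanSpace ℝ (Fin d))} (hN : IsOpen N) {n : ℕ}
    (h : ContDiffOn ℝ (n + 1 : ℕ) F N) (i : Fin d) : ContDiffOn ℝ n (pd i F) N := by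
  have h1 : ContDiffOn ℝ n (fderiv ℝ F) N := h.fderiv_of_isOpen hN (by norm_cast)
  have h2 := h1.clm_apply (contDiffOn_const (c := (EuclideanSpace.single i (1 : ℝ))))
  refine h2.congr fun α hα => ?_
  exact pd_eq_fderiv ((h.differentiableOn (by norm_cast) α hα).differentiableAt
    (hN.mem_nhds hα)) i

end Partial

section Dominated
variable {d : ℕ} {𝒳 : Type*} [MeasurableSpace 𝒳] {lam : Measure 𝒳}
  {N : Set (EuclideanSpace ℝ (Fin d))} {F : EuclideanSpace ℝ (Fin d) → 𝒳 → ℝ}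

/-- A partial derivative is an almost everywhere limit of difference quotients along `1 / (n + 1)`,
started late enough for the shifted points to lie in `N`. -/
lemma aestronglyMeasurable_pd (hN : IsOpen N) (hm : ∀ α ∈ N, AEStronglyMeasurable (F α) lam)
    (hd : ∀ᵐ x ∂lam, DifferentiableOn ℝ (fun α => F α x) N) {α : EuclideanSpace ℝ (Fin d)}
    (hα : α ∈ N) (i : Fin d) : AEStronglyMeasurable (fun x => pd i (fun a => F a x) α) lam := by
  set e : EuclideanSpace ℝ (Fin d) := EuclideanSpace.single i 1
  let t : ℕ → ℝ := fun n => 1 / ((n : ℝ) + 1)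
  have ht : Tendsto t atTop (𝓝 0) := tendsto_one_div_add_atTop_nhds_zero_nat
  have htp : ∀ n, t n ≠ 0 := fun n => by positivity
  have hlim : Tendsto (fun n => α + t n • e) atTop (𝓝 α) := by
    simpa using (ht.smul_const e).const_add α
  obtain ⟨n₀, hn₀⟩ := eventually_atTop.1 (hlim.eventually_mem (hN.mem_nhds hα))
  refine aestronglyMeasurable_of_tendsto_ae atTop
    (f := fun n x => (t (n + n₀))⁻¹ * (F (α + t (n + n₀) • e) x - F α x))
    (fun n => ((hm _ (hn₀ _ (Nat.le_add_left _ _))).sub (hm α hα)).const_mul _) ?_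
  filter_upwards [hd] with x hx
  have h1 := ((hx α hα).differentiableAt (hN.mem_nhds hα)).lineDifferentiableAt (v := e)
    |>.hasLineDerivAt.tendsto_slope_zero
  have h2 : Tendsto (fun n => t (n + n₀)) atTop (𝓝[≠] 0) :=
    tendsto_nhdsWithin_iff.2 ⟨ht.comp (tendsto_add_atTop_nat n₀),
      Eventually.of_forall fun n => htp _⟩
  exact h1.comp h2

/-- Differentiation under the integral sign, with domination of the partial derivatives. -/
lemma hasFDerivAt_integral_of_abs_pd_le (hN : IsOpen N)
    (hint : ∀ α ∈ N, Integrable (F α) lam)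
    (hd : ∀ᵐ x ∂lam, DifferentiableOn ℝ (fun α => F α x) N) {G : 𝒳 → ℝ} (hG : Integrable G lam)
    (hb : ∀ᵐ x ∂lam, ∀ α ∈ N, ∀ i, |pd i (fun a => F a x) α| ≤ G x)
    {α : EuclideanSpace ℝ (Fin d)} (hα : α ∈ N) :
    (∀ i, Integrable (fun x => pd i (fun a => F a x) α) lam) ∧
    DifferentiableAt ℝ (fun a => ∫ x, F a x ∂lam) α ∧
    ∀ i, pd i (fun a => ∫ x, F a x ∂lam) α = ∫ x, pd i (fun a => F a x) α ∂lam := by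
  have hm := fun β hβ => aestronglyMeasurable_pd hN (fun α hα => (hint α hα).aestronglyMeasurable)
    hd (α := β) hβ
  have hI : ∀ i, Integrable (fun x => pd i (fun a => F a x) α) lam := fun i =>
    hG.mono' (hm α hα i) (hb.mono fun x hx => hx α hα i)
  -- The full derivative is rebuilt from the partial ones, which are what is dominated; its operator
  -- norm is at most `d * G x`.
  let F' : EuclideanSpace ℝ (Fin d) → 𝒳 → (EuclideanSpace ℝ (Fin d) →L[ℝ] ℝ) := fun β x =>
    ∑ i, pd i (fun a => F a x) β • EuclideanSpace.proj i
  have hF'single : ∀ β x i, F' β x (EuclideanSpace.single i 1) = pd i (fun a => F a x) β := by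
    intro β x i
    simp [F']
  have hF' : ∀ᵐ x ∂lam, ∀ β ∈ N, HasFDerivAt (fun a => F a x) (F' β x) β := by
    filter_upwards [hd] with x hx β hβ
    have h1 := (hx β hβ).differentiableAt (hN.mem_nhds hβ)
    refine h1.hasFDerivAt.congr_fderiv ?_
    ext v
    rw [clm_apply_eq_sum, clm_apply_eq_sum (F' β x)]
    refine Finset.sum_congr rfl fun i _ => ?_
    rw [hF'single, pd_eq_fderiv h1]
  have hF'int : Integrable (F' α) lam := by
    refine integrable_finsetSum (f := fun i x => pd i (fun a => F a x) α •
      (EuclideanSpace.proj i : EuclideanSpace ℝ (Fin d) →L[ℝ] ℝ)) _ fun i _ => ?_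
    exact (hI i).smul_const _
  have key := hasFDerivAt_integral_of_dominated_of_fderiv_le (𝕜 := ℝ) (μ := lam) (F := F)
    (F' := F') (x₀ := α) (s := N) (bound := fun x => d * G x) (hN.mem_nhds hα)
    (by filter_upwards [hN.mem_nhds hα] with β hβ using (hint β hβ).aestronglyMeasurable)
    (hint α hα) hF'int.aestronglyMeasurable
    (by
      filter_upwards [hb] with x hx β hβ
      refine (clm_norm_le_sum _).trans ?_
      simp_rw [hF'single]
      refine (Finset.sum_le_sum fun i _ => hx β hβ i).trans ?_
      simp)
    (hG.const_mul _) hF'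
  refine ⟨hI, key.differentiableAt, fun i => ?_⟩
  rw [pd_eq_fderiv key.differentiableAt, key.fderiv, ContinuousLinearMap.integral_apply hF'int]
  simp_rw [hF'single]

end Dominated

/-! ### Lipschitz bounds from partial derivatives -/

section Lipschitz
variable {d : ℕ} {a : EuclideanSpace ℝ (Fin d)} {δ : ℝ}

/-- A function with bounded partial derivatives on a ball is Lipschitz at the centre. -/
lemma abs_sub_le_of_abs_pd_le {u : EuclideanSpace ℝ (Fin d) → ℝ} {H : ℝ}
    (hd : ∀ α ∈ Metric.ball a δ, ∀ i, LineDifferentiableAt ℝ u α (EuclideanSpace.single i 1))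
    (hb : ∀ α ∈ Metric.ball a δ, ∀ i, |pd i u α| ≤ H) {α : EuclideanSpace ℝ (Fin d)}
    (hα : α ∈ Metric.ball a δ) : |u α - u a| ≤ d * H * ‖α - a‖ := by
  classical
  -- Only coordinatewise differentiability is known, so `a` is joined to `α` by changing one
  -- coordinate at a time. Each coordinate stays at least as close to that of `a` as in `α`, so the
  -- path stays in the ball; this is why one endpoint is the centre.
  let pt : Finset (Fin d) → EuclideanSpace ℝ (Fin d) := fun s =>
    a + ∑ i ∈ s, (α i - a i) • EuclideanSpace.single i (1 : ℝ)
  have hpt : ∀ (s : Finset (Fin d)) (j : Fin d), j ∉ s → ∀ t ∈ Set.Icc (0 : ℝ) 1,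
      pt s + (t * (α j - a j)) • EuclideanSpace.single j (1 : ℝ) ∈ Metric.ball a δ := by
    intro s j hj t ht
    refine Metric.mem_ball.2 (lt_of_le_of_lt ?_ (Metric.mem_ball.1 hα))
    rw [EuclideanSpace.dist_eq, EuclideanSpace.dist_eq]
    refine Real.sqrt_le_sqrt (Finset.sum_le_sum fun i _ => ?_)
    simp only [Real.dist_eq, sq_abs]
    have hval : (pt s + (t * (α j - a j)) • EuclideanSpace.single j (1 : ℝ)) i - a i =
        ((if i ∈ s then 1 else 0) + if i = j then t else 0) * (α i - a i) := by
      have : (∑ k ∈ s, (α k - a k) • EuclideanSpace.single k (1 : ℝ)) i =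
          if i ∈ s then α i - a i else 0 := by
        simp [Finset.sum_apply, Pi.single_apply]
      simp only [pt, PiLp.add_apply, this, PiLp.smul_apply, PiLp.single_apply]
      by_cases hij : i = j
      · subst hij; simp [hj]
      · by_cases his : i ∈ s <;> simp [hij, his]
    rw [hval, mul_pow]
    refine mul_le_of_le_one_left (sq_nonneg _) ?_
    by_cases hij : i = j
    · subst hij; simp only [hj, if_false, if_true, zero_add]
      exact pow_le_one₀ ht.1 ht.2
    · by_cases his : i ∈ s <;> simp [hij, his]
  have hstep : ∀ s : Finset (Fin d), |u (pt s) - u a| ≤ ∑ i ∈ s, H * |α i - a i| := by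
    intro s
    induction s using Finset.induction_on with
    | empty => simp [pt]
    | insert j s hj ih =>
      rw [Finset.sum_insert hj]
      have hins : pt (insert j s) = pt s + (1 * (α j - a j)) • EuclideanSpace.single j (1 : ℝ) := by
        simp only [pt, Finset.sum_insert hj, one_mul]; abel
      let ψ : ℝ → ℝ := fun t => u (pt s + (t * (α j - a j)) • EuclideanSpace.single j (1 : ℝ))
      have hψ : ∀ t ∈ Set.Icc (0 : ℝ) 1, HasDerivWithinAt ψ
          ((α j - a j) * pd j u (pt s + (t * (α j - a j)) • EuclideanSpace.single j (1 : ℝ)))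
          (Set.Icc 0 1) t := fun t ht => by
        have h1 := (hd _ (hpt s j hj t ht) j).hasLineDerivAt
        have h2 : HasDerivAt (fun t' : ℝ => (t' - t) * (α j - a j)) (α j - a j) t := by
          simpa using ((hasDerivAt_id t).sub_const t).mul_const (α j - a j)
        have h3 : HasDerivAt (fun r : ℝ => u (pt s + (t * (α j - a j)) •
            EuclideanSpace.single j (1 : ℝ) + r • EuclideanSpace.single j (1 : ℝ)))
            (pd j u (pt s + (t * (α j - a j)) • EuclideanSpace.single j (1 : ℝ)))
            ((t - t) * (α j - a j)) := by
          rw [sub_self, zero_mul]; exact h1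
        have h4 := (h3.comp t h2).hasDerivWithinAt (s := Set.Icc 0 1)
        refine (h4.congr_deriv (mul_comm _ _)).congr (fun t' _ => ?_) ?_
        · simp only [ψ, Function.comp_apply, add_assoc, ← add_smul]; congr 3; ring
        · simp only [ψ, Function.comp_apply, add_assoc, ← add_smul]; congr 3; ring
      have h1 := (convex_Icc (0 : ℝ) 1).norm_image_sub_le_of_norm_hasDerivWithin_le hψ
        (C := H * |α j - a j|) (fun t ht => by
          rw [norm_mul, mul_comm, Real.norm_eq_abs, Real.norm_eq_abs]
          exact mul_le_mul_of_nonneg_right (hb _ (hpt s j hj t ht) j) (abs_nonneg _))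
        (Set.left_mem_Icc.2 zero_le_one) (Set.right_mem_Icc.2 zero_le_one)
      have e0 : ψ 0 = u (pt s) := by simp [ψ]
      have e1 : ψ 1 = u (pt (insert j s)) := by simp only [ψ]; rw [← hins]
      rw [e0, e1, sub_zero, norm_one, mul_one, Real.norm_eq_abs] at h1
      have e : u (pt (insert j s)) - u a = (u (pt (insert j s)) - u (pt s)) + (u (pt s) - u a) := by
        ring
      rw [e]
      exact (abs_add_le _ _).trans (add_le_add h1 ih)
  have huniv : pt Finset.univ = α := by
    ext j
    simp [pt, Finset.sum_apply, Pi.single_apply]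
  have h := hstep Finset.univ
  rw [huniv] at h
  refine h.trans ?_
  have : ∀ i ∈ (Finset.univ : Finset (Fin d)), H * |α i - a i| ≤ H * ‖α - a‖ := fun i _ => by
    have hH : 0 ≤ H := (abs_nonneg _).trans (hb α hα i)
    exact mul_le_mul_of_nonneg_left (PiLp.norm_apply_le (α - a) i) hH
  refine (Finset.sum_le_sum this).trans ?_
  simp [mul_assoc]

/-- The gradient of a function with bounded third order partial derivatives is nearly affine. -/
lemma norm_sub_sub_le_of_abs_pd_pd_pd_le {F : EuclideanSpace ℝ (Fin d) → ℝ} {H : ℝ}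
    (hd : ∀ α ∈ Metric.ball a δ, ∀ j, DifferentiableAt ℝ (pd j F) α)
    (hd3 : ∀ α ∈ Metric.ball a δ, ∀ i j k,
      LineDifferentiableAt ℝ (pd j (pd k F)) α (EuclideanSpace.single i 1))
    (hb : ∀ α ∈ Metric.ball a δ, ∀ i j k, |pd i (pd j (pd k F)) α| ≤ H) {ρ : ℝ}
    (hρδ : ρ < δ) {α β : EuclideanSpace ℝ (Fin d)}
    (hα : α ∈ Metric.closedBall a ρ) (hβ : β ∈ Metric.closedBall a ρ) :
    ‖(WithLp.toLp 2 fun j => pd j F α) - (WithLp.toLp 2 fun j => pd j F β) -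
      Matrix.toEuclideanCLM (𝕜 := ℝ) (Matrix.of fun i j => pd i (pd j F) a).transpose (α - β)‖ ≤
      d ^ 3 * |H| * ρ * ‖α - β‖ := by
  have hsub : Metric.closedBall a ρ ⊆ Metric.ball a δ := Metric.closedBall_subset_ball hρδ
  -- Each factor `d` in `d ^ 3` is one sum over coordinates: for the norm of the gradient difference
  -- here, for the operator norm of a derivative, and for the coordinate path.
  refine (euclidean_norm_le_sum _).trans ?_
  have key : ∀ j : Fin d, |((WithLp.toLp 2 fun j => pd j F α) - (WithLp.toLp 2 fun j => pd j F β) -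
      Matrix.toEuclideanCLM (𝕜 := ℝ)
        (Matrix.of fun i j => pd i (pd j F) a).transpose (α - β)) j| ≤
      d ^ 2 * |H| * ρ * ‖α - β‖ := by
    intro j
    -- `L` is the derivative at `a` of the `j`-th component of the gradient, that is, row `j` of the
    -- transposed matrix. Symmetry of second derivatives is not invoked.
    let L : EuclideanSpace ℝ (Fin d) →L[ℝ] ℝ := ∑ i, pd i (pd j F) a • EuclideanSpace.proj i
    have hL : ∀ i, L (EuclideanSpace.single i 1) = pd i (pd j F) a := fun i => by simp [L]
    have e1 : ((WithLp.toLp 2 fun j => pd j F α) - (WithLp.toLp 2 fun j => pd j F β) -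
        Matrix.toEuclideanCLM (𝕜 := ℝ)
          (Matrix.of fun i j => pd i (pd j F) a).transpose (α - β)) j =
        (pd j F α - L α) - (pd j F β - L β) := by
      have : (Matrix.toEuclideanCLM (𝕜 := ℝ)
          (Matrix.of fun i j => pd i (pd j F) a).transpose (α - β)) j = L (α - β) := by
        rw [Matrix.ofLp_toEuclideanCLM]
        simp [L, Matrix.mulVec, dotProduct]
      simp only [PiLp.sub_apply] at this ⊢
      rw [this, map_sub]; ring
    rw [e1]
    have hder : ∀ γ ∈ Metric.closedBall a ρ, HasFDerivWithinAt (fun γ => pd j F γ - L γ)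
        (fderiv ℝ (pd j F) γ - L) (Metric.closedBall a ρ) γ := fun γ hγ =>
      ((hd γ (hsub hγ) j).hasFDerivAt.sub L.hasFDerivAt).hasFDerivWithinAt
    refine (convex_closedBall a ρ).norm_image_sub_le_of_norm_hasFDerivWithin_le hder (fun γ hγ => ?_)
      hβ hα
    refine (clm_norm_le_sum _).trans ?_
    have : ∀ i ∈ (Finset.univ : Finset (Fin d)),
        |(fderiv ℝ (pd j F) γ - L) (EuclideanSpace.single i 1)| ≤ d * |H| * ρ := fun i _ => by
      rw [sub_apply, hL, ← pd_eq_fderiv (hd γ (hsub hγ) j)]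
      have h1 := abs_sub_le_of_abs_pd_le (u := pd i (pd j F)) (H := |H|)
        (fun γ hγ k => hd3 γ hγ k i j)
        (fun γ hγ k => (hb γ hγ k i j).trans (le_abs_self H)) (hsub hγ)
      refine h1.trans ?_
      have : ‖γ - a‖ ≤ ρ := by simpa [dist_eq_norm] using hγ
      gcongr
    refine (Finset.sum_le_sum this).trans ?_
    simp only [Finset.sum_const, Finset.card_univ, Fintype.card_fin, nsmul_eq_mul]
    exact le_of_eq (by ring)
  refine (Finset.sum_le_sum fun j _ => key j).trans ?_
  simp only [Finset.sum_const, Finset.card_univ, Fintype.card_fin, nsmul_eq_mul]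
  exact le_of_eq (by ring)

end Lipschitz

/-! ### The generating convex function -/

namespace IsGenerator
variable {φ : ℝ → ℝ≥0∞}

lemma contDiffOn_dphi (hφ : IsGenerator φ) : ContDiffOn ℝ 3 (dphi φ) (interior (dom φ)) :=
  hφ.contDiff.deriv_of_isOpen isOpen_interior (by norm_num)

lemma hasDerivAt_realVal (hφ : IsGenerator φ) {r : ℝ} (hr : r ∈ interior (dom φ)) :
    HasDerivAt (realVal φ) (dphi φ r) r :=
  ((hφ.contDiff.differentiableOn (by norm_num) r hr).differentiableAt
    (isOpen_interior.mem_nhds hr)).hasDerivAt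

lemma hasDerivAt_dphi (hφ : IsGenerator φ) {r : ℝ} (hr : r ∈ interior (dom φ)) :
    HasDerivAt (dphi φ) (deriv (dphi φ) r) r :=
  ((hφ.contDiffOn_dphi.differentiableOn (by norm_num) r hr).differentiableAt
    (isOpen_interior.mem_nhds hr)).hasDerivAt

lemma monotoneOn_dphi (hφ : IsGenerator φ) : MonotoneOn (dphi φ) (interior (dom φ)) :=
  hφ.strictConvex.convexOn.monotoneOn_deriv fun _ hr => (hφ.hasDerivAt_realVal hr).differentiableAt

lemma deriv_dphi_nonneg (hφ : IsGenerator φ) {r : ℝ} (hr : r ∈ interior (dom φ)) :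
    0 ≤ deriv (dphi φ) r := by
  rw [← derivWithin_of_isOpen isOpen_interior hr]
  exact hφ.monotoneOn_dphi.derivWithin_nonneg

lemma measurable_realVal (hφ : IsGenerator φ) : Measurable (realVal φ) :=
  hφ.closed.measurable.ennreal_toReal

/-- A linear lower bound for `φ'` to the right of `1`, in terms of `1 - 1 / r`. -/
lemma exists_mul_le_dphi_sub (hφ : IsGenerator φ) (h1 : 0 < deriv (dphi φ) 1) :
    ∃ κ, 0 < κ ∧ ∀ r ∈ interior (dom φ), 1 ≤ r → κ * (1 - 1 / r) ≤ dphi φ r - dphi φ 1 := by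
  set b := deriv (dphi φ) 1
  have hslope : ∀ᶠ r in 𝓝[>] (1 : ℝ), b / 2 < slope (dphi φ) 1 r :=
    ((hasDerivAt_iff_tendsto_slope.1 (hφ.hasDerivAt_dphi hφ.one_mem)).mono_left
      (nhdsWithin_mono _ fun r (hr : 1 < r) => ne_of_gt hr)).eventually_const_lt (half_lt_self h1)
  have hI : ∀ᶠ r in 𝓝[>] (1 : ℝ), r ∈ interior (dom φ) :=
    mem_nhdsWithin_of_mem_nhds (isOpen_interior.mem_nhds hφ.one_mem)
  obtain ⟨u, hu1, hu⟩ := mem_nhdsGT_iff_exists_Ioo_subset.1 (hslope.and hI)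
  have hu1' : (1 : ℝ) < u := hu1
  -- A point inside the interval where the slope of `φ'` exceeds `b / 2`, with `w - 1 ≤ 1`.
  set w : ℝ := min ((1 + u) / 2) 2 with hw
  have hw1 : 1 < w := lt_min (by linarith) one_lt_two
  have hw2 : w ≤ 2 := min_le_right _ _
  have hwu : w < u := (min_le_left _ _).trans_lt (by linarith)
  have hsmall : ∀ r, 1 ≤ r → r ≤ w → b / 2 * (r - 1) ≤ dphi φ r - dphi φ 1 := fun r h1r hrw => by
    rcases h1r.eq_or_lt with rfl | h1r
    · simp
    have h2 := (hu ⟨h1r, hrw.trans_lt hwu⟩).1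
    rw [slope_def_field, lt_div_iff₀ (by linarith)] at h2
    exact h2.le
  -- Up to `w` the slope bound suffices, as `1 - 1 / r ≤ r - 1`; beyond `w` monotonicity of `φ'`
  -- does, as `1 - 1 / r ≤ 1`.
  refine ⟨b / 2 * (w - 1), mul_pos (half_pos h1) (by linarith), fun r hr h1r => ?_⟩
  have hr0 : 0 < r := by linarith
  have hinv0 : 0 ≤ 1 - 1 / r := by
    rw [sub_nonneg, div_le_one hr0]; exact h1r
  rcases le_total r w with hrw | hrw
  · refine le_trans ?_ (hsmall r h1r hrw)
    have h3 : 1 - 1 / r ≤ r - 1 := by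
      have : 1 - 1 / r = (r - 1) / r := by field_simp
      rw [this]
      exact div_le_self (by linarith) h1r
    have h4 : (w - 1) * (1 - 1 / r) ≤ 1 * (r - 1) :=
      mul_le_mul (by linarith) h3 hinv0 zero_le_one
    rw [mul_assoc]
    exact mul_le_mul_of_nonneg_left (by linarith) (half_pos h1).le
  · have h5 := hsmall w hw1.le le_rfl
    have h6 := hφ.monotoneOn_dphi (hu ⟨hw1, hwu⟩).2 hr hrw
    have h7 : b / 2 * (w - 1) * (1 - 1 / r) ≤ b / 2 * (w - 1) := by
      refine mul_le_of_le_one_right (mul_pos (half_pos h1) (by linarith)).le ?_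
      have : 0 < 1 / r := by positivity
      linarith
    linarith

end IsGenerator

/-! ### Pointwise calculus in the model -/

section Model
variable {d : ℕ} {𝒳 : Type*} [MeasurableSpace 𝒳] {φ : ℝ → ℝ≥0∞} {M : Model d 𝒳}
  {θ θT α : EuclideanSpace ℝ (Fin d)}

namespace Model

lemma measurable_ofReal_p (hα : α ∈ M.Θ) : Measurable fun x => ENNReal.ofReal (M.p α x) :=
  (M.measurable_p α hα).ennreal_ofReal

lemma ae_P_iff (hα : α ∈ M.Θ) {q : 𝒳 → Prop} :
    (∀ᵐ x ∂(M.P α), q x) ↔ ∀ᵐ x ∂M.lam, 0 < M.p α x → q x := by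
  rw [Model.P, ae_withDensity_iff (measurable_ofReal_p hα)]
  simp

lemma integral_P (hα : α ∈ M.Θ) (ψ : 𝒳 → ℝ) :
    ∫ x, ψ x ∂(M.P α) = ∫ x, M.p α x * ψ x ∂M.lam := by
  rw [Model.P, integral_withDensity_eq_integral_toReal_smul (measurable_ofReal_p hα)
    (ae_of_all _ fun x => ENNReal.ofReal_lt_top)]
  simp [ENNReal.toReal_ofReal (M.p_nonneg α hα _)]

lemma integrable_P_iff (hα : α ∈ M.Θ) {ψ : 𝒳 → ℝ} :
    Integrable ψ (M.P α) ↔ Integrable (fun x => M.p α x * ψ x) M.lam := by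
  rw [Model.P, integrable_withDensity_iff_integrable_smul' (measurable_ofReal_p hα)
    (ae_of_all _ fun x => ENNReal.ofReal_lt_top)]
  simp [ENNReal.toReal_ofReal (M.p_nonneg α hα _)]

lemma isProbabilityMeasure_P (hα : α ∈ M.Θ) : IsProbabilityMeasure (M.P α) :=
  M.isProbability α hα

lemma integrable_p (hα : α ∈ M.Θ) : Integrable (M.p α) M.lam := by
  have := isProbabilityMeasure_P hα
  simpa using (integrable_P_iff hα).1 (integrable_const (1 : ℝ))

lemma integral_p (hα : α ∈ M.Θ) : ∫ x, M.p α x ∂M.lam = 1 := by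
  have := isProbabilityMeasure_P hα
  simpa using (integral_P hα fun _ => (1 : ℝ)).symm

end Model

/-- The points of the common support at which the densities are smooth and their ratios lie in the
domain of `φ'`. -/
structure RegularPoint (φ : ℝ → ℝ≥0∞) (M : Model d 𝒳) (θ : EuclideanSpace ℝ (Fin d)) (x : 𝒳) :
    Prop where
  contDiffOn_p : ContDiffOn ℝ 3 (fun α => M.p α x) (interior M.Θ)
  pos : ∀ α ∈ M.Θ, 0 < M.p α x
  mem_dom : ∀ α ∈ M.Θ, M.p θ x / M.p α x ∈ interior (dom φ)

/-- Because of the common support, a point where `p_θ` vanishes is one where all densities vanish;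
elsewhere a `P_θ`-almost sure property is a `λ`-almost sure one. -/
lemma ae_regularPoint_or (hθ : θ ∈ M.Θ)
    (hp : ∀ᵐ x ∂M.lam, ContDiffOn ℝ 3 (fun α => M.p α x) (interior M.Θ))
    (hint : RatioIntegrable φ M θ) :
    ∀ᵐ x ∂M.lam, RegularPoint φ M θ x ∨ ∀ α ∈ M.Θ, M.p α x = 0 := by
  filter_upwards [hp, M.support_eq, (Model.ae_P_iff hθ).1 hint.mem_dom] with x h1 h2 h3
  by_cases h : 0 < M.p θ x
  · exact Or.inl ⟨h1, fun α hα => (h2 α hα θ hθ).2 h, h3 h⟩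
  · refine Or.inr fun α hα => le_antisymm ?_ (M.p_nonneg α hα x)
    exact not_lt.1 fun h4 => h ((h2 α hα θ hθ).1 h4)

/-- The integrand of `P_θ f(θ, α)` with respect to the dominating measure. -/
noncomputable def fDens (φ : ℝ → ℝ≥0∞) (M : Model d 𝒳) (θ α : EuclideanSpace ℝ (Fin d)) (x : 𝒳) :
    ℝ :=
  fFun φ M θ α x * M.p θ x

/-- The weight `φ''(r) r² / p_α` with `r = p_θ / p_α`. -/
noncomputable def infoWeight (φ : ℝ → ℝ≥0∞) (M : Model d 𝒳) (θ α : EuclideanSpace ℝ (Fin d))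
    (x : 𝒳) : ℝ :=
  deriv (dphi φ) (M.p θ x / M.p α x) * (M.p θ x / M.p α x) ^ 2 / M.p α x

lemma pd_eq_of_hasFDerivAt {F : EuclideanSpace ℝ (Fin d) → ℝ}
    {L : EuclideanSpace ℝ (Fin d) →L[ℝ] ℝ} (h : HasFDerivAt F L α) (i : Fin d) :
    pd i F α = L (EuclideanSpace.single i 1) := by
  rw [pd_eq_fderiv h.differentiableAt, h.fderiv]

namespace RegularPoint
variable {x : 𝒳}

lemma contDiffOn_ratio (h : RegularPoint φ M θ x) :
    ContDiffOn ℝ 3 (fun α => M.p θ x / M.p α x) (interior M.Θ) :=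
  contDiffOn_const.div h.contDiffOn_p fun α hα => (h.pos α (interior_subset hα)).ne'

lemma contDiffOn_fFun (h : RegularPoint φ M θ x) (hφ : IsGenerator φ) :
    ContDiffOn ℝ 3 (fun α => fFun φ M θ α x) (interior M.Θ) :=
  hφ.contDiffOn_dphi.comp h.contDiffOn_ratio fun α hα => h.mem_dom α (interior_subset hα)

lemma contDiffOn_fDens (h : RegularPoint φ M θ x) (hφ : IsGenerator φ) :
    ContDiffOn ℝ 3 (fun α => fDens φ M θ α x) (interior M.Θ) :=
  (h.contDiffOn_fFun hφ).mul contDiffOn_const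

lemma contDiffOn_gFun (h : RegularPoint φ M θ x) (hφ : IsGenerator φ) :
    ContDiffOn ℝ 3 (fun α => gFun φ M θ α x) (interior M.Θ) :=
  (h.contDiffOn_ratio.mul (h.contDiffOn_fFun hφ)).sub
    ((hφ.contDiff.of_le (by norm_num)).comp h.contDiffOn_ratio
      fun α hα => h.mem_dom α (interior_subset hα))

lemma hasFDerivAt_ratio (h : RegularPoint φ M θ x) (hα : α ∈ interior M.Θ) :
    HasFDerivAt (fun α => M.p θ x / M.p α x)
      ((-(M.p θ x / M.p α x ^ 2)) • fderiv ℝ (fun α => M.p α x) α) α := by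
  have hne := (h.pos α (interior_subset hα)).ne'
  have h1 : HasFDerivAt (fun α => M.p α x) (fderiv ℝ (fun α => M.p α x) α) α :=
    ((h.contDiffOn_p.differentiableOn (by norm_num) α hα).differentiableAt
      (isOpen_interior.mem_nhds hα)).hasFDerivAt
  have h2 : HasDerivAt (fun y : ℝ => M.p θ x / y) (-(M.p θ x / M.p α x ^ 2)) (M.p α x) := by
    have := (hasDerivAt_inv hne).const_mul (M.p θ x)
    simp only [← div_eq_mul_inv] at this
    exact this.congr_deriv (by ring)
  exact h2.comp_hasFDerivAt α h1

lemma pd_p (h : RegularPoint φ M θ x) (hα : α ∈ interior M.Θ) (i : Fin d) :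
    pd i (fun α => M.p α x) α =
      fderiv ℝ (fun α => M.p α x) α (EuclideanSpace.single i 1) :=
  pd_eq_fderiv ((h.contDiffOn_p.differentiableOn (by norm_num) α hα).differentiableAt
      (isOpen_interior.mem_nhds hα)) i

/-- Chain rule: `r φ'(r) - φ(r)` has derivative `r φ''(r)`, the terms in `φ'` cancelling, and `∂r =
-(r / p_α) ∂p_α`. -/
lemma pd_gFun (h : RegularPoint φ M θ x) (hφ : IsGenerator φ) (hα : α ∈ interior M.Θ)
    (i : Fin d) : pd i (fun α => gFun φ M θ α x) α =
      -(infoWeight φ M θ α x * pd i (fun α => M.p α x) α) := by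
  have hpos := h.pos α (interior_subset hα)
  have hdom := h.mem_dom α (interior_subset hα)
  have h1 : HasDerivAt (fun r => r * dphi φ r - realVal φ r)
      ((M.p θ x / M.p α x) * deriv (dphi φ) (M.p θ x / M.p α x)) (M.p θ x / M.p α x) := by
    have := ((hasDerivAt_id _).mul (hφ.hasDerivAt_dphi hdom)).sub (hφ.hasDerivAt_realVal hdom)
    refine this.congr_deriv ?_
    simp
  have h2 := h1.comp_hasFDerivAt α (h.hasFDerivAt_ratio hα)
  have h3 : pd i (fun α => gFun φ M θ α x) α = _ := pd_eq_of_hasFDerivAt h2 i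
  rw [h3, h.pd_p hα]
  simp only [smul_apply, smul_eq_mul, infoWeight]
  field_simp

/-- Since `p_θ φ''(r) = p_α · r φ''(r)`. This identity makes the mean score vanish. -/
lemma pd_fDens (h : RegularPoint φ M θ x) (hφ : IsGenerator φ) (hθ : θ ∈ M.Θ)
    (hα : α ∈ interior M.Θ) (i : Fin d) : pd i (fun α => fDens φ M θ α x) α =
      M.p α x * pd i (fun α => gFun φ M θ α x) α := by
  have hpos := h.pos α (interior_subset hα)
  have hposθ := h.pos θ hθ
  have hdom := h.mem_dom α (interior_subset hα)
  have h2 := ((hφ.hasDerivAt_dphi hdom).comp_hasFDerivAt α (h.hasFDerivAt_ratio hα)).mul_const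
    (M.p θ x)
  have h3 : pd i (fun α => fDens φ M θ α x) α = _ := pd_eq_of_hasFDerivAt h2 i
  rw [h3, h.pd_gFun hφ hα, h.pd_p hα]
  simp only [smul_apply, smul_eq_mul, infoWeight]
  field_simp

lemma differentiableAt_pd_gFun (h : RegularPoint φ M θ x) (hφ : IsGenerator φ)
    (hα : α ∈ interior M.Θ) (j : Fin d) :
    DifferentiableAt ℝ (pd j fun α => gFun φ M θ α x) α :=
  ((contDiffOn_pd (n := 2) isOpen_interior (h.contDiffOn_gFun hφ) j).differentiableOn
    (by norm_num) α hα).differentiableAt (isOpen_interior.mem_nhds hα)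

/-- The first order identity differentiated by the product rule; the term `∂ᵢp ∂ⱼg` is the integrand
of the information matrix, with a minus sign. -/
lemma pd_pd_fDens (h : RegularPoint φ M θ x) (hφ : IsGenerator φ) (hθ : θ ∈ M.Θ)
    (hα : α ∈ interior M.Θ) (i j : Fin d) : pd i (pd j fun α => fDens φ M θ α x) α =
      M.p α x * pd i (pd j fun α => gFun φ M θ α x) α -
        infoWeight φ M θ α x * pd i (fun α => M.p α x) α * pd j (fun α => M.p α x) α := by
  have h1 := eqOn_pd isOpen_interior (fun β hβ => h.pd_fDens hφ hθ hβ j) i hα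
  have hpd : DifferentiableAt ℝ (fun α => M.p α x) α :=
    (h.contDiffOn_p.differentiableOn (by norm_num) α hα).differentiableAt
      (isOpen_interior.mem_nhds hα)
  have hgd := h.differentiableAt_pd_gFun hφ hα j
  have h2 := pd_eq_of_hasFDerivAt (hpd.hasFDerivAt.mul hgd.hasFDerivAt) i
  refine h1.trans (h2.trans ?_)
  simp only [add_apply, smul_apply, smul_eq_mul]
  rw [← pd_eq_fderiv hpd, ← pd_eq_fderiv hgd, h.pd_gFun hφ hα]
  ring

end RegularPoint

lemma infoWeight_nonneg (hφ : IsGenerator φ) {x : 𝒳} (hα : α ∈ M.Θ)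
    (h : RegularPoint φ M θ x ∨ ∀ α ∈ M.Θ, M.p α x = 0) : 0 ≤ infoWeight φ M θ α x := by
  rcases h with h | h
  · have := h.pos α hα
    have := hφ.deriv_dphi_nonneg (h.mem_dom α hα)
    unfold infoWeight
    positivity
  · simp [infoWeight, h α hα]

lemma fDens_eq_zero {x : 𝒳} (hθ : θ ∈ M.Θ) (h : ∀ α ∈ M.Θ, M.p α x = 0) :
    (fun α => fDens φ M θ α x) = fun _ => 0 := by
  funext α
  simp [fDens, h θ hθ]

lemma pd_const (c : ℝ) (i : Fin d) : pd i (fun _ => c) = fun _ => 0 := by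
  funext α
  simpa using pd_eq_of_hasFDerivAt (hasFDerivAt_const c α) i

lemma measurable_fFun (hθ : θ ∈ M.Θ) (hα : α ∈ M.Θ) : Measurable (fFun φ M θ α) :=
  (measurable_deriv _).comp ((M.measurable_p θ hθ).div (M.measurable_p α hα))

lemma measurable_gFun (hφ : IsGenerator φ) (hθ : θ ∈ M.Θ) (hα : α ∈ M.Θ) :
    Measurable (gFun φ M θ α) := by
  have h1 := (M.measurable_p θ hθ).div (M.measurable_p α hα)
  exact (h1.mul (measurable_fFun hθ hα)).sub (hφ.measurable_realVal.comp h1)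

lemma measurable_hFun (hφ : IsGenerator φ) (hθ : θ ∈ M.Θ) (hα : α ∈ M.Θ) :
    Measurable (hFun φ M θ α) := measurable_const.sub (measurable_gFun hφ hθ hα)

lemma integral_fFun (hθ : θ ∈ M.Θ) :
    (fun α => ∫ y, fFun φ M θ α y ∂(M.P θ)) = fun α => ∫ x, fDens φ M θ α x ∂M.lam := by
  funext α
  rw [Model.integral_P hθ]
  simp [fDens, mul_comm]

lemma integrable_fDens (hθ : θ ∈ M.Θ) (hint : RatioIntegrable φ M θ) (hα : α ∈ M.Θ) :
    Integrable (fDens φ M θ α) M.lam := by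
  refine ((Model.integrable_P_iff hθ).1 (hint.integrable α hα)).congr (ae_of_all _ fun x => ?_)
  simp [fDens, mul_comm]

end Model

/-! ### Fatou's lemma and integrals of matrices -/

/-- If nonnegative functions with integral `c` converge almost everywhere, the integral of the limit
is at most `c`. -/
lemma integral_le_of_ae_tendsto {𝒳 : Type*} [MeasurableSpace 𝒳] {lam : Measure 𝒳}
    {Z : ℕ → 𝒳 → ℝ} {Z₀ : 𝒳 → ℝ} {c : ℝ} (hZ : ∀ᶠ n in atTop, Integrable (Z n) lam)
    (hpos : ∀ᶠ n in atTop, 0 ≤ᵐ[lam] Z n) (hc : ∀ᶠ n in atTop, ∫ x, Z n x ∂lam = c)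
    (hlim : ∀ᵐ x ∂lam, Tendsto (fun n => Z n x) atTop (𝓝 (Z₀ x))) (hZ₀ : Integrable Z₀ lam) :
    ∫ x, Z₀ x ∂lam ≤ c := by
  obtain ⟨n₀, hn₀⟩ := eventually_atTop.1 (hZ.and (hpos.and hc))
  let Y : ℕ → 𝒳 → ℝ := fun n => Z (n + n₀)
  have hY : ∀ n, Integrable (Y n) lam ∧ 0 ≤ᵐ[lam] Y n ∧ ∫ x, Y n x ∂lam = c :=
    fun n => hn₀ _ (Nat.le_add_left _ _)
  have hYlim : ∀ᵐ x ∂lam, Tendsto (fun n => Y n x) atTop (𝓝 (Z₀ x)) := by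
    filter_upwards [hlim] with x hx using hx.comp (tendsto_add_atTop_nat n₀)
  have hc0 : 0 ≤ c := (hY 0).2.2 ▸ integral_nonneg_of_ae (hY 0).2.1
  have h0 : 0 ≤ᵐ[lam] Z₀ := by
    filter_upwards [hYlim, ae_all_iff.2 fun n => (hY n).2.1] with x hx hx0
    exact ge_of_tendsto' hx hx0
  have h1 : ∫⁻ x, ENNReal.ofReal (Z₀ x) ∂lam =
      ∫⁻ x, liminf (fun n => ENNReal.ofReal (Y n x)) atTop ∂lam := by
    refine lintegral_congr_ae ?_
    filter_upwards [hYlim] with x hx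
    exact (ENNReal.tendsto_ofReal hx).liminf_eq.symm
  have h2 := lintegral_liminf_le' (u := atTop) (μ := lam) (f := fun n x => ENNReal.ofReal (Y n x))
    fun n => (hY n).1.aestronglyMeasurable.aemeasurable.ennreal_ofReal
  have h3 : ∀ n, ∫⁻ x, ENNReal.ofReal (Y n x) ∂lam = ENNReal.ofReal c := fun n => by
    rw [← ofReal_integral_eq_lintegral_ofReal (hY n).1 (hY n).2.1, (hY n).2.2]
  simp_rw [h3, liminf_const] at h2
  rw [← h1, ← ofReal_integral_eq_lintegral_ofReal hZ₀ h0] at h2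
  exact (ENNReal.ofReal_le_ofReal_iff hc0).1 h2

lemma integrable_sum_sum_smul_const {𝒳 ι W : Type*} [MeasurableSpace 𝒳] [Fintype ι]
    [NormedAddCommGroup W] [NormedSpace ℝ W] [CompleteSpace W] {ν : Measure 𝒳}
    {A : 𝒳 → ι → ι → ℝ} (hA : ∀ i j, Integrable (fun x => A x i j) ν) (B : ι → ι → W) :
    Integrable (fun x => ∑ i, ∑ j, A x i j • B i j) ν ∧
    ∫ x, ∑ i, ∑ j, A x i j • B i j ∂ν = ∑ i, ∑ j, (∫ x, A x i j ∂ν) • B i j := by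
  have hI : ∀ i j, Integrable (fun x => A x i j • B i j) ν := fun i j => (hA i j).smul_const _
  refine ⟨integrable_finsetSum _ fun i _ => integrable_finsetSum _ fun j _ => hI i j, ?_⟩
  rw [integral_finsetSum _ fun i _ => integrable_finsetSum _ fun j _ => hI i j]
  refine Finset.sum_congr rfl fun i _ => ?_
  rw [integral_finsetSum _ fun j _ => hI i j]
  exact Finset.sum_congr rfl fun j _ => integral_smul_const _ _

open Matrix in
-- Expansion in matrix units reduces integrals of operators to integrals of entries.
lemma toEuclideanCLM_eq_sum {d : ℕ} (A : Matrix (Fin d) (Fin d) ℝ) :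
    toEuclideanCLM (𝕜 := ℝ) A =
      ∑ i, ∑ j, A i j • toEuclideanCLM (𝕜 := ℝ) (Matrix.single i j (1 : ℝ)) := by
  conv_lhs => rw [matrix_eq_sum_single A]
  rw [map_sum]
  refine Finset.sum_congr rfl fun i _ => ?_
  rw [map_sum]
  refine Finset.sum_congr rfl fun j _ => ?_
  rw [← map_smul, Matrix.smul_single, smul_eq_mul, mul_one]

open Matrix in
lemma integral_toEuclideanCLM {𝒳 : Type*} [MeasurableSpace 𝒳] {ν : Measure 𝒳} {d : ℕ}
    {A : 𝒳 → Matrix (Fin d) (Fin d) ℝ} (hA : ∀ i j, Integrable (fun x => A x i j) ν) :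
    Integrable (fun x => toEuclideanCLM (𝕜 := ℝ) (A x)) ν ∧
    ∫ x, toEuclideanCLM (𝕜 := ℝ) (A x) ∂ν =
      toEuclideanCLM (𝕜 := ℝ) (Matrix.of fun i j => ∫ x, A x i j ∂ν) := by
  have h := integrable_sum_sum_smul_const hA
    fun i j => toEuclideanCLM (𝕜 := ℝ) (Matrix.single i j (1 : ℝ))
  have e : (fun x => toEuclideanCLM (𝕜 := ℝ) (A x)) = fun x =>
      ∑ i, ∑ j, A x i j • toEuclideanCLM (𝕜 := ℝ) (Matrix.single i j (1 : ℝ)) :=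
    funext fun x => toEuclideanCLM_eq_sum (A x)
  rw [e, toEuclideanCLM_eq_sum (Matrix.of fun i j => ∫ x, A x i j ∂ν)]
  exact h

/-! ### Verification that the criterion is regular at `θT` -/

section Local
variable {d : ℕ} {𝒳 : Type*} [MeasurableSpace 𝒳]

/-- The regularity conditions around `θT`, with explicit neighbourhood and dominating functions. -/
structure LocalRegularity (φ : ℝ → ℝ≥0∞) (M : Model d 𝒳) (θ θT : EuclideanSpace ℝ (Fin d))
    (N : Set (EuclideanSpace ℝ (Fin d))) (G H : 𝒳 → ℝ) : Prop where
  gen : IsGenerator φ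
  mem : θ ∈ M.Θ
  ae_regular : ∀ᵐ x ∂M.lam, RegularPoint φ M θ x ∨ ∀ α ∈ M.Θ, M.p α x = 0
  ratio : RatioIntegrable φ M θ
  isOpen : IsOpen N
  mem_nhd : θT ∈ N
  subset : N ⊆ M.Θ
  integrable_G : Integrable G M.lam
  abs_pd_le : ∀ᵐ x ∂M.lam, ∀ α ∈ N, ∀ i, |pd i (fun a => fDens φ M θ a x) α| ≤ G x
  abs_pd_pd_le : ∀ᵐ x ∂M.lam, ∀ α ∈ N, ∀ i j, |pd i (pd j fun a => fDens φ M θ a x) α| ≤ G x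
  integrable_H : Integrable H (M.P θT)
  abs_pd_pd_pd_le : ∀ᵐ x ∂(M.P θT), ∀ α ∈ N, ∀ i j k,
    LineDifferentiableAt ℝ (pd j (pd k fun a => hFun φ M θ a x)) α (EuclideanSpace.single i 1) ∧
      |pd i (pd j (pd k fun a => hFun φ M θ a x)) α| ≤ H x

lemma exists_localRegularity {φ : ℝ → ℝ≥0∞} {M : Model d 𝒳} {θ θT : EuclideanSpace ℝ (Fin d)}
    (hφ : IsGenerator φ) (hθ : θ ∈ M.Θ)
    (hp : ∀ᵐ x ∂M.lam, ContDiffOn ℝ 3 (fun α => M.p α x) (interior M.Θ))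
    (hint : RatioIntegrable φ M θ) (hA1 : AssumptionA1 φ M θ θT) :
    ∃ N G H, LocalRegularity φ M θ θT N G H := by
  obtain ⟨N, hN, hθT, hNΘ, ⟨G, hG, hG'⟩, H, hH, hH'⟩ := hA1
  exact ⟨N, G, H, hφ, hθ, ae_regularPoint_or hθ hp hint, hint, hN, hθT, hNΘ, hG,
    hG'.mono fun x hx α hα => (hx α hα).1, hG'.mono fun x hx α hα => (hx α hα).2, hH, hH'⟩

/-- `P_θ f(θ, α)`. -/
noncomputable def meanF (φ : ℝ → ℝ≥0∞) (M : Model d 𝒳) (θ α : EuclideanSpace ℝ (Fin d)) : ℝ :=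
  ∫ y, fFun φ M θ α y ∂(M.P θ)

namespace LocalRegularity
variable {φ : ℝ → ℝ≥0∞} {M : Model d 𝒳} {θ θT α : EuclideanSpace ℝ (Fin d)}
  {N : Set (EuclideanSpace ℝ (Fin d))} {G H : 𝒳 → ℝ}

lemma subset_interior (h : LocalRegularity φ M θ θT N G H) : N ⊆ interior M.Θ :=
  interior_maximal h.subset h.isOpen

lemma mem_interior (h : LocalRegularity φ M θ θT N G H) : θT ∈ interior M.Θ :=
  h.subset_interior h.mem_nhd

lemma mem_T (h : LocalRegularity φ M θ θT N G H) : θT ∈ M.Θ := h.subset h.mem_nhd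

lemma ae_P_regular (h : LocalRegularity φ M θ θT N G H) :
    ∀ᵐ x ∂(M.P θT), RegularPoint φ M θ x := by
  refine (Model.ae_P_iff h.mem_T).2 ?_
  filter_upwards [h.ae_regular] with x hx hpos
  exact hx.resolve_right fun h0 => hpos.ne' (h0 θT h.mem_T)

lemma ae_contDiffOn_fDens (h : LocalRegularity φ M θ θT N G H) :
    ∀ᵐ x ∂M.lam, ContDiffOn ℝ 3 (fun α => fDens φ M θ α x) N := by
  filter_upwards [h.ae_regular] with x hx
  rcases hx with hx | hx
  · exact (hx.contDiffOn_fDens h.gen).mono h.subset_interior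
  · rw [fDens_eq_zero h.mem hx]; exact contDiffOn_const

lemma meanF_deriv (h : LocalRegularity φ M θ θT N G H) (hα : α ∈ N) :
    (∀ i, Integrable (fun x => pd i (fun a => fDens φ M θ a x) α) M.lam) ∧
    DifferentiableAt ℝ (meanF φ M θ) α ∧
    ∀ i, pd i (meanF φ M θ) α = ∫ x, pd i (fun a => fDens φ M θ a x) α ∂M.lam := by
  have h1 := hasFDerivAt_integral_of_abs_pd_le (F := fDens φ M θ) h.isOpen
    (fun β hβ => integrable_fDens h.mem h.ratio (h.subset hβ))
    (h.ae_contDiffOn_fDens.mono fun x hx => hx.differentiableOn (by norm_num))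
    h.integrable_G h.abs_pd_le hα
  have h2 : meanF φ M θ = fun α => ∫ x, fDens φ M θ α x ∂M.lam := integral_fFun h.mem
  rw [h2]
  exact h1

/-- Differentiation under the integral applied to the first partials; the integral formula for these
holds on all of the open set `N`, so it may itself be differentiated. -/
lemma meanF_deriv2 (h : LocalRegularity φ M θ θT N G H) (hα : α ∈ N) (j : Fin d) :
    (∀ i, Integrable (fun x => pd i (pd j fun a => fDens φ M θ a x) α) M.lam) ∧
    DifferentiableAt ℝ (pd j (meanF φ M θ)) α ∧
    ∀ i, pd i (pd j (meanF φ M θ)) α =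
      ∫ x, pd i (pd j fun a => fDens φ M θ a x) α ∂M.lam := by
  obtain ⟨h1, h2, h3⟩ := hasFDerivAt_integral_of_abs_pd_le
    (F := fun α x => pd j (fun a => fDens φ M θ a x) α) h.isOpen
    (fun β hβ => (h.meanF_deriv hβ).1 j)
    (h.ae_contDiffOn_fDens.mono fun x hx =>
      (contDiffOn_pd (n := 2) h.isOpen hx j).differentiableOn (by norm_num))
    h.integrable_G (h.abs_pd_pd_le.mono fun x hx β hβ i => hx β hβ i j) hα
  have he : Set.EqOn (pd j (meanF φ M θ))
      (fun α => ∫ x, pd j (fun a => fDens φ M θ a x) α ∂M.lam) N :=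
    fun β hβ => (h.meanF_deriv hβ).2.2 j
  refine ⟨h1, h2.congr_of_eventuallyEq (he.eventuallyEq_of_mem (h.isOpen.mem_nhds hα)),
    fun i => (eqOn_pd h.isOpen he i hα).trans (h3 i)⟩

section Point
variable {x : 𝒳}

lemma differentiableAt_gFun (h : LocalRegularity φ M θ θT N G H) (hx : RegularPoint φ M θ x)
    (hα : α ∈ N) : DifferentiableAt ℝ (fun a => gFun φ M θ a x) α :=
  ((hx.contDiffOn_gFun h.gen).differentiableOn (by norm_num) α
    (h.subset_interior hα)).differentiableAt (isOpen_interior.mem_nhds (h.subset_interior hα))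

lemma differentiableAt_hFun (h : LocalRegularity φ M θ θT N G H) (hx : RegularPoint φ M θ x)
    (hα : α ∈ N) : DifferentiableAt ℝ (fun a => hFun φ M θ a x) α :=
  (h.meanF_deriv hα).2.1.sub (h.differentiableAt_gFun hx hα)

lemma pd_hFun (h : LocalRegularity φ M θ θT N G H) (hx : RegularPoint φ M θ x) (hα : α ∈ N)
    (j : Fin d) : pd j (fun a => hFun φ M θ a x) α =
      pd j (meanF φ M θ) α - pd j (fun a => gFun φ M θ a x) α := by
  have h1 := (h.meanF_deriv hα).2.1
  have h2 := h.differentiableAt_gFun hx hα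
  refine (pd_eq_of_hasFDerivAt (h1.hasFDerivAt.sub h2.hasFDerivAt) j).trans ?_
  rw [sub_apply, pd_eq_fderiv h1, pd_eq_fderiv h2]

lemma hasFDerivAt_pd_hFun (h : LocalRegularity φ M θ θT N G H) (hx : RegularPoint φ M θ x)
    (hα : α ∈ N) (j : Fin d) : HasFDerivAt (pd j fun a => hFun φ M θ a x)
      (fderiv ℝ (pd j (meanF φ M θ)) α - fderiv ℝ (pd j fun a => gFun φ M θ a x) α) α := by
  have h1 := (h.meanF_deriv2 hα j).2.1
  have h2 := hx.differentiableAt_pd_gFun h.gen (h.subset_interior hα) j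
  have he : Set.EqOn (pd j fun a => hFun φ M θ a x)
      (fun α => pd j (meanF φ M θ) α - pd j (fun a => gFun φ M θ a x) α) N :=
    fun β hβ => h.pd_hFun hx hβ j
  exact (h1.hasFDerivAt.sub h2.hasFDerivAt).congr_of_eventuallyEq
    (he.eventuallyEq_of_mem (h.isOpen.mem_nhds hα))

lemma pd_pd_hFun (h : LocalRegularity φ M θ θT N G H) (hx : RegularPoint φ M θ x)
    (hα : α ∈ N) (i j : Fin d) : pd i (pd j fun a => hFun φ M θ a x) α =
      pd i (pd j (meanF φ M θ)) α - pd i (pd j fun a => gFun φ M θ a x) α := by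
  rw [pd_eq_of_hasFDerivAt (h.hasFDerivAt_pd_hFun hx hα j) i, sub_apply,
    pd_eq_fderiv (h.meanF_deriv2 hα j).2.1,
    pd_eq_fderiv (hx.differentiableAt_pd_gFun h.gen (h.subset_interior hα) j)]

lemma hasGradientAt_hFun (h : LocalRegularity φ M θ θT N G H) (hx : RegularPoint φ M θ x)
    (hα : α ∈ N) : HasGradientAt (fun a => hFun φ M θ a x) (score φ M θ α x) α := by
  have h1 := h.differentiableAt_hFun hx hα
  rw [hasGradientAt_iff_hasFDerivAt]
  refine h1.hasFDerivAt.congr_fderiv ?_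
  ext v
  rw [clm_apply_eq_sum, InnerProductSpace.toDual_apply_apply, PiLp.inner_apply]
  refine Finset.sum_congr rfl fun i _ => ?_
  rw [← pd_eq_fderiv h1]
  simp [score]

end Point

lemma ae_p_mul_pd_gFun (h : LocalRegularity φ M θ θT N G H) (i : Fin d) :
    ∀ᵐ x ∂M.lam, M.p θT x * pd i (fun a => gFun φ M θ a x) θT =
      pd i (fun a => fDens φ M θ a x) θT := by
  filter_upwards [h.ae_regular] with x hx
  rcases hx with hx | hx
  · exact (hx.pd_fDens h.gen h.mem h.mem_interior i).symm
  · rw [fDens_eq_zero h.mem hx, pd_const, hx θT h.mem_T, zero_mul]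

lemma ae_p_mul_pd_pd_gFun (h : LocalRegularity φ M θ θT N G H) (i j : Fin d) :
    ∀ᵐ x ∂M.lam, M.p θT x * pd i (pd j fun a => gFun φ M θ a x) θT -
        pd i (pd j fun a => fDens φ M θ a x) θT =
      infoWeight φ M θ θT x * pd i (fun a => M.p a x) θT * pd j (fun a => M.p a x) θT := by
  filter_upwards [h.ae_regular] with x hx
  rcases hx with hx | hx
  · rw [hx.pd_pd_fDens h.gen h.mem h.mem_interior i j]; ring
  · rw [fDens_eq_zero h.mem hx, pd_const, pd_const]; simp [infoWeight, hx θT h.mem_T]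

lemma integral_pd_gFun (h : LocalRegularity φ M θ θT N G H) (i : Fin d) :
    Integrable (fun x => pd i (fun a => gFun φ M θ a x) θT) (M.P θT) ∧
    ∫ x, pd i (fun a => gFun φ M θ a x) θT ∂(M.P θT) = pd i (meanF φ M θ) θT := by
  have h1 := h.meanF_deriv h.mem_nhd
  rw [Model.integrable_P_iff h.mem_T, Model.integral_P h.mem_T, h1.2.2 i,
    integral_congr_ae (h.ae_p_mul_pd_gFun i)]
  exact ⟨(h1.1 i).congr (Filter.EventuallyEq.symm (h.ae_p_mul_pd_gFun i)), rfl⟩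

/-- The score is `∂(P_θ f)` minus `∂g`, and `P_{θT} ∂g = ∂(P_θ f)` by integrating the first order
identity. -/
lemma integral_score (h : LocalRegularity φ M θ θT N G H) (i : Fin d) :
    ∫ x, score φ M θ θT x i ∂(M.P θT) = 0 := by
  have := Model.isProbabilityMeasure_P h.mem_T
  have h1 := h.integral_pd_gFun i
  have h2 : (fun x => score φ M θ θT x i) =ᵐ[M.P θT] fun x =>
      pd i (meanF φ M θ) θT - pd i (fun a => gFun φ M θ a x) θT := by
    filter_upwards [h.ae_P_regular] with x hx using h.pd_hFun hx h.mem_nhd i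
  rw [integral_congr_ae h2, integral_sub (integrable_const _) h1.1, h1.2]
  simp

lemma aestronglyMeasurable_score (h : LocalRegularity φ M θ θT N G H) :
    AEStronglyMeasurable (score φ M θ θT) (M.P θT) := by
  have h1 : ∀ i, AEStronglyMeasurable (fun x => score φ M θ θT x i) (M.P θT) := fun i =>
    aestronglyMeasurable_pd (F := hFun φ M θ) h.isOpen
      (fun α hα => (measurable_hFun h.gen h.mem (h.subset hα)).aestronglyMeasurable)
      (h.ae_P_regular.mono fun x hx α hα =>
        (h.differentiableAt_hFun hx hα).differentiableWithinAt) h.mem_nhd i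
  have h2 : AEMeasurable (fun x i => score φ M θ θT x i) (M.P θT) :=
    aemeasurable_pi_lambda _ fun i => (h1 i).aemeasurable
  exact ((WithLp.measurable_toLp 2 (Fin d → ℝ)).comp_aemeasurable h2).aestronglyMeasurable

/-- The matrix `S` is a weighted Fisher information matrix. -/
lemma matS_apply (h : LocalRegularity φ M θ θT N G H) (hA2 : AssumptionA2 φ M θ θT)
    (i j : Fin d) :
    Integrable (fun x => infoWeight φ M θ θT x * pd i (fun a => M.p a x) θT *
      pd j (fun a => M.p a x) θT) M.lam ∧
    matS φ M θ θT i j = ∫ x, infoWeight φ M θ θT x * pd i (fun a => M.p a x) θT *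
      pd j (fun a => M.p a x) θT ∂M.lam := by
  have := Model.isProbabilityMeasure_P h.mem_T
  obtain ⟨h1, _, h2⟩ := h.meanF_deriv2 h.mem_nhd j
  have h3 : (fun x => hess φ M θ θT x i j) =ᵐ[M.P θT] fun x =>
      pd i (pd j (meanF φ M θ)) θT - pd i (pd j fun a => gFun φ M θ a x) θT := by
    filter_upwards [h.ae_P_regular] with x hx using h.pd_pd_hFun hx h.mem_nhd i j
  -- Up to sign, `∂²g` differs from the integrable Hessian of `h` by a constant.
  have hg : Integrable (fun x => pd i (pd j fun a => gFun φ M θ a x) θT) (M.P θT) := by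
    refine ((integrable_const (pd i (pd j (meanF φ M θ)) θT)).sub (hA2.hess_int i j)).congr ?_
    filter_upwards [h3] with x hx
    simp [hx]
  have hg' := (Model.integrable_P_iff h.mem_T).1 hg
  have h4 := h.ae_p_mul_pd_pd_gFun i j
  refine ⟨(hg'.sub (h1 i)).congr h4, ?_⟩
  -- Both sides equal `P_{θT} ∂²g - ∂²(P_θ f)`.
  rw [← integral_congr_ae h4, integral_sub hg' (h1 i), ← h2 i, ← Model.integral_P h.mem_T]
  change -∫ x, hess φ M θ θT x i j ∂(M.P θT) = _
  rw [integral_congr_ae h3, integral_sub (integrable_const _) hg]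
  simp

open Matrix in
-- The quadratic form is `∫ infoWeight * (∑ vᵢ ∂ᵢp)²`, nonnegative because `φ'` is monotone;
-- non-singularity excludes a kernel.
lemma matS_posDef (h : LocalRegularity φ M θ θT N G H) (hA2 : AssumptionA2 φ M θ θT) :
    (matS φ M θ θT).PosDef := by
  have hpsd : (matS φ M θ θT).PosSemidef := by
    refine PosSemidef.of_dotProduct_mulVec_nonneg ?_ fun v => ?_
    · ext i j
      simp only [conjTranspose_apply, star_trivial]
      rw [(h.matS_apply hA2 j i).2, (h.matS_apply hA2 i j).2]
      congr 1; ext x; ring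
    · have h1 : star v ⬝ᵥ matS φ M θ θT *ᵥ v =
          ∫ x, ∑ i, ∑ j, v i * v j * (infoWeight φ M θ θT x * pd i (fun a => M.p a x) θT *
            pd j (fun a => M.p a x) θT) ∂M.lam := by
        have hI : ∀ i j, Integrable (fun x => v i * v j * (infoWeight φ M θ θT x *
            pd i (fun a => M.p a x) θT * pd j (fun a => M.p a x) θT)) M.lam := fun i j =>
          (h.matS_apply hA2 i j).1.const_mul _
        rw [integral_finsetSum _ fun i _ => integrable_finsetSum _ fun j _ => hI i j]
        simp only [dotProduct, mulVec, Finset.mul_sum, star_trivial]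
        refine Finset.sum_congr rfl fun i _ => ?_
        rw [integral_finsetSum _ fun j _ => hI i j]
        refine Finset.sum_congr rfl fun j _ => ?_
        rw [integral_const_mul, (h.matS_apply hA2 i j).2]
        ring
      rw [h1]
      refine integral_nonneg_of_ae ?_
      filter_upwards [h.ae_regular] with x hx
      have h2 := infoWeight_nonneg h.gen h.mem_T hx
      have h3 : ∑ i, ∑ j, v i * v j * (infoWeight φ M θ θT x * pd i (fun a => M.p a x) θT *
            pd j (fun a => M.p a x) θT) =
          infoWeight φ M θ θT x * (∑ i, v i * pd i (fun a => M.p a x) θT) ^ 2 := by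
        rw [sq, Finset.sum_mul_sum, Finset.mul_sum]
        refine Finset.sum_congr rfl fun i _ => ?_
        rw [Finset.mul_sum]
        exact Finset.sum_congr rfl fun j _ => by ring
      rw [h3]
      exact mul_nonneg h2 (sq_nonneg _)
  refine hpsd.posDef_iff_isUnit.2 ?_
  have : matS φ M θ θT = -(Matrix.of fun i j => ∫ x, hess φ M θ θT x i j ∂(M.P θT)) := by
    ext i j; simp [matS]
  rw [this]
  exact hA2.nonsingular.neg

open Matrix in
/-- The criterion `h(θ, ·)` is regular at `θT`. -/
lemma exists_regularCriterion (h : LocalRegularity φ M θ θT N G H)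
    (hA2 : AssumptionA2 φ M θ θT) : ∃ Hs K δ, RegularCriterion (M.P θT) (hFun φ M θ)
      (score φ M θ) Hs K (toEuclideanCLM (𝕜 := ℝ) (matS φ M θ θT)) θT δ ∧
      Metric.ball θT δ ⊆ M.Θ := by
  obtain ⟨δ, hδ, hball⟩ := Metric.isOpen_iff.1 h.isOpen θT h.mem_nhd
  have hsymm : (matS φ M θ θT)ᵀ = matS φ M θ θT := by
    have := (h.matS_posDef hA2).isHermitian
    rwa [IsHermitian, conjTranspose_eq_transpose_of_trivial] at this
  have hHs := integral_toEuclideanCLM (A := fun x => (hess φ M θ θT x)ᵀ) (ν := M.P θT)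
    fun i j => hA2.hess_int j i
  -- The transpose puts the components of the gradient in rows; after integration the symmetry of
  -- `S` absorbs it. The absolute value in `d ^ 3 * |H x|` gives nonnegativity at every `x`.
  refine ⟨fun x => toEuclideanCLM (𝕜 := ℝ) (hess φ M θ θT x)ᵀ, fun x => d ^ 3 * |H x|, δ,
    ⟨hδ, ?_, ?_, ?_, fun x => by positivity, h.integrable_H.abs.const_mul _, hHs.1, ?_,
      h.integral_score, ?_⟩, hball.trans h.subset⟩
  · exact fun α hα => (measurable_hFun h.gen h.mem (h.subset (hball hα))).aemeasurable
  · filter_upwards [h.ae_P_regular] with x hx α hα using h.hasGradientAt_hFun hx (hball hα)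
  · filter_upwards [h.ae_P_regular, h.abs_pd_pd_pd_le] with x hx hx3 ρ _ hρδ α hα β hβ
    exact norm_sub_sub_le_of_abs_pd_pd_pd_le (F := fun a => hFun φ M θ a x)
      (fun γ hγ j => (h.hasFDerivAt_pd_hFun hx (hball hγ) j).differentiableAt)
      (fun γ hγ i j k => (hx3 γ (hball hγ) i j k).1)
      (fun γ hγ i j k => (hx3 γ (hball hγ) i j k).2) hρδ hα hβ
  · exact (memLp_two_iff_integrable_sq_norm h.aestronglyMeasurable_score).2 hA2.score_sq
  · rw [hHs.2, ← map_neg, ← hsymm]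
    congr 1
    ext i j
    simp [matS]

end LocalRegularity
end Local

/-! ### Coercivity of positive definite matrices -/

section Coercive
open Matrix
open scoped RealInnerProductSpace MatrixOrder

lemma inner_toEuclideanCLM_comm {ι : Type*} [Fintype ι] [DecidableEq ι] {S : Matrix ι ι ℝ}
    (hS : S.IsHermitian) (v w : EuclideanSpace ℝ ι) :
    ⟪toEuclideanCLM (𝕜 := ℝ) S v, w⟫ = ⟪v, toEuclideanCLM (𝕜 := ℝ) S w⟫ := by
  have h : IsSelfAdjoint (toEuclideanCLM (𝕜 := ℝ) S) := IsSelfAdjoint.map hS _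
  conv_lhs => rw [← h.adjoint_eq]
  exact ContinuousLinearMap.adjoint_inner_left _ _ _

/-- With `R` the square root of `S`, `⟪S v, v⟫ = ‖R v‖²` and `v = R⁻¹ (R v)`, so `‖R⁻¹‖` gives the
constant; the added `1` covers dimension zero. -/
lemma exists_coercive_of_posDef {ι : Type*} [Fintype ι] [DecidableEq ι] {S : Matrix ι ι ℝ}
    (hS : S.PosDef) : ∃ c : ℝ, 0 < c ∧ ∀ v, c * ‖v‖ ^ 2 ≤ ⟪toEuclideanCLM (𝕜 := ℝ) S v, v⟫ := by
  set R := CFC.sqrt S with hR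
  have hRR : R * R = S := CFC.sqrt_mul_sqrt_self _ hS.posSemidef.nonneg
  have hRh : R.IsHermitian := (CFC.sqrt_nonneg S).isSelfAdjoint
  have hdet : IsUnit R.det := by
    have h1 : IsUnit (R * R).det := hRR ▸ (isUnit_iff_isUnit_det S).1 hS.isUnit
    rw [det_mul] at h1
    exact isUnit_of_mul_isUnit_left h1
  let A := toEuclideanCLM (𝕜 := ℝ) R⁻¹
  refine ⟨(‖A‖ ^ 2 + 1)⁻¹, by positivity, fun v => ?_⟩
  have h1 : ⟪toEuclideanCLM (𝕜 := ℝ) S v, v⟫ = ‖toEuclideanCLM (𝕜 := ℝ) R v‖ ^ 2 := by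
    rw [← hRR, map_mul, mul_apply_eq_comp, inner_toEuclideanCLM_comm hRh,
      real_inner_self_eq_norm_sq]
  have h2 : v = A (toEuclideanCLM (𝕜 := ℝ) R v) := by
    rw [← mul_apply_eq_comp, ← map_mul, nonsing_inv_mul _ hdet, map_one, one_apply_eq_self]
  have h3 : ‖v‖ ≤ ‖A‖ * ‖toEuclideanCLM (𝕜 := ℝ) R v‖ := by
    conv_lhs => rw [h2]
    exact A.le_opNorm _
  rw [h1, inv_mul_le_iff₀ (by positivity)]
  have h4 := pow_le_pow_left₀ (norm_nonneg _) h3 2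
  rw [mul_pow] at h4
  nlinarith [sq_nonneg ‖toEuclideanCLM (𝕜 := ℝ) R v‖]

end Coercive

/-! ### The case `θT = θ` and the dual representation of the divergence -/

section Null
variable {d : ℕ} {𝒳 : Type*} [MeasurableSpace 𝒳] {φ : ℝ → ℝ≥0∞} {M : Model d 𝒳}
  {θ θT α : EuclideanSpace ℝ (Fin d)} {N : Set (EuclideanSpace ℝ (Fin d))} {G H : 𝒳 → ℝ}

namespace LocalRegularity

lemma ae_differentiableAt_p (h : LocalRegularity φ M θ θT N G H) :
    ∀ᵐ x ∂M.lam, DifferentiableAt ℝ (fun α => M.p α x) θT := by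
  filter_upwards [h.ae_regular] with x hx
  rcases hx with hx | hx
  · exact (hx.contDiffOn_p.differentiableOn (by norm_num) θT h.mem_interior).differentiableAt
      (isOpen_interior.mem_nhds h.mem_interior)
  · refine (differentiableAt_const (0 : ℝ)).congr_of_eventuallyEq ?_
    filter_upwards [h.isOpen.mem_nhds h.mem_nhd] with α hα using hx α (h.subset hα)

/-- Under the null hypothesis, the derivative of `f p_θ` is proportional to that of the density. -/
lemma ae_pd_fDens_self (h : LocalRegularity φ M θ θ N G H) (i : Fin d) :
    ∀ᵐ x ∂M.lam, pd i (fun a => fDens φ M θ a x) θ =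
      -(deriv (dphi φ) 1 * pd i (fun a => M.p a x) θ) := by
  filter_upwards [h.ae_regular] with x hx
  rcases hx with hx | hx
  · have hpos := (hx.pos θ h.mem).ne'
    rw [hx.pd_fDens h.gen h.mem h.mem_interior, hx.pd_gFun h.gen h.mem_interior, infoWeight,
      div_self hpos]
    field_simp
  · have h1 : pd i (fun a => M.p a x) θ = pd i (fun _ => (0 : ℝ)) θ :=
      eqOn_pd h.isOpen (fun β hβ => hx β (h.subset hβ)) i h.mem_nhd
    rw [fDens_eq_zero h.mem hx, h1, pd_const]; simp

/-- One-sided Lipschitz bound for the densities. -/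
lemma exists_p_sub_le (h : LocalRegularity φ M θ θ N G H) (hb : 0 < deriv (dphi φ) 1) :
    ∃ δ C, 0 < δ ∧ Metric.ball θ δ ⊆ N ∧ ∀ᵐ x ∂M.lam, ∀ α ∈ Metric.ball θ δ,
      M.p θ x - M.p α x ≤ C * G x * ‖α - θ‖ := by
  obtain ⟨κ, hκ, hle⟩ := h.gen.exists_mul_le_dphi_sub hb
  obtain ⟨δ, hδ, hball⟩ := Metric.isOpen_iff.1 h.isOpen θ h.mem_nhd
  refine ⟨δ, d / κ, hδ, hball, ?_⟩
  filter_upwards [h.ae_regular, h.ae_contDiffOn_fDens, h.abs_pd_le] with x hx hC hG α hα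
  have hLip : |fDens φ M θ α x - fDens φ M θ θ x| ≤ d * G x * ‖α - θ‖ := by
    have hd : ∀ β ∈ Metric.ball θ δ, DifferentiableAt ℝ (fun a => fDens φ M θ a x) β :=
      fun β hβ => (hC.differentiableOn (by norm_num) β (hball hβ)).differentiableAt
        (h.isOpen.mem_nhds (hball hβ))
    refine (convex_ball θ δ).norm_image_sub_le_of_norm_fderiv_le (𝕜 := ℝ)
      (f := fun a => fDens φ M θ a x) hd (fun β hβ => ?_) (Metric.mem_ball_self hδ) hα
    refine (clm_norm_le_sum _).trans ?_
    simp_rw [← pd_eq_fderiv (hd β hβ)]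
    refine (Finset.sum_le_sum fun i _ => hG β (hball hβ) i).trans ?_
    simp
  have hnonneg : 0 ≤ d * G x * ‖α - θ‖ := (abs_nonneg _).trans hLip
  have e : d / κ * G x * ‖α - θ‖ = (d * G x * ‖α - θ‖) / κ := by ring
  rw [e, le_div_iff₀ hκ]
  rcases hx with hx | hx
  · have hpα := hx.pos α (h.subset (hball hα))
    have hpθ := hx.pos θ h.mem
    -- The bound is trivial for `p_θ ≤ p_α`. Otherwise `r ≥ 1`, and multiplying the lower bound for
    -- `φ'(r) - φ'(1)` by `p_θ` turns `1 - 1 / r` into `p_θ - p_α`.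
    rcases le_total (M.p θ x) (M.p α x) with hcase | hcase
    · nlinarith
    · have h1 := hle _ (hx.mem_dom α (h.subset (hball hα))) ((one_le_div hpα).2 hcase)
      have h2 : fDens φ M θ α x - fDens φ M θ θ x =
          M.p θ x * (dphi φ (M.p θ x / M.p α x) - dphi φ 1) := by
        simp only [fDens, fFun, div_self hpθ.ne']; ring
      have h3 := (le_abs_self _).trans hLip
      rw [h2] at h3
      have h4 := mul_le_mul_of_nonneg_left h1 hpθ.le
      have h5 : M.p θ x * (κ * (1 - 1 / (M.p θ x / M.p α x))) = (M.p θ x - M.p α x) * κ := by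
        field_simp
      linarith
  · rw [hx θ h.mem, hx α (h.subset (hball hα)), sub_zero, zero_mul]
    exact hnonneg

/-- The densities may be differentiated under the integral sign at `θ`. -/
lemma integral_pd_p_eq_zero (h : LocalRegularity φ M θ θ N G H) (hb : 0 < deriv (dphi φ) 1)
    (i : Fin d) : ∫ x, pd i (fun a => M.p a x) θ ∂M.lam = 0 := by
  obtain ⟨δ, C, hδ, hball, hle⟩ := h.exists_p_sub_le hb
  set e : EuclideanSpace ℝ (Fin d) := EuclideanSpace.single i 1
  have hI : Integrable (fun x => pd i (fun a => M.p a x) θ) M.lam := by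
    refine (((h.meanF_deriv h.mem_nhd).1 i).const_mul (-(deriv (dphi φ) 1)⁻¹)).congr ?_
    filter_upwards [h.ae_pd_fDens_self i] with x hx
    rw [hx]; field_simp
  -- Fatou for difference quotients in direction `s e`, made nonnegative by adding `C * G`. Each
  -- quotient has integral zero because densities integrate to one. The signs `1` and `-1` together
  -- give equality.
  have key : ∀ s : ℝ, |s| = 1 → s * ∫ x, pd i (fun a => M.p a x) θ ∂M.lam ≤ 0 := by
    intro s hs
    let t : ℕ → ℝ := fun n => 1 / ((n : ℝ) + 1)
    have htp : ∀ n, 0 < t n := fun n => by positivity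
    have ht : Tendsto t atTop (𝓝 0) := tendsto_one_div_add_atTop_nhds_zero_nat
    have htδ : ∀ᶠ n in atTop, θ + t n • (s • e) ∈ Metric.ball θ δ := by
      have : Tendsto (fun n => θ + t n • (s • e)) atTop (𝓝 θ) := by
        simpa using (ht.smul_const (s • e)).const_add θ
      exact this.eventually_mem (Metric.ball_mem_nhds θ hδ)
    have hnorm : ∀ n, ‖θ + t n • (s • e) - θ‖ = t n := fun n => by
      simp [norm_smul, hs, e, abs_of_pos (htp n)]
    have hGI : Integrable (fun x => C * G x) M.lam := h.integrable_G.const_mul C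
    have hfat := integral_le_of_ae_tendsto (lam := M.lam)
      (Z := fun n x => (t n)⁻¹ * (M.p (θ + t n • (s • e)) x - M.p θ x) + C * G x)
      (Z₀ := fun x => s * pd i (fun a => M.p a x) θ + C * G x) (c := ∫ x, C * G x ∂M.lam)
      (by
        filter_upwards [htδ] with n hn
        exact (((Model.integrable_p (h.subset (hball hn))).sub
          (Model.integrable_p h.mem)).const_mul _).add hGI)
      (by
        filter_upwards [htδ] with n hn
        filter_upwards [hle] with x hx
        have h1 := hx _ hn
        rw [hnorm] at h1
        have h2 := htp n
        have h3 : (t n)⁻¹ * (M.p θ x - M.p (θ + t n • (s • e)) x) ≤ C * G x := by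
          rw [inv_mul_le_iff₀ h2]; linarith
        simp only [Pi.zero_apply]
        linarith [mul_sub (t n)⁻¹ (M.p θ x) (M.p (θ + t n • (s • e)) x),
          mul_sub (t n)⁻¹ (M.p (θ + t n • (s • e)) x) (M.p θ x)])
      (by
        filter_upwards [htδ] with n hn
        have h1 := Model.integrable_p (h.subset (hball hn))
        have h2 := Model.integrable_p h.mem
        have h12 : Integrable (fun x => (t n)⁻¹ * (M.p (θ + t n • (s • e)) x - M.p θ x)) M.lam :=
          (h1.sub h2).const_mul _
        rw [integral_add h12 hGI, integral_const_mul, integral_sub h1 h2,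
          Model.integral_p (h.subset (hball hn)), Model.integral_p h.mem]
        simp)
      (by
        filter_upwards [h.ae_differentiableAt_p] with x hx
        refine Tendsto.add_const _ ?_
        have h1 := (hx.lineDifferentiableAt (v := s • e)).hasLineDerivAt.tendsto_slope_zero
        rw [lineDeriv_smul] at h1
        exact h1.comp (tendsto_nhdsWithin_iff.2
          ⟨ht, Eventually.of_forall fun n => (htp n).ne'⟩))
      ((hI.const_mul s).add hGI)
    rw [integral_add (hI.const_mul s) hGI, integral_const_mul] at hfat
    linarith
  have h1 := key 1 (by simp)
  have h2 := key (-1) (by simp)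
  linarith

/-- Under the null hypothesis, `M` is proportional to `S`. -/
lemma matM_eq_smul_matS (h : LocalRegularity φ M θ θ N G H) (hA2 : AssumptionA2 φ M θ θ) :
    (0 < deriv (dphi φ) 1 ∨ d = 0) ∧
      matM φ M θ θ = deriv (dphi φ) 1 • matS φ M θ θ := by
  set b := deriv (dphi φ) 1 with hbdef
  have hw : ∀ᵐ x ∂M.lam, infoWeight φ M θ θ x = b / M.p θ x := by
    filter_upwards [h.ae_regular] with x hx
    rcases hx with hx | hx
    · rw [infoWeight, div_self (hx.pos θ h.mem).ne']; simp [hbdef]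
    · simp [infoWeight, hx θ h.mem]
  -- Strict convexity permits `φ''(1) = 0`, but then `S` would vanish, contradicting positive
  -- definiteness unless `d = 0`.
  have hb : 0 < b ∨ d = 0 := by
    rcases (h.gen.deriv_dphi_nonneg h.gen.one_mem).lt_or_eq with hb | hb
    · exact Or.inl hb
    · refine Or.inr ?_
      by_contra hd
      have i : Fin d := ⟨0, Nat.pos_of_ne_zero hd⟩
      have h1 := (h.matS_posDef hA2).diag_pos (i := i)
      rw [(h.matS_apply hA2 i i).2] at h1
      have h2 : ∫ x, infoWeight φ M θ θ x * pd i (fun a => M.p a x) θ *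
          pd i (fun a => M.p a x) θ ∂M.lam = ∫ _, (0 : ℝ) ∂M.lam := by
        refine integral_congr_ae ?_
        filter_upwards [hw] with x hx
        rw [hx, hbdef, ← hb]; simp
      rw [h2] at h1
      simp at h1
  refine ⟨hb, ?_⟩
  ext i j
  replace hb : 0 < b := hb.resolve_right fun hd => by subst hd; exact i.elim0
  -- So the score at `θ` is `b ∂p / p`, and its covariance is `b` times `∫ b ∂ᵢp ∂ⱼp / p dλ`.
  have hmean : ∀ i, pd i (meanF φ M θ) θ = 0 := fun i => by
    rw [(h.meanF_deriv h.mem_nhd).2.2 i, integral_congr_ae (h.ae_pd_fDens_self i), integral_neg,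
      integral_const_mul, h.integral_pd_p_eq_zero hb i]
    simp
  rw [Matrix.smul_apply, smul_eq_mul, (h.matS_apply hA2 i j).2, ← integral_const_mul]
  change ∫ x, score φ M θ θ x i * score φ M θ θ x j ∂(M.P θ) = _
  rw [Model.integral_P h.mem]
  refine integral_congr_ae ?_
  filter_upwards [h.ae_regular, hw] with x hx hwx
  rcases hx with hx | hx
  · have hsc : ∀ k, score φ M θ θ x k = infoWeight φ M θ θ x * pd k (fun a => M.p a x) θ :=
      fun k => by
      have : score φ M θ θ x k = _ := h.pd_hFun hx h.mem_nhd k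
      rw [this, hmean, hx.pd_gFun h.gen h.mem_interior]; simp
    have hpos := (hx.pos θ h.mem).ne'
    simp only [hsc, hwx]
    field_simp
  · simp [infoWeight, hx θ h.mem]

/-- Under the null hypothesis the criterion vanishes at `θ`. -/
lemma ae_hFun_self (h : LocalRegularity φ M θ θ N G H) :
    ∀ᵐ x ∂(M.P θ), hFun φ M θ θ x = 0 := by
  have := Model.isProbabilityMeasure_P h.mem
  have h1 : ∀ᵐ x ∂(M.P θ), fFun φ M θ θ x = dphi φ 1 := by
    filter_upwards [h.ae_P_regular] with x hx
    rw [fFun, div_self (hx.pos θ h.mem).ne']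
  have h2 : ∫ y, fFun φ M θ θ y ∂(M.P θ) = dphi φ 1 := by
    rw [integral_congr_ae h1]; simp
  filter_upwards [h.ae_P_regular] with x hx
  rw [hFun, h2, gFun, div_self (hx.pos θ h.mem).ne']
  simp [realVal, h.gen.map_one]

end LocalRegularity

/-- The dual representation of the divergence at `θT`. -/
lemma phiDiv_eq_integral_hFun (hθ : θ ∈ M.Θ) (hθT : θT ∈ M.Θ)
    (hreg : ∀ᵐ x ∂M.lam, RegularPoint φ M θ x ∨ ∀ α ∈ M.Θ, M.p α x = 0)
    (hint : RatioIntegrable φ M θ) (hh : Integrable (hFun φ M θ θT) (M.P θT)) :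
    phiDiv φ (M.P θ) (M.P θT) ≠ ∞ ∧
      (phiDiv φ (M.P θ) (M.P θT)).toReal = ∫ x, hFun φ M θ θT x ∂(M.P θT) := by
  have := Model.isProbabilityMeasure_P hθT
  have := Model.isProbabilityMeasure_P hθ
  have hregT : ∀ᵐ x ∂(M.P θT), RegularPoint φ M θ x := by
    refine (Model.ae_P_iff hθT).2 ?_
    filter_upwards [hreg] with x hx hpos
    exact hx.resolve_right fun h0 => hpos.ne' (h0 θT hθT)
  have hrm : Measurable fun x => M.p θ x / M.p θT x :=
    (M.measurable_p θ hθ).div (M.measurable_p θT hθT)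
  have hwd : M.P θ = (M.P θT).withDensity fun x => ENNReal.ofReal (M.p θ x / M.p θT x) := by
    rw [Model.P, Model.P, ← withDensity_mul _ (Model.measurable_ofReal_p hθT) hrm.ennreal_ofReal]
    refine withDensity_congr_ae ?_
    filter_upwards [hreg] with x hx
    rw [Pi.mul_apply, ← ENNReal.ofReal_mul (M.p_nonneg θT hθT x)]
    rcases hx with hx | hx
    · rw [mul_div_cancel₀ _ (hx.pos θT hθT).ne']
    · simp [hx θ hθ, hx θT hθT]
  have hac : M.P θ ≪ M.P θT := hwd ▸ withDensity_absolutelyContinuous _ _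
  have hrn : (M.P θ).rnDeriv (M.P θT) =ᵐ[M.P θT] fun x =>
      ENNReal.ofReal (M.p θ x / M.p θT x) := by
    conv_lhs => rw [hwd]
    exact Measure.rnDeriv_withDensity _ hrm.ennreal_ofReal
  have hrf : (fun x => M.p θT x * (M.p θ x / M.p θT x * fFun φ M θ θT x)) =ᵐ[M.lam]
      fun x => M.p θ x * fFun φ M θ θT x := by
    filter_upwards [hreg] with x hx
    rcases hx with hx | hx
    · have := (hx.pos θT hθT).ne'
      field_simp
    · simp [hx θ hθ, hx θT hθT]
  have hrfI : Integrable (fun x => M.p θ x / M.p θT x * fFun φ M θ θT x) (M.P θT) :=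
    (Model.integrable_P_iff hθT).2
      (((Model.integrable_P_iff hθ).1 (hint.integrable θT hθT)).congr hrf.symm)
  have hrf' : ∫ x, M.p θ x / M.p θT x * fFun φ M θ θT x ∂(M.P θT) =
      ∫ y, fFun φ M θ θT y ∂(M.P θ) := by
    rw [Model.integral_P hθT, Model.integral_P hθ, integral_congr_ae hrf]
  -- The bracket subtracted from `h` has `P_{θT}`-mean zero, as `P_{θT} (r f) = P_θ f`. So `φ(r)`
  -- inherits both its integrability and its mean from `h`.
  have hval : ∀ x, realVal φ (M.p θ x / M.p θT x) = hFun φ M θ θT x -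
      ((∫ y, fFun φ M θ θT y ∂(M.P θ)) - M.p θ x / M.p θT x * fFun φ M θ θT x) := fun x => by
    simp only [hFun, gFun, fFun]; ring
  have hconst : Integrable (fun x => (∫ y, fFun φ M θ θT y ∂(M.P θ)) -
      M.p θ x / M.p θT x * fFun φ M θ θT x) (M.P θT) := (integrable_const _).sub hrfI
  have hvI : Integrable (fun x => realVal φ (M.p θ x / M.p θT x)) (M.P θT) := by
    simp_rw [hval]; exact hh.sub hconst
  have hvint : ∫ x, realVal φ (M.p θ x / M.p θT x) ∂(M.P θT) =
      ∫ x, hFun φ M θ θT x ∂(M.P θT) := by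
    simp_rw [hval]
    rw [integral_sub hh hconst, integral_sub (integrable_const _) hrfI, hrf']
    simp
  have hD : phiDiv φ (M.P θ) (M.P θT) =
      ENNReal.ofReal (∫ x, realVal φ (M.p θ x / M.p θT x) ∂(M.P θT)) := by
    rw [phiDiv, if_pos hac, ofReal_integral_eq_lintegral_ofReal hvI
      (ae_of_all _ fun x => ENNReal.toReal_nonneg)]
    refine lintegral_congr_ae ?_
    filter_upwards [hrn, hregT] with x hx hr
    have h1 := interior_subset (hr.mem_dom θT hθT)
    rw [hx, ENNReal.toReal_ofReal (div_nonneg (M.p_nonneg θ hθ x) (M.p_nonneg θT hθT x)),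
      realVal, ENNReal.ofReal_toReal (ne_of_lt h1)]
  have h0 : 0 ≤ ∫ x, realVal φ (M.p θ x / M.p θT x) ∂(M.P θT) :=
    integral_nonneg fun x => ENNReal.toReal_nonneg
  rw [hD, ENNReal.toReal_ofReal h0]
  exact ⟨ENNReal.ofReal_ne_top, hvint⟩

end Null

/-! ### Limit laws of the estimator and of the statistic -/

section Limits
open Matrix
open scoped RealInnerProductSpace

namespace RegularCriterion
variable {d : ℕ} {Ω 𝒳 : Type*} [MeasurableSpace Ω] [MeasurableSpace 𝒳] {μ : Measure Ω}
  [IsProbabilityMeasure μ] {ν : Measure 𝒳} {X : ℕ → Ω → 𝒳}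
  {h : EuclideanSpace ℝ (Fin d) → 𝒳 → ℝ}
  {sc : EuclideanSpace ℝ (Fin d) → 𝒳 → EuclideanSpace ℝ (Fin d)}
  {Hs : 𝒳 → EuclideanSpace ℝ (Fin d) →L[ℝ] EuclideanSpace ℝ (Fin d)} {K : 𝒳 → ℝ}
  {S V : Matrix (Fin d) (Fin d) ℝ} {a : EuclideanSpace ℝ (Fin d)} {δ : ℝ}
  {αt : ℕ → Ω → EuclideanSpace ℝ (Fin d)}

/-- The expansions of the local maximizers in terms of the inverse of the information matrix. -/
lemma tendstoInMeasure_expansions_inv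
    (hR : RegularCriterion ν h sc Hs K (toEuclideanCLM (𝕜 := ℝ) S) a δ)
    (hX : ∀ i, HasLaw (X i) ν μ) (hindep : iIndepFun X μ) (hS : S.PosDef)
    (hαm : ∀ n, AEMeasurable (αt n) μ)
    (hstat : ∀ n, AEMeasurable (fun ω => empMean X n ω (h (αt n ω))) μ)
    (hmax : ∀ᵐ ω ∂μ, ∀ᶠ n in atTop, αt n ω ∈ interior (Metric.closedBall a (radius13 n)) ∧
        IsMaxOn (fun α => empMean X n ω (h α)) (Metric.closedBall a (radius13 n)) (αt n ω)) :
    TendstoInMeasure μ (fun (n : ℕ) ω => √(n : ℝ) • (αt n ω - a) -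
      toEuclideanCLM (𝕜 := ℝ) S⁻¹ (normScore X sc a n ω)) atTop 0 ∧
    TendstoInMeasure μ (fun (n : ℕ) ω => n * (empMean X n ω (h (αt n ω)) - empMean X n ω (h a)) -
      ⟪normScore X sc a n ω, toEuclideanCLM (𝕜 := ℝ) S⁻¹ (normScore X sc a n ω)⟫ / 2) atTop 0 ∧
    TendstoInMeasure μ (fun (n : ℕ) ω =>
      √(n : ℝ) * (empMean X n ω (h (αt n ω)) - empMean X n ω (h a))) atTop 0 := by
  obtain ⟨c, hc, hSc⟩ := exists_coercive_of_posDef hS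
  refine hR.tendstoInMeasure_expansions hX hindep hc hSc _ (fun v => ?_)
    (inner_toEuclideanCLM_comm hS.isHermitian) hαm hstat hmax
  rw [← mul_apply_eq_comp, ← map_mul, mul_nonsing_inv _ ((isUnit_iff_isUnit_det S).1 hS.isUnit),
    map_one, one_apply_eq_self]

/-- Asymptotic normality of the local maximizers. -/
lemma tendstoInDistribution_argmax
    (hR : RegularCriterion ν h sc Hs K (toEuclideanCLM (𝕜 := ℝ) S) a δ)
    (hX : ∀ i, HasLaw (X i) ν μ) (hindep : iIndepFun X μ) (hS : S.PosDef)
    (hV : ∀ i j, V i j = ∫ x, sc a x i * sc a x j ∂ν)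
    (hαm : ∀ n, AEMeasurable (αt n) μ)
    (hexp : TendstoInMeasure μ (fun (n : ℕ) ω => √(n : ℝ) • (αt n ω - a) -
      toEuclideanCLM (𝕜 := ℝ) S⁻¹ (normScore X sc a n ω)) atTop 0) :
    (S⁻¹ * V * S⁻¹).PosSemidef ∧
      TendstoInDistribution (fun (n : ℕ) ω => √(n : ℝ) • (αt n ω - a)) atTop id (fun _ => μ)
        (multivariateGaussian 0 (S⁻¹ * V * S⁻¹)) := by
  obtain ⟨hVp, hU⟩ := hR.tendstoInDistribution_normScore hX hindep hV
  have hT : (S⁻¹)ᵀ = S⁻¹ := by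
    rw [← conjTranspose_eq_transpose_of_trivial]; exact hS.inv.isHermitian
  have hp : (S⁻¹ * V * (S⁻¹)ᵀ).PosSemidef := by
    rw [← conjTranspose_eq_transpose_of_trivial]; exact hVp.mul_mul_conjTranspose_same _
  have hm := multivariateGaussian_map_toEuclideanCLM hVp S⁻¹ hp
  rw [hT] at hp hm
  refine ⟨hp, tendstoInDistribution_of_tendstoInMeasure_sub _ _
    (tendstoInDistribution_id_of_map_eq
      (hU.continuous_comp (toEuclideanCLM (𝕜 := ℝ) S⁻¹).continuous) hm) hexp fun n => ?_⟩
  exact ((hαm n).sub_const a).const_smul (√(n : ℝ))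

/-- The likelihood-ratio type limit of the maximal value of the criterion. -/
lemma tendstoInDistribution_max_chiSquared
    (hR : RegularCriterion ν h sc Hs K (toEuclideanCLM (𝕜 := ℝ) S) a δ)
    (hX : ∀ i, HasLaw (X i) ν μ) (hindep : iIndepFun X μ) (hS : S.PosDef) {b : ℝ}
    (hb : 0 < b ∨ d = 0) (hV : ∀ i j, (b • S) i j = ∫ x, sc a x i * sc a x j ∂ν)
    (hh : ∀ᵐ x ∂ν, h a x = 0)
    (hstat : ∀ n, AEMeasurable (fun ω => empMean X n ω (h (αt n ω))) μ)
    (hexp : TendstoInMeasure μ (fun (n : ℕ) ω =>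
      n * (empMean X n ω (h (αt n ω)) - empMean X n ω (h a)) -
        ⟪normScore X sc a n ω, toEuclideanCLM (𝕜 := ℝ) S⁻¹ (normScore X sc a n ω)⟫ / 2)
      atTop 0) :
    TendstoInDistribution (fun (n : ℕ) ω => 2 * n / b * empMean X n ω (h (αt n ω))) atTop id
      (fun _ => μ) (chiSquared d) := by
  obtain ⟨hVp, hU⟩ := hR.tendstoInDistribution_normScore hX hindep hV
  -- The score has covariance `b S`, so `⟪x, S⁻¹ x⟫ / b` is the normalized form with a `χ²` law. In
  -- dimension zero `b` may vanish, but all matrices are equal.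
  have hMT : (b • S) * (b⁻¹ • S⁻¹) = 1 := by
    rcases hb with hb | rfl
    · rw [smul_mul_smul_comm, mul_inv_cancel₀ hb.ne',
        mul_nonsing_inv _ ((isUnit_iff_isUnit_det S).1 hS.isUnit), one_smul]
    · exact Subsingleton.elim _ _
  have hm := multivariateGaussian_map_inner_inv hVp hMT
  have ham : ∀ n, AEMeasurable (fun ω => empMean X n ω (h a)) μ := fun n =>
    aemeasurable_empMean hX (hR.aemeasurable a (Metric.mem_ball_self hR.delta_pos)) n
  have hQ : TendstoInDistribution
      (fun (n : ℕ) ω => n * (empMean X n ω (h (αt n ω)) - empMean X n ω (h a))) atTop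
      (fun x => ⟪x, toEuclideanCLM (𝕜 := ℝ) S⁻¹ x⟫ / 2) (fun _ => μ)
      (multivariateGaussian 0 (b • S)) :=
    tendstoInDistribution_of_tendstoInMeasure_sub _ _
      (hU.continuous_comp
        (g := fun x => ⟪x, toEuclideanCLM (𝕜 := ℝ) S⁻¹ x⟫ / 2) (by fun_prop)) hexp
      fun n => ((hstat n).sub (ham n)).const_mul _
  have hQ2 := hQ.continuous_comp (g := fun y => 2 / b * y) (by fun_prop)
  refine tendstoInDistribution_id_of_map_eq (tendstoInDistribution_of_tendstoInMeasure_sub _ _ hQ2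
    ?_ fun n => (hstat n).const_mul _) ?_
  · refine tendstoInMeasure_of_tendsto_ae (fun n => ?_) ?_
    · have h1 := hQ2.forall_aemeasurable n
      exact (((hstat n).const_mul _).sub h1).aestronglyMeasurable
    · filter_upwards [ae_forall_of_hasLaw hX hh] with ω hω
      refine tendsto_const_nhds.congr fun n => ?_
      have h0 : empMean X n ω (h a) = 0 := by simp [empMean, hω]
      simp only [Pi.sub_apply, Function.comp_apply, h0, Pi.zero_apply]
      ring
  · rw [← hm]
    congr 1
    funext x
    simp only [Function.comp_apply, map_smul, _root_.smul_apply, real_inner_smul_right]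
    ring

/-- Asymptotic normality of the maximal value of the criterion. -/
lemma tendstoInDistribution_max_gaussianReal {T : EuclideanSpace ℝ (Fin d) →L[ℝ] _}
    (hR : RegularCriterion ν h sc Hs K T a δ)
    (hX : ∀ i, HasLaw (X i) ν μ) (hindep : iIndepFun X μ) (hh : MemLp (h a) 2 ν)
    (hstat : ∀ n, AEMeasurable (fun ω => empMean X n ω (h (αt n ω))) μ)
    (hexp : TendstoInMeasure μ (fun (n : ℕ) ω =>
      √(n : ℝ) * (empMean X n ω (h (αt n ω)) - empMean X n ω (h a))) atTop 0) :
    TendstoInDistribution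
      (fun (n : ℕ) ω => √(n : ℝ) * (empMean X n ω (h (αt n ω)) - ∫ x, h a x ∂ν)) atTop id
      (fun _ => μ) (gaussianReal 0 Var[h a; ν].toNNReal) := by
  have hm := hR.aemeasurable a (Metric.mem_ball_self hR.delta_pos)
  have hmap := (hX 0).map_eq
  have hm0 : AEMeasurable (h a) (μ.map (X 0)) := hmap.symm ▸ hm
  have hL2 : MemLp (fun ω => h a (X 0 ω)) 2 μ :=
    (hmap.symm ▸ hh : MemLp (h a) 2 (μ.map (X 0))).comp_of_map (hX 0).aemeasurable
  have hmean : ∫ ω, h a (X 0 ω) ∂μ = ∫ x, h a x ∂ν :=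
    (hX 0).integral_comp hm.aestronglyMeasurable
  have hvar : Var[fun ω => h a (X 0 ω); μ] = Var[h a; ν] := by
    rw [← hmap, variance_map hm0 (hX 0).aemeasurable]
    rfl
  have hclt := tendstoInDistribution_inv_sqrt_mul_sum_sub (P := μ)
    (X := fun i ω => h a (X i ω)) (Y := id) (P' := gaussianReal 0 Var[h a; ν].toNNReal)
    (by rw [hvar]; exact HasLaw.id) hL2 (iIndepFun_comp hX hindep hm) (identDistrib_comp hX hm)
  refine tendstoInDistribution_of_tendstoInMeasure_sub _ _ hclt ?_
    fun n => ((hstat n).sub_const _).const_mul _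
  -- The two normalized statistics differ exactly by `√n` times the gain from maximizing.
  convert hexp using 1
  ext n ω
  simp only [Pi.sub_apply, hmean, empMean, smul_eq_mul]
  rcases Nat.eq_zero_or_pos n with rfl | hn
  · simp
  · have hn' : 0 < √(n : ℝ) := Real.sqrt_pos.2 (by exact_mod_cast hn)
    have hs : (n : ℝ) = √(n : ℝ) * √(n : ℝ) := (Real.mul_self_sqrt n.cast_nonneg).symm
    generalize √(n : ℝ) = r at *
    rw [hs]
    field_simp
    ring

end RegularCriterion

/-- Inside the parameter space, `ball13` is a closed ball. -/
lemma ball13_eq_closedBall {d : ℕ} {𝒳 : Type*} [MeasurableSpace 𝒳] {M : Model d 𝒳}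
    {a : EuclideanSpace ℝ (Fin d)} {δ : ℝ} (hδ : Metric.ball a δ ⊆ M.Θ) {n : ℕ}
    (hn : radius13 n < δ) : ball13 M a n = Metric.closedBall a (radius13 n) := by
  ext α
  rw [mem_closedBall_iff_norm]
  exact ⟨fun h => h.2, fun h => ⟨hδ (mem_ball_iff_norm.2 (h.trans_lt hn)), h⟩⟩

end Limits

end PhiDivergence

/-! ### The main theorem -/

theorem mainTheorem5 {d : ℕ} {𝒳 : Type*} [MeasurableSpace 𝒳] (M : Model d 𝒳)
    (φ : ℝ → ℝ≥0∞) (hφ : IsGenerator φ)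
    (θ θT : EuclideanSpace ℝ (Fin d)) (hθ : θ ∈ M.Θ) (hθT : θT ∈ interior M.Θ)
    (hp : ∀ᵐ x ∂M.lam, ContDiffOn ℝ 3 (fun α => M.p α x) (interior M.Θ))
    (hint : RatioIntegrable φ M θ)
    (hA1 : AssumptionA1 φ M θ θT) (hA2 : AssumptionA2 φ M θ θT)
    {Ω : Type*} [MeasurableSpace Ω] (μ : Measure Ω) [IsProbabilityMeasure μ]
    (X : ℕ → Ω → 𝒳) (hX : ∀ i, HasLaw (X i) (M.P θT) μ) (hindep : iIndepFun X μ) :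
    (∃ αt, IsLocalMaximizer μ φ M θ θT X αt) ∧
    ∀ αt, IsLocalMaximizer μ φ M θ θT X αt →
      (∀ᵐ ω ∂μ, ∀ᶠ n : ℕ in atTop, empMean X n ω (score φ M θ (αt n ω)) = 0) ∧
      ((matV φ M θ θT).PosSemidef ∧
        TendstoInDistribution (fun (n : ℕ) ω => √(n : ℝ) • (αt n ω - θT)) atTop id (fun _ => μ)
          (multivariateGaussian 0 (matV φ M θ θT))) ∧
      (θT = θ →
        TendstoInDistribution
          (fun (n : ℕ) ω => 2 * n / deriv (dphi φ) 1 * empMean X n ω (hFun φ M θ (αt n ω)))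
          atTop id (fun _ => μ) (chiSquared d)) ∧
      (AssumptionA3 φ M θ θT → θ ≠ θT →
        phiDiv φ (M.P θ) (M.P θT) ≠ ∞ ∧
        TendstoInDistribution
          (fun (n : ℕ) ω => √(n : ℝ) *
            (empMean X n ω (hFun φ M θ (αt n ω)) - (phiDiv φ (M.P θ) (M.P θT)).toReal))
          atTop id (fun _ => μ) (gaussianReal 0 (sigmaSq φ M θ θT).toNNReal)) := by
  obtain ⟨N, G, H, hL⟩ := exists_localRegularity hφ hθ hp hint hA1
  have hS := hL.matS_posDef hA2
  obtain ⟨Hs, K, δ, hR, hball⟩ := hL.exists_regularCriterion hA2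
  -- Once the radius is below `δ`, the constraint `α ∈ Θ` is void and the results for closed balls
  -- apply.
  have hev : ∀ᶠ n in atTop, ball13 M θT n = Metric.closedBall θT (radius13 n) := by
    filter_upwards [tendsto_radius13.eventually_lt_const hR.delta_pos] with n hn
    exact ball13_eq_closedBall hball hn
  have hmax : ∀ αt : ℕ → Ω → EuclideanSpace ℝ (Fin d),
      (∀ᵐ ω ∂μ, ∀ᶠ n : ℕ in atTop, αt n ω ∈ interior (ball13 M θT n) ∧
        IsMaxOn (fun α => empMean X n ω (hFun φ M θ α)) (ball13 M θT n) (αt n ω)) ↔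
      ∀ᵐ ω ∂μ, ∀ᶠ n : ℕ in atTop,
        αt n ω ∈ interior (Metric.closedBall θT (radius13 n)) ∧
        IsMaxOn (fun α => empMean X n ω (hFun φ M θ α)) (Metric.closedBall θT (radius13 n))
          (αt n ω) := fun αt =>
    eventually_congr <| ae_of_all _ fun ω => eventually_congr <| hev.mono fun n hn => by rw [hn]
  constructor
  · obtain ⟨c, hc, hSc⟩ := exists_coercive_of_posDef hS
    obtain ⟨αt, h1, h2, h3⟩ := hR.exists_local_maximizer hX hindep hc hSc
    exact ⟨αt, h1, h2, (hmax αt).2 h3⟩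
  intro αt hαt
  have hmax' := (hmax αt).1 hαt.isMax
  obtain ⟨hexp, hexp2, hexp1⟩ := hR.tendstoInMeasure_expansions_inv hX hindep hS hαt.aemeasurable
    hαt.aemeasurable_stat hmax'
  refine ⟨hR.ae_eventually_score_eq_zero hX hindep hmax',
    hR.tendstoInDistribution_argmax hX hindep hS (V := matM φ M θ θT) (fun _ _ => rfl)
      hαt.aemeasurable hexp, ?_, fun hA3 _ => ?_⟩
  · rintro rfl
    obtain ⟨hb, hM⟩ := hL.matM_eq_smul_matS hA2
    exact hR.tendstoInDistribution_max_chiSquared hX hindep hS hb (fun i j => by rw [← hM]; rfl)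
      hL.ae_hFun_self hαt.aemeasurable_stat hexp2
  · have := Model.isProbabilityMeasure_P hL.mem_T
    have hmem : MemLp (hFun φ M θ θT) 2 (M.P θT) :=
      (memLp_two_iff_integrable_sq
        (measurable_hFun hφ hθ hL.mem_T).aestronglyMeasurable).2 hA3
    obtain ⟨hfin, hD⟩ := phiDiv_eq_integral_hFun hθ hL.mem_T hL.ae_regular hint
      (hmem.integrable one_le_two)
    have hvar : Var[hFun φ M θ θT; M.P θT] = sigmaSq φ M θ θT := variance_eq_sub hmem
    refine ⟨hfin, ?_⟩
    rw [hD, ← hvar]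
    exact hR.tendstoInDistribution_max_gaussianReal hX hindep hmem hαt.aemeasurable_stat hexp1
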